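/- Let $X_t=\sum_{i=1}^{N_t}\varepsilon_i$, $t\ge 0$, where $(N_t)$ is, under $\mathbb P_\vartheta$, a homogeneous Poisson process with intensity $\vartheta>0$, and where the $\varepsilon_i$ are independent, independent of $N$, and equal to $\pm 1$ with probability $\tfrac12$ each. For every $T>0$ let $0<\Delta_T\le T$, and observe $X_0,X_{\Delta_T},X_{2\Delta_T},\ldots,X_{n_T\Delta_T}$ with $n_T=\lfloor T/\Delta_T\rfloor$. For $k\in\mathbb Z$ put $f_\Delta(\vartheta,k)=\mathbb P_\vartheta(X_\Delta=k)$, and define $$\widehat\vartheta^{QV}_{T}=\frac1T\sum_{i=1}^{n_T}\big(X_{i\Delta_T}-X_{(i-1)\Delta_T}\big)^2,\qquad \widehat\vartheta^{OS}_{T}=\widehat\vartheta^{QV}_{T}-\frac{\sum_{i=1}^{n_T}\partial_\vartheta\log f_{\Delta_T}\big(\widehat\vartheta^{QV}_{T},X_{i\Delta_T}-X_{(i-1)\Delta_T}\big)}{\sum_{i=1}^{n_T}\partial^2_\vartheta\log f_{\Delta_T}\big(\widehat\vartheta^{QV}_{T},X_{i\Delta_T}-X_{(i-1)\Delta_T}\big)}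 .$$ Let $\mathcal I_\nu(x)=\sum_{m\ge0}\frac{(x/2)^{2m+\nu}}{m!\,(\nu+m)!}$ be the modified Bessel function of the first kind, $h_\Delta(\vartheta,k)=\mathcal I_{|k|+1}(\vartheta\Delta)/\mathcal I_{|k|}(\vartheta\Delta)$, and, for $\Delta>0$, $$I_{T,\Delta}(\vartheta)=T\Delta\,\mathbb E_\vartheta\Big[\big(h_\Delta(\vartheta,X_\Delta)+(\vartheta\Delta)^{-1}|X_\Delta|-1\big)^2\Big],\qquad \mathfrak I_{T,\Delta}(\vartheta)=\lfloor T/\Delta\rfloor\,\mathbb E_\vartheta\big[(\partial_\vartheta\log f_\Delta(\vartheta,X_\Delta))^2\big],$$ the latter being the Fisher information of the observed increments. **Theorem.** Let $\vartheta>0$, and assume that, as $T\to\infty$, one of the following holds: $\Delta_T\to0$ (microscopic regime), or $\Delta_T\to\Delta_\infty\in(0,\infty)$ (intermediate regime), or $\Delta_T\to\infty$ and $T/\Delta_T\to\infty$ (macroscopic regime). Then $$I_{T,\Delta_T}(\vartheta)^{1/2}\big(\widehat\vartheta^{OS}_{T}-\vartheta\big)\longrightarrow\mathcal N(0,1)\quad\text{in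 distribution under }\mathbb P_\vartheta\text{ as }T\to\infty .$$ The one-step estimator is therefore efficient on all scales: the same convergence holds with $I_{T,\Delta_T}(\vartheta)$ replaced by the Fisher information $\mathfrak I_{T,\Delta_T}(\vartheta)$, and also with $I_{T,\Delta_T}(\vartheta)$ replaced by the information of the respective regime, namely $T/\vartheta$ in the microscopic regime, $I_{T,\Delta_\infty}(\vartheta)$ in the intermediate regime, and $T/(2\vartheta^2\Delta_T)$ in the macroscopic regime. -/

import Mathlib

open MeasureTheory ProbabilityTheory Filter Topology
open scoped NNReal ENNReal

noncomputable section

namespace TimeScales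

/-- `N` is a standard homogeneous Poisson process with intensity `ϑ` under `P`: it starts from `0`,
its paths are nondecreasing and right-continuous, and its increments over disjoint intervals are
independent, the increment over `[s, t]` having the Poisson law with parameter `ϑ (t - s)`. -/
structure IsPoissonProcess {Ω : Type*} [MeasurableSpace Ω]
    (N : ℝ≥0 → Ω → ℕ) (ϑ : ℝ) (P : Measure Ω) : Prop where
  measurable : ∀ t, Measurable (N t)
  zero : ∀ᵐ ω ∂P, N 0 ω = 0
  paths : ∀ᵐ ω ∂P, Monotone (fun t => N t ω) ∧
    ∀ t, ContinuousWithinAt (fun s => N s ω) (Set.Ici t) t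
  indep_increments : HasIndepIncrements (fun t ω => (N t ω : ℤ)) P
  increments : ∀ s t : ℝ≥0, s ≤ t →
    HasLaw (fun ω => (N t ω : ℤ) - (N s ω : ℤ))
      ((poissonMeasure (Real.toNNReal (ϑ * ((t : ℝ) - s)))).map (Nat.cast : ℕ → ℤ)) P

/-- The ingredients of the compound Poisson process with symmetric Bernoulli jumps and intensity
`ϑ`: a Poisson process `N` with intensity `ϑ`, and an independent sequence of independent signs
`ε i`, each equal to `1` or `-1` with probability `1 / 2`. The sequence is indexed from `0`, so
that `ε i` is the `(i + 1)`-st jump. -/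
structure IsModel {Ω : Type*} [MeasurableSpace Ω]
    (N : ℝ≥0 → Ω → ℕ) (ε : ℕ → Ω → ℤ) (ϑ : ℝ) (P : Measure Ω) : Prop where
  poisson : IsPoissonProcess N ϑ P
  jump_measurable : ∀ i, Measurable (ε i)
  jump_pos : ∀ i, P {ω | ε i ω = 1} = 1 / 2
  jump_neg : ∀ i, P {ω | ε i ω = -1} = 1 / 2
  jump_indep : iIndepFun ε P
  indep : IndepFun (fun ω i => ε i ω) (fun ω t => N t ω) P

/-- The process `X_t = ∑_{i = 1}^{N_t} ε_i`, started from `X_0 = 0`. -/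
def process {Ω : Type*} (N : ℝ≥0 → Ω → ℕ) (ε : ℕ → Ω → ℤ) (t : ℝ≥0) (ω : Ω) : ℤ :=
  ∑ i ∈ Finset.range (N t ω), ε i ω

/-- The likelihood of one increment, `f_Δ(ϑ, k) = P_ϑ(X_Δ = k)`. -/
def likelihood {Ω : Type*} [MeasurableSpace Ω] (P : ℝ → Measure Ω) (X : ℝ≥0 → Ω → ℤ)
    (Δ : ℝ≥0) (ϑ : ℝ) (k : ℤ) : ℝ :=
  (P ϑ).real {ω | X Δ ω = k}

/-- The score `∂_ϑ log f(ϑ, k)`. -/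
def score (f : ℝ → ℤ → ℝ) (ϑ : ℝ) (k : ℤ) : ℝ :=
  deriv (fun θ => Real.log (f θ k)) ϑ

/-- The second derivative `∂²_ϑ log f(ϑ, k)`. -/
def scoreDeriv (f : ℝ → ℤ → ℝ) (ϑ : ℝ) (k : ℤ) : ℝ :=
  deriv (fun θ => score f θ k) ϑ

/-- The number `⌊T / Δ⌋` of observed increments. -/
def numObs (T Δ : ℝ≥0) : ℕ := ⌊T / Δ⌋₊

/-- The quadratic variation estimator, as a function of the data `x i = X_{iΔ}`. -/
def qvEstimator (T Δ : ℝ≥0) (x : ℕ → ℤ) : ℝ :=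
  1 / (T : ℝ) * ∑ i ∈ Finset.range (numObs T Δ), ((x (i + 1) - x i : ℤ) : ℝ) ^ 2

/-- The one-step estimator: one Newton-Raphson iteration for the log-likelihood built on `f`,
started from the quadratic variation estimator. -/
def osEstimator (f : ℝ → ℤ → ℝ) (T Δ : ℝ≥0) (x : ℕ → ℤ) : ℝ :=
  qvEstimator T Δ x -
    (∑ i ∈ Finset.range (numObs T Δ), score f (qvEstimator T Δ x) (x (i + 1) - x i)) /
      (∑ i ∈ Finset.range (numObs T Δ), scoreDeriv f (qvEstimator T Δ x) (x (i + 1) - x i))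

/-- The one-step estimator evaluated at the observation `(X_0, X_Δ, X_{2Δ}, …)`. -/
def oneStep {Ω : Type*} [MeasurableSpace Ω] (P : ℝ → Measure Ω) (X : ℝ≥0 → Ω → ℤ)
    (T Δ : ℝ≥0) (ω : Ω) : ℝ :=
  osEstimator (likelihood P X Δ) T Δ (fun i => X (i * Δ) ω)

/-- The modified Bessel function of the first kind `I_ν`, for integer order. -/
def besselI (ν : ℕ) (x : ℝ) : ℝ :=
  ∑' m : ℕ, (x / 2) ^ (2 * m + ν) / ((m.factorial : ℝ) * ((ν + m).factorial : ℝ))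

/-- The ratio `h_Δ(ϑ, k) = I_{|k|+1}(ϑΔ) / I_{|k|}(ϑΔ)`. -/
def besselRatio (Δ ϑ : ℝ) (k : ℤ) : ℝ :=
  besselI (k.natAbs + 1) (ϑ * Δ) / besselI k.natAbs (ϑ * Δ)

/-- The information
`I_{T,Δ}(ϑ) = T Δ E_ϑ[(h_Δ(ϑ, X_Δ) + (ϑΔ)⁻¹ |X_Δ| - 1)²]`. -/
def information {Ω : Type*} [MeasurableSpace Ω] (P : ℝ → Measure Ω) (X : ℝ≥0 → Ω → ℤ)
    (T Δ : ℝ≥0) (ϑ : ℝ) : ℝ :=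
  (T : ℝ) * (Δ : ℝ) *
    ∫ ω, (besselRatio Δ ϑ (X Δ ω) + (ϑ * (Δ : ℝ))⁻¹ * |(X Δ ω : ℝ)| - 1) ^ 2 ∂(P ϑ)

/-- The exact Fisher information `⌊T/Δ⌋ E_ϑ[(∂_ϑ log f_Δ(ϑ, X_Δ))²]` of the experiment generated
by the `⌊T/Δ⌋` independent, identically distributed increments. -/
def fisherInformation {Ω : Type*} [MeasurableSpace Ω] (P : ℝ → Measure Ω) (X : ℝ≥0 → Ω → ℤ)
    (T Δ : ℝ≥0) (ϑ : ℝ) : ℝ :=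
  (numObs T Δ : ℝ) * ∫ ω, (score (likelihood P X Δ) ϑ (X Δ ω)) ^ 2 ∂(P ϑ)

/-- Microscopic scale: `Δ_T → 0`. -/
def IsMicroscopic (Δ : ℝ≥0 → ℝ≥0) : Prop := Tendsto Δ atTop (𝓝 0)

/-- Intermediate scale with limit `Δ_∞ ∈ (0, ∞)`: `Δ_T → Δ_∞`. -/
def IsIntermediate (Δ : ℝ≥0 → ℝ≥0) (Δinf : ℝ≥0) : Prop := 0 < Δinf ∧ Tendsto Δ atTop (𝓝 Δinf)

/-- Macroscopic scale: `Δ_T → ∞` and `T / Δ_T → ∞`. -/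
def IsMacroscopic (Δ : ℝ≥0 → ℝ≥0) : Prop :=
  Tendsto Δ atTop atTop ∧ Tendsto (fun T => T / Δ T) atTop atTop

/-- `a_T^{1/2} (Y_T - ϑ) → N(0, 1)` in distribution under `P` as `T → ∞`. -/
def AsympStandardNormal {Ω : Type*} [MeasurableSpace Ω] (P : Measure Ω) [IsProbabilityMeasure P]
    (a : ℝ≥0 → ℝ) (Y : ℝ≥0 → Ω → ℝ) (ϑ : ℝ) : Prop :=
  TendstoInDistribution (fun (T : ℝ≥0) (ω : Ω) => Real.sqrt (a T) * (Y T ω - ϑ)) atTop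
    (id : ℝ → ℝ) (fun _ => P) (gaussianReal 0 1)

end TimeScales

end

/-!
The law of an increment depends on `(ϑ, Δ)` only through `y = ϑ * Δ`: it is the Skellam law of the
difference of two independent Poisson variables with parameter `y / 2`. Its score is a quotient of
Bessel functions up to elementary terms and therefore solves a Riccati equation. Compared with the
information `J y` of one observation, the fourth moment of the score, the second moment of its
derivative and the mean oscillation of that derivative are then bounded in terms of `1 + 1 / y`
alone, uniformly in `y > 0`. So all errors in an array of `n` increments are controlled by
`n / (1 + 1 / y)`, which tends to infinity with `T` and `T / Δ_T`: Lyapunov's theorem applies to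
the score sum, and the quadratic variation estimator is close enough to `ϑ` for one Newton step to
leave only a negligible error. The three regimes matter only through the behaviour of `J` at `0`,
at a positive point and at infinity.
-/

noncomputable section

namespace TimeScales

/-! ### Modified Bessel functions of integer order -/

section Bessel

/-- The `m`-th term `y ^ m / (m! (ν + m)!)` of the power series `besselSeries ν`. -/
def besselTerm (ν m : ℕ) (y : ℝ) : ℝ := y ^ m / ((m.factorial : ℝ) * ((ν + m).factorial : ℝ))

/-- The entire function `F_ν` with `I_ν(x) = (x / 2) ^ ν * F_ν(x ^ 2 / 4)`. Unlike `I_ν`, it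
satisfies `F_ν' = F_{ν + 1}`. -/
def besselSeries (ν : ℕ) (y : ℝ) : ℝ := ∑' m, besselTerm ν m y

lemma abs_besselTerm_le (ν m : ℕ) (y : ℝ) :
    |besselTerm ν m y| ≤ |y| ^ m / (m.factorial : ℝ) := by
  rw [besselTerm, abs_div, abs_pow, abs_of_pos (by positivity : (0 : ℝ) < m.factorial * _)]
  gcongr
  exact le_mul_of_one_le_right (by positivity) (by exact_mod_cast Nat.factorial_pos _)

lemma summable_besselTerm (ν : ℕ) (y : ℝ) : Summable fun m => besselTerm ν m y :=
  .of_norm_bounded (Real.summable_pow_div_factorial |y|) fun m => abs_besselTerm_le ν m y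

lemma hasDerivAt_besselTerm_succ (ν m : ℕ) (y : ℝ) :
    HasDerivAt (besselTerm ν (m + 1)) (besselTerm (ν + 1) m y) y := by
  refine ((hasDerivAt_pow (m + 1) y).div_const _).congr_deriv ?_
  rw [besselTerm, Nat.factorial_succ, show ν + 1 + m = ν + (m + 1) by ring]
  push_cast
  have : (m.factorial : ℝ) ≠ 0 := by positivity
  field_simp

lemma hasDerivAt_besselSeries (ν : ℕ) (y : ℝ) :
    HasDerivAt (besselSeries ν) (besselSeries (ν + 1) y) y := by
  have hy : y ∈ Metric.ball (0 : ℝ) (|y| + 1) := by simp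
  have htail : HasDerivAt (fun z => ∑' m, besselTerm ν (m + 1) z) (besselSeries (ν + 1) y) y := by
    refine hasDerivAt_tsum_of_isPreconnected (Real.summable_pow_div_factorial (|y| + 1))
      Metric.isOpen_ball (convex_ball 0 (|y| + 1)).isPreconnected
      (fun m z _ => hasDerivAt_besselTerm_succ ν m z) (fun m z hz => ?_) hy
      ((summable_nat_add_iff 1).2 (summable_besselTerm ν y)) hy
    rw [mem_ball_zero_iff, Real.norm_eq_abs] at hz
    exact (abs_besselTerm_le _ _ _).trans (by gcongr)
  have hsplit : besselSeries ν = fun z => besselTerm ν 0 z + ∑' m, besselTerm ν (m + 1) z :=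
    funext fun z => (summable_besselTerm ν z).tsum_eq_zero_add
  rw [hsplit]
  simpa [besselTerm] using htail.const_add (1 / (ν.factorial : ℝ))

lemma besselSeries_recurrence (ν : ℕ) (y : ℝ) :
    besselSeries ν y = y * besselSeries (ν + 2) y + (ν + 1) * besselSeries (ν + 1) y := by
  have hshift : HasSum (fun m : ℕ => m * besselTerm (ν + 1) m y) (y * besselSeries (ν + 2) y) := by
    rw [← hasSum_nat_add_iff' 1]
    simp only [Finset.range_one, Finset.sum_singleton, Nat.cast_zero, zero_mul, sub_zero]
    refine ((summable_besselTerm (ν + 2) y).hasSum.mul_left y).congr_fun fun m => ?_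
    rw [besselTerm, besselTerm, Nat.factorial_succ, show ν + 2 + m = ν + 1 + (m + 1) by ring]
    push_cast
    have : (m.factorial : ℝ) ≠ 0 := by positivity
    field_simp
    ring
  refine ((hshift.add ((summable_besselTerm (ν + 1) y).hasSum.mul_left ((ν : ℝ) + 1))).congr_fun
    fun m => ?_).tsum_eq
  rw [besselTerm, besselTerm, show ν + 1 + m = (ν + m) + 1 by ring, Nat.factorial_succ]
  push_cast
  have : (m.factorial : ℝ) ≠ 0 := by positivity
  field_simp
  ring

lemma besselSeries_pos (ν : ℕ) {y : ℝ} (hy : 0 ≤ y) : 0 < besselSeries ν y := by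
  refine (summable_besselTerm ν y).tsum_pos (fun m => ?_) 0 ?_ <;> rw [besselTerm] <;> positivity

lemma besselSeries_mono (ν : ℕ) {x y : ℝ} (hx : 0 ≤ x) (hxy : x ≤ y) :
    besselSeries ν x ≤ besselSeries ν y :=
  (summable_besselTerm ν x).tsum_le_tsum
    (fun m => by simp only [besselTerm]; gcongr) (summable_besselTerm ν y)

lemma besselSeries_le (ν : ℕ) {y : ℝ} (hy : 0 ≤ y) :
    besselSeries ν y ≤ Real.exp y / (ν.factorial : ℝ) := by
  rw [Real.exp_eq_exp_ℝ, NormedSpace.exp_eq_tsum_div, ← tsum_div_const]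
  refine (summable_besselTerm ν y).tsum_le_tsum (fun m => ?_)
    ((Real.summable_pow_div_factorial y).div_const _)
  rw [besselTerm, div_div]
  gcongr
  exact Nat.le_add_right ν m

lemma besselI_eq_pow_mul_besselSeries (ν : ℕ) (x : ℝ) :
    besselI ν x = (x / 2) ^ ν * besselSeries ν (x ^ 2 / 4) := by
  rw [besselI, besselSeries, ← tsum_mul_left]
  refine tsum_congr fun m => ?_
  rw [besselTerm, show x ^ 2 / 4 = (x / 2) ^ 2 by ring, ← pow_mul, pow_add]
  ring

lemma besselI_pos (ν : ℕ) {x : ℝ} (hx : 0 < x) : 0 < besselI ν x := by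
  rw [besselI_eq_pow_mul_besselSeries]
  exact mul_pos (by positivity) (besselSeries_pos ν (by positivity))

lemma besselI_le (ν : ℕ) {x : ℝ} (hx : 0 ≤ x) :
    besselI ν x ≤ Real.exp (x ^ 2 / 4) * ((x / 2) ^ ν / (ν.factorial : ℝ)) := by
  rw [besselI_eq_pow_mul_besselSeries, mul_div_left_comm]
  gcongr
  exact besselSeries_le ν (by positivity)

lemma besselI_mono (ν : ℕ) {x y : ℝ} (hx : 0 ≤ x) (hxy : x ≤ y) :
    besselI ν x ≤ besselI ν y := by
  rw [besselI_eq_pow_mul_besselSeries, besselI_eq_pow_mul_besselSeries]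
  have hy : 0 ≤ y := hx.trans hxy
  have := (besselSeries_pos ν (y := x ^ 2 / 4) (by positivity)).le
  gcongr
  exact besselSeries_mono ν (by positivity) (by gcongr)

lemma besselI_recurrence (ν : ℕ) {x : ℝ} (hx : x ≠ 0) :
    besselI ν x = besselI (ν + 2) x + 2 * (ν + 1) / x * besselI (ν + 1) x := by
  simp only [besselI_eq_pow_mul_besselSeries]
  rw [besselSeries_recurrence ν]
  field_simp
  ring

lemma continuous_besselI (ν : ℕ) : Continuous (besselI ν) := by
  have : Continuous (besselSeries ν) :=
    continuous_iff_continuousAt.2 fun y => (hasDerivAt_besselSeries ν y).continuousAt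
  rw [funext (besselI_eq_pow_mul_besselSeries ν)]
  fun_prop

lemma hasDerivAt_besselI (ν : ℕ) {x : ℝ} (hx : x ≠ 0) :
    HasDerivAt (besselI ν) (besselI (ν + 1) x + ν / x * besselI ν x) x := by
  have hpow : HasDerivAt (fun x : ℝ => (x / 2) ^ ν) ((ν : ℝ) * (x / 2) ^ (ν - 1) * (1 / 2)) x :=
    ((hasDerivAt_id x).div_const 2).pow ν
  have hsq : HasDerivAt (fun x : ℝ => x ^ 2 / 4) (x / 2) x :=
    ((hasDerivAt_pow 2 x).div_const 4).congr_deriv (by norm_num; ring)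
  simp only [besselI_eq_pow_mul_besselSeries, funext (besselI_eq_pow_mul_besselSeries ν)]
  refine (hpow.mul ((hasDerivAt_besselSeries ν (x ^ 2 / 4)).comp x hsq)).congr_deriv ?_
  rcases ν with _ | n
  · simp; ring
  · simp only [Nat.add_sub_cancel, Function.comp_def]
    push_cast
    field_simp
    ring

lemma hasDerivAt_besselI_succ (ν : ℕ) {x : ℝ} (hx : x ≠ 0) :
    HasDerivAt (besselI (ν + 1)) (besselI ν x - (ν + 1) / x * besselI (ν + 1) x) x := by
  refine (hasDerivAt_besselI (ν + 1) hx).congr_deriv ?_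
  rw [besselI_recurrence ν hx]
  push_cast
  ring

lemma monotoneOn_besselI_sq_sub (ν : ℕ) :
    MonotoneOn (fun x => besselI ν x ^ 2 - besselI (ν + 1) x ^ 2) (Set.Ici 0) := by
  have hd : ∀ x : ℝ, 0 < x → HasDerivAt (fun z => besselI ν z ^ 2 - besselI (ν + 1) z ^ 2)
      (2 * ν / x * besselI ν x ^ 2 + 2 * (ν + 1) / x * besselI (ν + 1) x ^ 2) x := by
    intro x hx
    refine (((hasDerivAt_besselI ν hx.ne').pow 2).sub
      ((hasDerivAt_besselI_succ ν hx.ne').pow 2)).congr_deriv ?_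
    push_cast
    ring
  refine monotoneOn_of_hasDerivWithinAt_nonneg (convex_Ici 0)
    (((continuous_besselI ν).pow 2).sub ((continuous_besselI (ν + 1)).pow 2)).continuousOn
    (f' := fun x => 2 * ν / x * besselI ν x ^ 2 + 2 * (ν + 1) / x * besselI (ν + 1) x ^ 2) ?_ ?_ <;>
  · intro x hx
    rw [interior_Ici, Set.mem_Ioi] at hx
    first | exact (hd x hx).hasDerivWithinAt | positivity

lemma besselI_succ_le (ν : ℕ) {x : ℝ} (hx : 0 < x) : besselI (ν + 1) x ≤ besselI ν x := by
  have hzero : besselI (ν + 1) 0 = 0 := by simp [besselI_eq_pow_mul_besselSeries]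
  have hmono := monotoneOn_besselI_sq_sub ν (Set.mem_Ici.2 le_rfl) (Set.mem_Ici.2 hx.le) hx.le
  simp only [hzero] at hmono
  have hsq : besselI (ν + 1) x ^ 2 ≤ besselI ν x ^ 2 := by nlinarith [sq_nonneg (besselI ν 0)]
  exact (pow_le_pow_iff_left₀ (besselI_pos _ hx).le (besselI_pos _ hx).le two_ne_zero).1 hsq

/-- The quotient `I_{k+1}(x) / I_k(x)` of consecutive Bessel functions. -/
def besselQuot (k : ℕ) (x : ℝ) : ℝ := besselI (k + 1) x / besselI k x

variable (k : ℕ) {x : ℝ}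

lemma besselQuot_pos (hx : 0 < x) : 0 < besselQuot k x :=
  div_pos (besselI_pos _ hx) (besselI_pos _ hx)

lemma besselQuot_le_one (hx : 0 < x) : besselQuot k x ≤ 1 :=
  (div_le_one (besselI_pos _ hx)).2 (besselI_succ_le k hx)

lemma one_div_besselQuot (hx : 0 < x) :
    1 / besselQuot k x = besselQuot (k + 1) x + 2 * (k + 1) / x := by
  have := besselI_pos (k + 1) hx
  rw [besselQuot, besselQuot, one_div_div, besselI_recurrence k hx.ne']
  field_simp

lemma two_mul_besselQuot_le (hx : 0 < x) : 2 * (k + 1) * besselQuot k x ≤ x := by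
  have hinv : 2 * ((k : ℝ) + 1) / x ≤ 1 / besselQuot k x := by
    linarith [one_div_besselQuot k hx, besselQuot_pos (k + 1) hx]
  rwa [div_le_div_iff₀ hx (besselQuot_pos k hx), one_mul] at hinv

lemma le_besselQuot (hx : 0 < x) : x / (x + 2 * (k + 1)) ≤ besselQuot k x := by
  have hinv : 1 / besselQuot k x ≤ (x + 2 * (k + 1)) / x := by
    rw [one_div_besselQuot k hx, add_div, div_self hx.ne']
    gcongr
    exact besselQuot_le_one _ hx
  rwa [one_div_le (besselQuot_pos k hx) (by positivity), one_div_div] at hinv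

lemma hasDerivAt_besselQuot (hx : 0 < x) : HasDerivAt (besselQuot k)
    (1 - besselQuot k x ^ 2 - (2 * k + 1) / x * besselQuot k x) x := by
  have := besselI_pos k hx
  refine ((hasDerivAt_besselI_succ k hx.ne').div (hasDerivAt_besselI k hx.ne')
    this.ne').congr_deriv ?_
  simp only [besselQuot]
  field_simp
  ring

lemma abs_deriv_besselQuot_le (hx : 0 < x) :
    |1 - besselQuot k x ^ 2 - (2 * k + 1) / x * besselQuot k x| ≤ 1 := by
  have hpos := besselQuot_pos k hx
  have hsq : besselQuot k x ^ 2 ≤ 1 := pow_le_one₀ hpos.le (besselQuot_le_one k hx)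
  have hle : (2 * (k : ℝ) + 1) / x * besselQuot k x ≤ 1 := by
    rw [div_mul_eq_mul_div, div_le_one hx]
    linarith [two_mul_besselQuot_le k hx]
  have hnonneg : 0 ≤ (2 * (k : ℝ) + 1) / x * besselQuot k x := by positivity
  rw [abs_le]
  constructor <;> linarith [sq_nonneg (besselQuot k x)]

end Bessel

/-! ### The symmetric Skellam distribution -/

/-- The probability mass function of the symmetric Skellam distribution with variance `x`, i.e.
the law at time `x / ϑ` of the compound Poisson process with intensity `ϑ` and fair `±1` jumps. -/
def skellam (x : ℝ) (k : ℤ) : ℝ := Real.exp (-x) * besselI k.natAbs x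

/-- The score `∂_x log (skellam x k)` of the symmetric Skellam distribution, in closed form. -/
def skellamScore (x : ℝ) (k : ℤ) : ℝ := besselQuot k.natAbs x + (k.natAbs : ℝ) / x - 1

/-- The second derivative `∂²_x log (skellam x k)`, in closed form. -/
def skellamScoreDeriv (x : ℝ) (k : ℤ) : ℝ :=
  1 - besselQuot k.natAbs x ^ 2 - (2 * k.natAbs + 1) / x * besselQuot k.natAbs x
    - (k.natAbs : ℝ) / x ^ 2

/-- The third derivative `∂³_x log (skellam x k)`, in closed form. -/
def skellamScoreDeriv₂ (x : ℝ) (k : ℤ) : ℝ :=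
  -(2 * besselQuot k.natAbs x + (2 * k.natAbs + 1) / x) *
      (1 - besselQuot k.natAbs x ^ 2 - (2 * k.natAbs + 1) / x * besselQuot k.natAbs x)
    + (2 * k.natAbs + 1) / x ^ 2 * besselQuot k.natAbs x + 2 * k.natAbs / x ^ 3

lemma skellam_neg (x : ℝ) (k : ℤ) : skellam x (-k) = skellam x k := by
  rw [skellam, skellam, Int.natAbs_neg]

section

variable {x : ℝ} (hx : 0 < x) (k : ℤ)
include hx

lemma skellam_pos : 0 < skellam x k :=
  mul_pos (Real.exp_pos _) (besselI_pos _ hx)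

lemma hasDerivAt_skellam :
    HasDerivAt (fun y => skellam y k) (skellam x k * skellamScore x k) x := by
  have hexp : HasDerivAt (fun y : ℝ => Real.exp (-y)) (Real.exp (-x) * (-1)) x :=
    (hasDerivAt_neg x).exp
  refine (hexp.mul (hasDerivAt_besselI k.natAbs hx.ne')).congr_deriv ?_
  have := (besselI_pos k.natAbs hx).ne'
  simp only [skellam, skellamScore, besselQuot]
  field_simp
  ring

lemma hasDerivAt_log_skellam :
    HasDerivAt (fun y => Real.log (skellam y k)) (skellamScore x k) x := by
  have hpos := (skellam_pos hx k).ne'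
  exact ((hasDerivAt_skellam hx k).log hpos).congr_deriv (mul_div_cancel_left₀ _ hpos)

lemma hasDerivAt_skellamScore :
    HasDerivAt (fun y => skellamScore y k) (skellamScoreDeriv x k) x := by
  refine (((hasDerivAt_besselQuot k.natAbs hx).add ((hasDerivAt_const x (k.natAbs : ℝ)).div
    (hasDerivAt_id x) hx.ne')).sub_const 1).congr_deriv ?_
  simp only [skellamScoreDeriv, id]
  ring

lemma hasDerivAt_skellamScoreDeriv :
    HasDerivAt (fun y => skellamScoreDeriv y k) (skellamScoreDeriv₂ x k) x := by
  have hquot := hasDerivAt_besselQuot k.natAbs hx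
  have hcoeff := (hasDerivAt_const x (2 * (k.natAbs : ℝ) + 1)).div (hasDerivAt_id x) hx.ne'
  have hinv := (hasDerivAt_const x (k.natAbs : ℝ)).div (hasDerivAt_pow 2 x) (pow_ne_zero 2 hx.ne')
  refine ((((hquot.pow 2).const_sub 1).sub (hcoeff.mul hquot)).sub hinv).congr_deriv ?_
  simp only [skellamScoreDeriv₂, Pi.div_apply, id]
  field_simp
  ring

lemma abs_skellamScore_le : |skellamScore x k| ≤ (k.natAbs : ℝ) / x + 1 := by
  have hpos := besselQuot_pos k.natAbs hx
  have hle := besselQuot_le_one k.natAbs hx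
  have hdiv : 0 ≤ (k.natAbs : ℝ) / x := by positivity
  rw [skellamScore, abs_le]
  constructor <;> linarith

lemma abs_skellamScoreDeriv_le : |skellamScoreDeriv x k| ≤ (k.natAbs : ℝ) / x ^ 2 + 1 := by
  have hderiv := abs_le.1 (abs_deriv_besselQuot_le k.natAbs hx)
  have hdiv : 0 ≤ (k.natAbs : ℝ) / x ^ 2 := by positivity
  rw [skellamScoreDeriv, abs_le]
  constructor <;> linarith

lemma abs_skellamScoreDeriv₂_le :
    |skellamScoreDeriv₂ x k| ≤ 2 + 2 * (k.natAbs + 1) / x + 2 * k.natAbs / x ^ 3 := by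
  set r := besselQuot k.natAbs x
  set n : ℝ := (k.natAbs : ℝ)
  set d := 1 - r ^ 2 - (2 * n + 1) / x * r
  have hr : 0 < r := besselQuot_pos k.natAbs hx
  have coeff_le : (2 * n + 1) / x ^ 2 * r ≤ 1 / x := by
    rw [div_mul_eq_mul_div, div_le_div_iff₀ (by positivity) hx]
    nlinarith [two_mul_besselQuot_le k.natAbs hx]
  calc |-(2 * r + (2 * n + 1) / x) * d + (2 * n + 1) / x ^ 2 * r + 2 * n / x ^ 3|
      ≤ |-(2 * r + (2 * n + 1) / x) * d| + |(2 * n + 1) / x ^ 2 * r| + |2 * n / x ^ 3| :=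
        abs_add_three _ _ _
    _ = (2 * r + (2 * n + 1) / x) * |d| + (2 * n + 1) / x ^ 2 * r + 2 * n / x ^ 3 := by
        rw [neg_mul, abs_neg, abs_mul, abs_of_nonneg (by positivity : 0 ≤ 2 * r + (2 * n + 1) / x),
          abs_of_nonneg (by positivity : 0 ≤ (2 * n + 1) / x ^ 2 * r),
          abs_of_nonneg (by positivity : 0 ≤ 2 * n / x ^ 3)]
    _ ≤ (2 * 1 + (2 * n + 1) / x) * 1 + 1 / x + 2 * n / x ^ 3 := by
        gcongr
        · exact besselQuot_le_one k.natAbs hx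
        · exact abs_deriv_besselQuot_le k.natAbs hx
    _ = _ := by ring

lemma cast_mul_skellam :
    (k : ℝ) * skellam x k = x / 2 * (skellam x (k - 1) - skellam x (k + 1)) := by
  have natCast (n : ℕ) :
      (n : ℝ) * skellam x n = x / 2 * (skellam x (n - 1) - skellam x (n + 1)) := by
    cases n with
    | zero => simp [skellam]
    | succ n =>
      simp only [skellam, show ((n + 1 : ℕ) - 1 : ℤ).natAbs = n by omega, Int.natAbs_natCast,
        show ((n + 1 : ℕ) + 1 : ℤ).natAbs = n + 2 by omega]
      rw [besselI_recurrence n hx.ne']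
      push_cast
      field_simp
      ring
  rcases Int.natAbs_eq k with h | h
  · rw [h, Int.cast_natCast, natCast]
  · rw [h, skellam_neg, ← skellam_neg x (_ - 1), ← skellam_neg x (_ + 1), neg_add', neg_sub',
      neg_neg, sub_neg_eq_add, Int.cast_neg, Int.cast_natCast, neg_mul, natCast]
    ring

/-- The Kolmogorov forward equation of the simple random walk in continuous time. -/
lemma skellam_mul_skellamScore :
    skellam x k * skellamScore x k =
      (skellam x (k + 1) + skellam x (k - 1)) / 2 - skellam x k := by
  have expand : skellam x k * skellamScore x k =
      Real.exp (-x) * besselI (k.natAbs + 1) x + |(k : ℝ)| * skellam x k / x - skellam x k := by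
    have := (besselI_pos k.natAbs hx).ne'
    rw [skellamScore, skellam, besselQuot, Nat.cast_natAbs, Int.cast_abs]
    field_simp
  rw [expand]
  rcases le_total 0 k with hk | hk
  · rw [abs_of_nonneg (Int.cast_nonneg hk), cast_mul_skellam hx, skellam, skellam, skellam,
      show (k + 1).natAbs = k.natAbs + 1 by omega]
    field_simp
    ring
  · rw [abs_of_nonpos (Int.cast_nonpos.2 hk), neg_mul, cast_mul_skellam hx, skellam, skellam,
      skellam, show (k - 1).natAbs = k.natAbs + 1 by omega]
    field_simp
    ring

lemma skellam_mul_skellamScoreDeriv_add :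
    skellam x k * (skellamScoreDeriv x k + skellamScore x k ^ 2) =
      (skellam x (k + 1) * skellamScore x (k + 1) + skellam x (k - 1) * skellamScore x (k - 1)) / 2
        - skellam x k * skellamScore x k := by
  have hleft := (hasDerivAt_skellam hx k).mul (hasDerivAt_skellamScore hx k)
  have hright := (((hasDerivAt_skellam hx (k + 1)).add
    (hasDerivAt_skellam hx (k - 1))).div_const 2).sub (hasDerivAt_skellam hx k)
  have forward : (fun y => skellam y k * skellamScore y k) =ᶠ[𝓝 x]
      fun y => (skellam y (k + 1) + skellam y (k - 1)) / 2 - skellam y k := by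
    filter_upwards [lt_mem_nhds hx] with y hy using skellam_mul_skellamScore hy k
  rw [(hright.congr_of_eventuallyEq forward).unique hleft]
  ring

end

/-! ### Functions of polynomial growth -/

/-- `φ : ℤ → ℝ` grows at most polynomially; such functions are integrable against every Skellam
distribution. -/
def PolyGrowth (φ : ℤ → ℝ) : Prop :=
  ∃ (C : ℝ) (p : ℕ), 0 ≤ C ∧ ∀ k, |φ k| ≤ C * (1 + (k.natAbs : ℝ)) ^ p

namespace PolyGrowth

variable {φ ψ : ℤ → ℝ}

lemma of_le (hψ : PolyGrowth ψ) (h : ∀ k, |φ k| ≤ ψ k) : PolyGrowth φ := by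
  obtain ⟨C, p, hC, hψ⟩ := hψ
  exact ⟨C, p, hC, fun k => (h k).trans ((le_abs_self _).trans (hψ k))⟩

lemma const (c : ℝ) : PolyGrowth fun _ => c :=
  ⟨|c|, 0, abs_nonneg c, fun k => by rw [pow_zero, mul_one]⟩

lemma natAbs : PolyGrowth fun k => (k.natAbs : ℝ) :=
  ⟨1, 1, zero_le_one, fun k => by rw [abs_of_nonneg (by positivity)]; linarith⟩

lemma cast : PolyGrowth fun k => (k : ℝ) :=
  natAbs.of_le fun k => by rw [Nat.cast_natAbs, Int.cast_abs]

lemma add (hφ : PolyGrowth φ) (hψ : PolyGrowth ψ) : PolyGrowth fun k => φ k + ψ k := by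
  obtain ⟨C, p, hC, hφ⟩ := hφ
  obtain ⟨D, q, hD, hψ⟩ := hψ
  refine ⟨C + D, p + q, by positivity, fun k => ?_⟩
  have one_le : (1 : ℝ) ≤ 1 + (k.natAbs : ℝ) := le_add_of_nonneg_right (Nat.cast_nonneg _)
  calc |φ k + ψ k| ≤ |φ k| + |ψ k| := abs_add_le _ _
    _ ≤ C * (1 + (k.natAbs : ℝ)) ^ p + D * (1 + (k.natAbs : ℝ)) ^ q := add_le_add (hφ k) (hψ k)
    _ ≤ C * (1 + (k.natAbs : ℝ)) ^ (p + q) + D * (1 + (k.natAbs : ℝ)) ^ (p + q) := by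
      gcongr C * ?_ + D * ?_
      · exact pow_le_pow_right₀ one_le (Nat.le_add_right p q)
      · exact pow_le_pow_right₀ one_le (Nat.le_add_left q p)
    _ = _ := (add_mul _ _ _).symm

lemma mul (hφ : PolyGrowth φ) (hψ : PolyGrowth ψ) : PolyGrowth fun k => φ k * ψ k := by
  obtain ⟨C, p, hC, hφ⟩ := hφ
  obtain ⟨D, q, hD, hψ⟩ := hψ
  refine ⟨C * D, p + q, by positivity, fun k => ?_⟩
  rw [abs_mul]
  exact (mul_le_mul (hφ k) (hψ k) (abs_nonneg _) (by positivity)).trans_eq (by ring)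

lemma sub_const (hφ : PolyGrowth φ) (c : ℝ) : PolyGrowth fun k => φ k - c := by
  simpa only [sub_eq_add_neg] using hφ.add (const (-c))

lemma const_mul (c : ℝ) (hφ : PolyGrowth φ) : PolyGrowth fun k => c * φ k := (const c).mul hφ

lemma div_const (hφ : PolyGrowth φ) (c : ℝ) : PolyGrowth fun k => φ k / c := by
  simpa only [div_eq_inv_mul] using hφ.const_mul c⁻¹

lemma pow (hφ : PolyGrowth φ) (n : ℕ) : PolyGrowth fun k => φ k ^ n := by
  induction n with
  | zero => simpa only [pow_zero] using const 1
  | succ n ih => simpa only [pow_succ] using ih.mul hφ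

lemma comp_add (hφ : PolyGrowth φ) (m : ℤ) : PolyGrowth fun k => φ (k + m) := by
  obtain ⟨C, p, hC, hφ⟩ := hφ
  refine ((((const 1).add (natAbs.add (const m.natAbs))).pow p).const_mul C).of_le
    fun k => (hφ (k + m)).trans ?_
  have : ((k + m).natAbs : ℝ) ≤ k.natAbs + m.natAbs := mod_cast Int.natAbs_add_le k m
  gcongr

lemma comp_sub (hφ : PolyGrowth φ) (m : ℤ) : PolyGrowth fun k => φ (k - m) := by
  simpa only [sub_eq_add_neg] using hφ.comp_add (-m)

end PolyGrowth

lemma one_add_pow_le_exp (n p : ℕ) :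
    (1 + (n : ℝ)) ^ p ≤ p.factorial * Real.exp 1 * Real.exp 1 ^ n := by
  have h := Real.pow_div_factorial_le_exp (1 + (n : ℝ)) (by positivity) p
  rw [div_le_iff₀ (by positivity), Real.exp_add, ← mul_one (n : ℝ), Real.exp_nat_mul,
    mul_one] at h
  linarith

lemma PolyGrowth.summable {φ : ℤ → ℝ} (hφ : PolyGrowth φ) {x : ℝ} (hx : 0 < x) :
    Summable fun k => skellam x k * φ k := by
  obtain ⟨C, p, hC, hφ⟩ := hφ
  set K : ℝ := Real.exp (-x) * Real.exp (x ^ 2 / 4) * C * (p.factorial * Real.exp 1)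
  have majorant : Summable fun n : ℕ => K * ((Real.exp 1 * (x / 2)) ^ n / (n.factorial : ℝ)) :=
    (Real.summable_pow_div_factorial _).mul_left K
  have bound (k : ℤ) : ‖skellam x k * φ k‖ ≤
      K * ((Real.exp 1 * (x / 2)) ^ k.natAbs / (k.natAbs.factorial : ℝ)) := by
    rw [norm_mul, Real.norm_eq_abs, Real.norm_eq_abs, abs_of_pos (skellam_pos hx k), skellam]
    calc Real.exp (-x) * besselI k.natAbs x * |φ k|
        ≤ Real.exp (-x) * (Real.exp (x ^ 2 / 4) * ((x / 2) ^ k.natAbs / (k.natAbs.factorial : ℝ))) *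
          (C * (p.factorial * Real.exp 1 * (Real.exp 1) ^ k.natAbs)) := by
          have := (besselI_pos k.natAbs hx).le
          gcongr
          · exact besselI_le k.natAbs hx.le
          · exact (hφ k).trans (mul_le_mul_of_nonneg_left (one_add_pow_le_exp _ _) hC)
      _ = _ := by simp only [K, mul_pow]; ring
  exact Summable.of_nat_of_neg
    (Summable.of_norm_bounded majorant fun n => by simpa only [Int.natAbs_natCast] using bound n)
    (Summable.of_norm_bounded majorant fun n => by
      simpa only [Int.natAbs_neg, Int.natAbs_natCast] using bound (-n))

section

variable {x : ℝ} (hx : 0 < x)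
include hx

lemma polyGrowth_skellamScore : PolyGrowth (skellamScore x) :=
  ((PolyGrowth.natAbs.div_const x).add (.const 1)).of_le (abs_skellamScore_le hx)

lemma polyGrowth_skellamScoreDeriv : PolyGrowth (skellamScoreDeriv x) :=
  ((PolyGrowth.natAbs.div_const (x ^ 2)).add (.const 1)).of_le (abs_skellamScoreDeriv_le hx)

end

/-! ### Integration against the Skellam distribution -/

lemma map_natCast_sub_prod_real_singleton (μ ν : Measure ℕ) [IsFiniteMeasure μ]
    [IsFiniteMeasure ν] (n : ℕ) :
    ((μ.prod ν).map fun p => (p.1 : ℤ) - p.2).real {(n : ℤ)} =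
      ∑' m, μ.real {n + m} * ν.real {m} := by
  have hpre : (fun p : ℕ × ℕ => (p.1 : ℤ) - p.2) ⁻¹' {(n : ℤ)} = ⋃ m, {n + m} ×ˢ {m} := by
    ext ⟨a, b⟩
    simp only [Set.mem_preimage, Set.mem_singleton_iff, Set.mem_iUnion, Set.mem_prod]
    exact ⟨fun _ => ⟨b, by omega⟩, fun ⟨_, _⟩ => by omega⟩
  have hdisj : Pairwise (Function.onFun Disjoint fun m : ℕ => ({n + m} ×ˢ {m} : Set (ℕ × ℕ))) :=
    fun a b hab => Set.disjoint_prod.2 (.inr (by simpa using hab))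
  rw [map_measureReal_apply (by fun_prop) (measurableSet_singleton _), hpre, measureReal_def,
    measure_iUnion hdisj fun _ => .of_discrete, ENNReal.tsum_toReal_eq fun _ => measure_ne_top _ _]
  simp only [Measure.prod_prod, ENNReal.toReal_mul, measureReal_def]

lemma map_natCast_sub_prod_real_neg (μ : Measure ℕ) [SFinite μ] (k : ℤ) :
    ((μ.prod μ).map fun p => (p.1 : ℤ) - p.2).real {-k} =
      ((μ.prod μ).map fun p => (p.1 : ℤ) - p.2).real {k} := by
  have hpre : (fun p : ℕ × ℕ => (p.1 : ℤ) - p.2) ⁻¹' {-k} =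
      Prod.swap ⁻¹' ((fun p : ℕ × ℕ => (p.1 : ℤ) - p.2) ⁻¹' {k}) := by
    ext p
    simp only [Set.mem_preimage, Set.mem_singleton_iff, Prod.fst_swap, Prod.snd_swap]
    omega
  rw [map_measureReal_apply (by fun_prop) (measurableSet_singleton _),
    map_measureReal_apply (by fun_prop) (measurableSet_singleton _), hpre,
    ← map_measureReal_apply measurable_swap .of_discrete, Measure.prod_swap]

/-- The symmetric Skellam distribution as a measure: the law of the difference of two independent
Poisson variables with parameter `x / 2`. -/
def skellamMeasure (x : ℝ) : Measure ℤ :=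
  ((poissonMeasure (x / 2).toNNReal).prod (poissonMeasure (x / 2).toNNReal)).map
    fun p => (p.1 : ℤ) - p.2

instance (x : ℝ) : IsProbabilityMeasure (skellamMeasure x) :=
  Measure.isProbabilityMeasure_map (by fun_prop)

lemma skellamMeasure_real_singleton {x : ℝ} (hx : 0 ≤ x) (k : ℤ) :
    (skellamMeasure x).real {k} = skellam x k := by
  have hx2 : ((x / 2).toNNReal : ℝ) = x / 2 := Real.coe_toNNReal _ (by positivity)
  have hexp : Real.exp (-x) = Real.exp (-(x / 2)) * Real.exp (-(x / 2)) := by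
    rw [← Real.exp_add, ← neg_add, add_halves]
  have natCast (n : ℕ) : (skellamMeasure x).real {(n : ℤ)} = skellam x n := by
    rw [skellamMeasure, map_natCast_sub_prod_real_singleton, skellam, besselI, ← tsum_mul_left]
    refine tsum_congr fun m => ?_
    rw [poissonMeasure_real_singleton, poissonMeasure_real_singleton, hx2, hexp,
      Int.natAbs_natCast, two_mul, add_assoc, add_comm m n, pow_add _ m]
    ring
  rcases Int.natAbs_eq k with h | h
  · rw [h, natCast]
  · rw [h, skellamMeasure, map_natCast_sub_prod_real_neg, ← skellamMeasure, natCast]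
    simp only [skellam, Int.natAbs_neg]

lemma PolyGrowth.integrable {φ : ℤ → ℝ} (hφ : PolyGrowth φ) {x : ℝ} (hx : 0 < x) :
    Integrable φ (skellamMeasure x) := by
  rw [← Measure.sum_smul_dirac (skellamMeasure x)]
  refine (integrable_sum_dirac_iff (x := id) fun k => measure_ne_top _ _).2 ?_
  refine (hφ.summable hx).abs.congr fun k => ?_
  rw [← measureReal_def, skellamMeasure_real_singleton hx.le, abs_mul,
    abs_of_pos (skellam_pos hx k), id, Real.norm_eq_abs]

lemma PolyGrowth.integral_mono {φ ψ : ℤ → ℝ} (hφ : PolyGrowth φ) (hψ : PolyGrowth ψ) {x : ℝ}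
    (hx : 0 < x) (h : ∀ k, φ k ≤ ψ k) :
    ∫ k, φ k ∂skellamMeasure x ≤ ∫ k, ψ k ∂skellamMeasure x :=
  MeasureTheory.integral_mono (hφ.integrable hx) (hψ.integrable hx) h

lemma hasSum_integral_skellam {φ : ℤ → ℝ} (hφ : PolyGrowth φ) {x : ℝ} (hx : 0 < x) :
    HasSum (fun k => skellam x k * φ k) (∫ k, φ k ∂skellamMeasure x) := by
  rw [integral_countable (hφ.integrable hx)]
  simp only [skellamMeasure_real_singleton hx.le, smul_eq_mul]
  exact (hφ.summable hx).hasSum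

lemma integral_pow_poissonMeasure (r : ℝ≥0) (c : ℂ) :
    ∫ n, c ^ n ∂poissonMeasure r = Complex.exp (r * (c - 1)) := by
  have term (n : ℕ) : (Real.exp (-r) * (r : ℝ) ^ n / (n.factorial : ℝ)) • c ^ n =
      Complex.exp (-r) * ((r * c) ^ n / (n.factorial : ℂ)) := by
    rw [Complex.real_smul, mul_pow]
    push_cast
    ring
  rw [integral_poissonMeasure, tsum_congr term, tsum_mul_left,
    (NormedSpace.expSeries_div_hasSum_exp _).tsum_eq, ← Complex.exp_eq_exp_ℂ, ← Complex.exp_add]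
  ring_nf

/-- The character `z ↦ exp (i t z)` of `ℤ`. -/
def intChar (t : ℝ) (z : ℤ) : ℂ := Complex.exp (t * z * Complex.I)

lemma integral_intChar_skellamMeasure {x : ℝ} (hx : 0 ≤ x) (t : ℝ) :
    ∫ k, intChar t k ∂skellamMeasure x = Complex.exp (x * (Real.cos t - 1)) := by
  set r : ℝ≥0 := (x / 2).toNNReal
  have hr : (r : ℂ) = (x : ℂ) / 2 := by
    exact_mod_cast Complex.ofReal_inj.2 (Real.coe_toNNReal (x / 2) (by positivity))
  have intChar_sub (p : ℕ × ℕ) : intChar t ((p.1 : ℤ) - p.2) =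
      Complex.exp (t * Complex.I) ^ p.1 * Complex.exp (-t * Complex.I) ^ p.2 := by
    rw [intChar, ← Complex.exp_nat_mul, ← Complex.exp_nat_mul, ← Complex.exp_add]
    push_cast
    ring_nf
  rw [skellamMeasure, integral_map .of_discrete .of_discrete]
  simp only [intChar_sub]
  rw [integral_prod_mul (fun n : ℕ => Complex.exp (t * Complex.I) ^ n)
    (fun n : ℕ => Complex.exp (-t * Complex.I) ^ n), integral_pow_poissonMeasure,
    integral_pow_poissonMeasure, ← Complex.exp_add, hr, Complex.ofReal_cos, Complex.cos]
  ring_nf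

section

variable {φ ψ : ℤ → ℝ} (hφ : PolyGrowth φ) {x : ℝ} (hx : 0 < x)
include hφ hx

lemma hasSum_skellam_add (m : ℤ) :
    HasSum (fun k => skellam x (k + m) * φ k) (∫ k, φ (k - m) ∂skellamMeasure x) := by
  have h := (Equiv.addRight m).hasSum_iff.2 (hasSum_integral_skellam (hφ.comp_sub m) hx)
  simpa only [Function.comp_def, Equiv.coe_addRight, add_sub_cancel_right] using h

/-- Stein's identity for the symmetric Skellam distribution. -/
lemma integral_cast_mul (h : ∀ k, φ (k + 1) - φ (k - 1) = ψ k) :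
    ∫ k, (k : ℝ) * φ k ∂skellamMeasure x = x / 2 * ∫ k, ψ k ∂skellamMeasure x := by
  have hasSum_diff := ((hasSum_skellam_add hφ hx (-1)).sub
    (hasSum_skellam_add hφ hx 1)).mul_left (x / 2)
  have hcongr : (fun k => skellam x k * ((k : ℝ) * φ k)) =
      fun k => x / 2 * (skellam x (k + -1) * φ k - skellam x (k + 1) * φ k) := by
    ext k
    rw [← mul_assoc, mul_comm _ (k : ℝ), cast_mul_skellam hx k, ← sub_eq_add_neg]
    ring
  rw [← hcongr] at hasSum_diff
  rw [(hasSum_integral_skellam (PolyGrowth.cast.mul hφ) hx).unique hasSum_diff, ← integral_sub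
    ((hφ.comp_sub _).integrable hx) ((hφ.comp_sub _).integrable hx)]
  simp only [sub_neg_eq_add, h]

end

section

variable {x : ℝ} (hx : 0 < x)
include hx

lemma integral_skellamScore : ∫ k, skellamScore x k ∂skellamMeasure x = 0 := by
  have hone := PolyGrowth.const 1
  have hasSum_forward := (((hasSum_skellam_add hone hx 1).add
    (hasSum_skellam_add hone hx (-1))).div_const 2).sub (hasSum_skellam_add hone hx 0)
  refine (hasSum_integral_skellam (polyGrowth_skellamScore hx) hx).unique
    (hasSum_forward.congr_fun fun k => ?_) |>.trans ?_
  · rw [skellam_mul_skellamScore hx]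
    simp only [mul_one, add_zero, sub_eq_add_neg]
  · simp only [integral_const, probReal_univ, smul_eq_mul, mul_one]
    norm_num

lemma integral_skellamScoreDeriv :
    ∫ k, skellamScoreDeriv x k ∂skellamMeasure x =
      -∫ k, skellamScore x k ^ 2 ∂skellamMeasure x := by
  have hderiv := polyGrowth_skellamScoreDeriv hx
  have hsq := (polyGrowth_skellamScore hx).pow 2
  have hasSum_score := hasSum_integral_skellam (polyGrowth_skellamScore hx) hx
  have hasSum_forward := ((((Equiv.addRight (1 : ℤ)).hasSum_iff.2 hasSum_score).add
    ((Equiv.addRight (-1 : ℤ)).hasSum_iff.2 hasSum_score)).div_const 2).sub hasSum_score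
  have h := (hasSum_integral_skellam (hderiv.add hsq) hx).unique
    (hasSum_forward.congr_fun fun k => skellam_mul_skellamScoreDeriv_add hx k)
  rw [integral_add (hderiv.integrable hx) (hsq.integrable hx), integral_skellamScore hx] at h
  linarith

lemma integrable_cast_pow (n : ℕ) : Integrable (fun k : ℤ => (k : ℝ) ^ n) (skellamMeasure x) :=
  (PolyGrowth.cast.pow n).integrable hx

lemma integral_cast_pow_succ (n : ℕ) {ψ : ℤ → ℝ}
    (h : ∀ k : ℤ, ((k : ℝ) + 1) ^ n - ((k : ℝ) - 1) ^ n = ψ k) :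
    ∫ k, (k : ℝ) ^ (n + 1) ∂skellamMeasure x = x / 2 * ∫ k, ψ k ∂skellamMeasure x := by
  simp only [pow_succ']
  exact integral_cast_mul (PolyGrowth.cast.pow n) hx fun k => by push_cast; exact h k

lemma integral_cast_sq : ∫ k, (k : ℝ) ^ 2 ∂skellamMeasure x = x := by
  rw [integral_cast_pow_succ hx 1 (ψ := fun _ => 2) fun k => by ring, integral_const,
    probReal_univ, one_smul]
  ring

lemma integral_evenPoly (a b c : ℝ) :
    ∫ k : ℤ, a * (k : ℝ) ^ 6 + b * (k : ℝ) ^ 4 + c * (k : ℝ) ^ 2 + 2 ∂skellamMeasure x =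
      a * (∫ k, (k : ℝ) ^ 6 ∂skellamMeasure x) + b * (∫ k, (k : ℝ) ^ 4 ∂skellamMeasure x)
        + c * x + 2 := by
  have hsix := (PolyGrowth.cast.pow 6).const_mul a
  have hfour := (PolyGrowth.cast.pow 4).const_mul b
  have hsq := (PolyGrowth.cast.pow 2).const_mul c
  rw [integral_add (((hsix.add hfour).add hsq).integrable hx) (integrable_const _),
    integral_add ((hsix.add hfour).integrable hx) (hsq.integrable hx),
    integral_add (hsix.integrable hx) (hfour.integrable hx), integral_const_mul,
    integral_const_mul, integral_const_mul, integral_cast_sq hx, integral_const, probReal_univ,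
    one_smul]

lemma integral_cast_pow_four : ∫ k, (k : ℝ) ^ 4 ∂skellamMeasure x = 3 * x ^ 2 + x := by
  rw [integral_cast_pow_succ hx 3 fun k => show _ =
    0 * (k : ℝ) ^ 6 + 0 * (k : ℝ) ^ 4 + 6 * (k : ℝ) ^ 2 + 2 by ring, integral_evenPoly hx]
  ring

lemma integral_cast_pow_six :
    ∫ k, (k : ℝ) ^ 6 ∂skellamMeasure x = 15 * x ^ 3 + 15 * x ^ 2 + x := by
  rw [integral_cast_pow_succ hx 5 fun k => show _ =
    0 * (k : ℝ) ^ 6 + 10 * (k : ℝ) ^ 4 + 20 * (k : ℝ) ^ 2 + 2 by ring, integral_evenPoly hx,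
    integral_cast_pow_four hx]
  ring

lemma integral_cast_pow_eight :
    ∫ k, (k : ℝ) ^ 8 ∂skellamMeasure x = 105 * x ^ 4 + 210 * x ^ 3 + 63 * x ^ 2 + x := by
  rw [integral_cast_pow_succ hx 7 fun k => show _ =
    14 * (k : ℝ) ^ 6 + 70 * (k : ℝ) ^ 4 + 42 * (k : ℝ) ^ 2 + 2 by ring, integral_evenPoly hx,
    integral_cast_pow_six hx, integral_cast_pow_four hx]
  ring

end

lemma natAbs_cast_sq (k : ℤ) : (k.natAbs : ℝ) ^ 2 = (k : ℝ) ^ 2 := by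
  rw [Nat.cast_natAbs, Int.cast_abs, sq_abs]

lemma integral_natAbs_le {x : ℝ} (hx : 0 < x) :
    ∫ k : ℤ, (k.natAbs : ℝ) ∂skellamMeasure x ≤ x := by
  refine (PolyGrowth.natAbs.integral_mono (PolyGrowth.cast.pow 2) hx fun k => ?_).trans_eq
    (integral_cast_sq hx)
  rw [← natAbs_cast_sq, ← Nat.cast_pow]
  exact Nat.cast_le.2 (Nat.le_self_pow two_ne_zero _)

/-! ### The Fisher information of one Skellam observation -/

/-- The Fisher information of the symmetric Skellam distribution at variance `x`. -/
def skellamInfo (x : ℝ) : ℝ := ∫ k, skellamScore x k ^ 2 ∂skellamMeasure x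

section

variable {x : ℝ} (hx : 0 < x)
include hx

lemma abs_skellamScore_sq_sub_le (k : ℤ) :
    |skellamScore x k ^ 2 - (k : ℝ) ^ 2 / x ^ 2| ≤ 2 / x * k.natAbs + 1 := by
  have hpos := besselQuot_pos k.natAbs hx
  have hle := besselQuot_le_one k.natAbs hx
  have hdiv : 0 ≤ (k.natAbs : ℝ) / x := by positivity
  rw [← natAbs_cast_sq, skellamScore, ← div_pow, div_mul_eq_mul_div, mul_div_assoc, abs_le]
  constructor <;> nlinarith

lemma abs_skellamInfo_sub_le : |skellamInfo x - 1 / x| ≤ 3 := by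
  have hsq : 1 / x = ∫ k : ℤ, (k : ℝ) ^ 2 / x ^ 2 ∂skellamMeasure x := by
    rw [integral_div, integral_cast_sq hx]
    field_simp
  have hbound := (PolyGrowth.natAbs.const_mul (2 / x)).add (.const 1)
  rw [skellamInfo, hsq, ← integral_sub (((polyGrowth_skellamScore hx).pow 2).integrable hx)
    ((integrable_cast_pow hx 2).div_const _)]
  calc ‖∫ k : ℤ, skellamScore x k ^ 2 - (k : ℝ) ^ 2 / x ^ 2 ∂skellamMeasure x‖
      ≤ ∫ k : ℤ, (2 / x * (k.natAbs : ℝ) + 1) ∂skellamMeasure x :=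
        norm_integral_le_of_norm_le (hbound.integrable hx)
          (ae_of_all _ (abs_skellamScore_sq_sub_le hx))
    _ = 2 / x * (∫ k : ℤ, (k.natAbs : ℝ) ∂skellamMeasure x) + 1 := by
        rw [integral_add ((PolyGrowth.natAbs.const_mul _).integrable hx) (integrable_const _),
          integral_const_mul, integral_const, probReal_univ, one_smul]
    _ ≤ 2 / x * x + 1 := by gcongr; exact integral_natAbs_le hx
    _ = 3 := by field_simp; norm_num

lemma skellamInfo_pos : 0 < skellamInfo x := by
  obtain ⟨n, hn⟩ := exists_nat_gt x
  have score_pos : 0 < skellamScore x n := by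
    have hquot := besselQuot_pos n hx
    have hdiv : 1 < (n : ℝ) / x := (one_lt_div hx).2 hn
    rw [skellamScore, Int.natAbs_natCast]
    linarith
  exact (mul_pos (skellam_pos hx n) (pow_pos score_pos 2)).trans_le
    (le_hasSum (hasSum_integral_skellam ((polyGrowth_skellamScore hx).pow 2) hx) n
      fun k _ => mul_nonneg (skellam_pos hx k).le (sq_nonneg _))

lemma skellam_le_exp_mul {y : ℝ} (hxy : x ≤ y) (k : ℤ) :
    skellam x k ≤ Real.exp y * skellam y k := by
  have hexp : Real.exp (-x) ≤ 1 := Real.exp_le_one_iff.2 (neg_nonpos.2 hx.le)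
  rw [skellam, skellam, ← mul_assoc, ← Real.exp_add, add_neg_cancel, Real.exp_zero]
  exact mul_le_mul hexp (besselI_mono _ hx.le hxy) (besselI_pos _ hx).le zero_le_one

lemma continuousAt_skellamInfo : ContinuousAt skellamInfo x := by
  have near : ∀ᶠ y in 𝓝 x, x / 2 < y ∧ y < 2 * x :=
    (lt_mem_nhds (by linarith)).and (gt_mem_nhds (by linarith))
  have info_eq_tsum (y : ℝ) (hy : 0 < y) :
      ∑' k, skellam y k * skellamScore y k ^ 2 = skellamInfo y :=
    (hasSum_integral_skellam ((polyGrowth_skellamScore hy).pow 2) hy).tsum_eq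
  have bound : PolyGrowth fun k => ((k.natAbs : ℝ) / (x / 2) + 1) ^ 2 :=
    ((PolyGrowth.natAbs.div_const _).add (.const 1)).pow 2
  have tendsto_tsum : Tendsto (fun y => ∑' k, skellam y k * skellamScore y k ^ 2) (𝓝 x)
      (𝓝 (∑' k, skellam x k * skellamScore x k ^ 2)) := by
    refine tendsto_tsum_of_dominated_convergence
      ((bound.summable (mul_pos two_pos hx)).mul_left (Real.exp (2 * x)))
      (fun k => (hasDerivAt_skellam hx k).continuousAt.mul
        ((hasDerivAt_skellamScore hx k).continuousAt.pow 2)) ?_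
    filter_upwards [near] with y ⟨hxy, hyx⟩ k
    have hy : 0 < y := (half_pos hx).trans hxy
    have hscore : |skellamScore y k| ≤ (k.natAbs : ℝ) / (x / 2) + 1 :=
      (abs_skellamScore_le hy k).trans (by gcongr)
    rw [norm_mul, norm_pow, Real.norm_of_nonneg (skellam_pos hy k).le, Real.norm_eq_abs,
      ← mul_assoc]
    exact mul_le_mul (skellam_le_exp_mul hy hyx.le k) (pow_le_pow_left₀ (abs_nonneg _) hscore 2)
      (by positivity) (mul_nonneg (Real.exp_pos _).le (skellam_pos (mul_pos two_pos hx) k).le)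
  rw [ContinuousAt, ← info_eq_tsum x hx]
  refine tendsto_tsum.congr' ?_
  filter_upwards [lt_mem_nhds hx] with y hy using info_eq_tsum y hy

lemma integral_skellamScore_pow_four_le :
    ∫ k, skellamScore x k ^ 4 ∂skellamMeasure x ≤ 8 * ((3 * x ^ 2 + x) / x ^ 4 + 1) := by
  have pointwise (k : ℤ) : skellamScore x k ^ 4 ≤ 8 * ((k : ℝ) ^ 4 / x ^ 4 + 1) := by
    have heven : (k.natAbs : ℝ) ^ 4 = (k : ℝ) ^ 4 := by
      rw [show 4 = 2 * 2 from rfl, pow_mul, natAbs_cast_sq, ← pow_mul]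
    calc skellamScore x k ^ 4 = |skellamScore x k| ^ 4 := (Even.pow_abs (by decide) _).symm
      _ ≤ ((k.natAbs : ℝ) / x + 1) ^ 4 :=
        pow_le_pow_left₀ (abs_nonneg _) (abs_skellamScore_le hx k) 4
      _ ≤ 2 ^ (4 - 1) * (((k.natAbs : ℝ) / x) ^ 4 + 1 ^ 4) :=
        add_pow_le (by positivity) zero_le_one 4
      _ = _ := by rw [div_pow, heven]; norm_num
  have growth := ((PolyGrowth.cast.pow 4).div_const (x ^ 4)).add (.const 1)
  refine (((polyGrowth_skellamScore hx).pow 4).integral_mono (growth.const_mul 8) hx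
    pointwise).trans_eq ?_
  rw [integral_const_mul, integral_add ((integrable_cast_pow hx 4).div_const _)
    (integrable_const _), integral_div, integral_cast_pow_four hx, integral_const, probReal_univ,
    one_smul]

lemma integral_skellamScoreDeriv_sq_le :
    ∫ k, skellamScoreDeriv x k ^ 2 ∂skellamMeasure x ≤ 2 * (1 / x ^ 3 + 1) := by
  have pointwise (k : ℤ) : skellamScoreDeriv x k ^ 2 ≤ 2 * ((k : ℝ) ^ 2 / x ^ 4 + 1) := by
    calc skellamScoreDeriv x k ^ 2 = |skellamScoreDeriv x k| ^ 2 := (sq_abs _).symm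
      _ ≤ ((k.natAbs : ℝ) / x ^ 2 + 1) ^ 2 :=
        pow_le_pow_left₀ (abs_nonneg _) (abs_skellamScoreDeriv_le hx k) 2
      _ ≤ 2 ^ (2 - 1) * (((k.natAbs : ℝ) / x ^ 2) ^ 2 + 1 ^ 2) :=
        add_pow_le (by positivity) zero_le_one 2
      _ = _ := by rw [div_pow, natAbs_cast_sq]; ring
  have growth := ((PolyGrowth.cast.pow 2).div_const (x ^ 4)).add (.const 1)
  refine (((polyGrowth_skellamScoreDeriv hx).pow 2).integral_mono (growth.const_mul 2) hx
    pointwise).trans_eq ?_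
  rw [integral_const_mul, integral_add ((integrable_cast_pow hx 2).div_const _)
    (integrable_const _), integral_div, integral_cast_sq hx, integral_const, probReal_univ,
    one_smul]
  field_simp

end

lemma tendsto_mul_skellamInfo_zero :
    Tendsto (fun x => x * skellamInfo x) (𝓝[>] 0) (𝓝 1) := by
  have hlin : Tendsto (fun x : ℝ => 3 * x) (𝓝[>] 0) (𝓝 0) :=
    (Continuous.tendsto' (by fun_prop) 0 0 (mul_zero 3)).mono_left nhdsWithin_le_nhds
  refine tendsto_iff_norm_sub_tendsto_zero.2 (squeeze_zero' (.of_forall fun _ => norm_nonneg _) ?_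
    hlin)
  filter_upwards [self_mem_nhdsWithin] with x (hx : 0 < x)
  rw [show x * skellamInfo x - 1 = (skellamInfo x - 1 / x) * x by field_simp, norm_mul,
    Real.norm_of_nonneg hx.le]
  exact mul_le_mul_of_nonneg_right (abs_skellamInfo_sub_le hx) hx.le

/-! ### Asymptotics for large arguments -/

section Liouville

variable (k : ℕ)

/-- The logarithmic derivative of `√x I_k(x)`. It solves the Riccati equation
`v' = 1 + (k² - 1/4) / x² - v²`, which has no first-order term. -/
def liouvilleLogDeriv (x : ℝ) : ℝ := besselQuot k x + (k + 1 / 2) / x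

lemma half_le_liouvilleLogDeriv {x : ℝ} (hx : 0 < x) : 1 / 2 ≤ liouvilleLogDeriv k x := by
  have hpos := besselQuot_pos k hx
  rw [liouvilleLogDeriv]
  rcases le_or_gt (x / 2) (k : ℝ) with hk | hk
  · have : 1 / 2 ≤ ((k : ℝ) + 1 / 2) / x := by
      rw [div_le_div_iff₀ two_pos hx]
      linarith
    linarith
  · have hquot : x / (2 * x + 2) ≤ besselQuot k x :=
      (div_le_div_of_nonneg_left hx.le (by positivity) (by linarith)).trans (le_besselQuot k hx)
    have hdiv : 1 / 2 / x ≤ ((k : ℝ) + 1 / 2) / x := by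
      gcongr
      linarith [k.cast_nonneg (α := ℝ)]
    have : 1 / 2 ≤ x / (2 * x + 2) + 1 / 2 / x := by
      rw [div_add_div _ _ (by positivity) hx.ne', div_le_div_iff₀ two_pos (by positivity)]
      nlinarith
    linarith

/-- The opposite of the derivative of `liouvilleLogDeriv k`, as given by the Riccati equation. -/
def riccatiDefect (x : ℝ) : ℝ := liouvilleLogDeriv k x ^ 2 - 1 - ((k : ℝ) ^ 2 - 1 / 4) / x ^ 2

lemma hasDerivAt_liouvilleLogDeriv {x : ℝ} (hx : 0 < x) :
    HasDerivAt (liouvilleLogDeriv k) (-riccatiDefect k x) x := by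
  refine ((hasDerivAt_besselQuot k hx).add ((hasDerivAt_const x ((k : ℝ) + 1 / 2)).div
    (hasDerivAt_id x) hx.ne')).congr_deriv ?_
  simp only [riccatiDefect, liouvilleLogDeriv, id]
  field_simp
  ring

/-- The derivative of `riccatiDefect k`. -/
def riccatiDefectDeriv (x : ℝ) : ℝ :=
  2 * ((k : ℝ) ^ 2 - 1 / 4) / x ^ 3 - 2 * liouvilleLogDeriv k x * riccatiDefect k x

lemma hasDerivAt_riccatiDefect {x : ℝ} (hx : 0 < x) :
    HasDerivAt (riccatiDefect k) (riccatiDefectDeriv k x) x := by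
  refine ((((hasDerivAt_liouvilleLogDeriv k hx).pow 2).sub_const 1).sub
    ((hasDerivAt_const x ((k : ℝ) ^ 2 - 1 / 4)).div (hasDerivAt_pow 2 x)
      (pow_ne_zero 2 hx.ne'))).congr_deriv ?_
  simp only [riccatiDefectDeriv]
  field_simp
  ring

lemma hasDerivAt_riccatiDefectDeriv {x : ℝ} (hx : 0 < x) :
    HasDerivAt (riccatiDefectDeriv k)
      (2 * riccatiDefect k x ^ 2 - 6 * ((k : ℝ) ^ 2 - 1 / 4) / x ^ 4
        - 2 * liouvilleLogDeriv k x * riccatiDefectDeriv k x) x := by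
  refine (((hasDerivAt_const x (2 * ((k : ℝ) ^ 2 - 1 / 4))).div (hasDerivAt_pow 3 x)
    (pow_ne_zero 3 hx.ne')).sub (((hasDerivAt_liouvilleLogDeriv k hx).const_mul 2).mul
      (hasDerivAt_riccatiDefect k hx))).congr_deriv ?_
  field_simp
  ring

-- `z * I_k(z) ^ 2` is an integrating factor.
lemma nonneg_of_deriv_add_liouville_nonneg {a : ℝ} (ha : 0 < a) {F F' : ℝ → ℝ}
    (hF : ∀ y, a ≤ y → HasDerivAt F (F' y) y)
    (h : ∀ y, a ≤ y → 0 ≤ F' y + 2 * liouvilleLogDeriv k y * F y) (hFa : 0 ≤ F a)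
    {y : ℝ} (hy : a ≤ y) : 0 ≤ F y := by
  have weight_pos (z : ℝ) (hz : a ≤ z) : 0 < z * besselI k z ^ 2 :=
    mul_pos (ha.trans_le hz) (pow_pos (besselI_pos k (ha.trans_le hz)) 2)
  have hderiv (z : ℝ) (hz : a ≤ z) : HasDerivAt (fun z => z * besselI k z ^ 2 * F z)
      (z * besselI k z ^ 2 * (F' z + 2 * liouvilleLogDeriv k z * F z)) z := by
    have hz0 : 0 < z := ha.trans_le hz
    have := (besselI_pos k hz0).ne'
    refine (((hasDerivAt_id z).mul ((hasDerivAt_besselI k hz0.ne').pow 2)).mul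
      (hF z hz)).congr_deriv ?_
    simp only [id, liouvilleLogDeriv, besselQuot, Pi.mul_apply, Pi.pow_apply]
    field_simp
    ring
  have mono : MonotoneOn (fun z => z * besselI k z ^ 2 * F z) (Set.Ici a) := by
    refine monotoneOn_of_hasDerivWithinAt_nonneg (convex_Ici a)
      (fun z hz => (hderiv z hz).continuousAt.continuousWithinAt)
      (fun z hz => (hderiv z (interior_subset hz)).hasDerivWithinAt) fun z hz => ?_
    exact mul_nonneg (weight_pos z (interior_subset hz)).le (h z (interior_subset hz))
  exact nonneg_of_mul_nonneg_right ((mul_nonneg (weight_pos a le_rfl).le hFa).trans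
    (mono Set.self_mem_Ici (Set.mem_Ici.2 hy) hy)) (weight_pos y hy)

-- `2 * S` is a supersolution because `liouvilleLogDeriv k` is at least `1 / 2`.
lemma abs_le_of_abs_deriv_add_liouville_le {a : ℝ} (ha : 0 < a) {e e' S S' : ℝ → ℝ}
    (he : ∀ y, a ≤ y → HasDerivAt e (e' y) y) (hS : ∀ y, a ≤ y → HasDerivAt S (S' y) y)
    (hS' : ∀ y, a ≤ y → -(S y / 2) ≤ S' y)
    (h : ∀ y, a ≤ y → |e' y + 2 * liouvilleLogDeriv k y * e y| ≤ S y)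
    (hea : |e a| ≤ 2 * S a) {y : ℝ} (hy : a ≤ y) : |e y| ≤ 2 * S y := by
  have supersolution (y : ℝ) (hy : a ≤ y) :
      S y ≤ 2 * S' y + 2 * liouvilleLogDeriv k y * (2 * S y) := by
    have hnonneg : 0 ≤ S y := (abs_nonneg _).trans (h y hy)
    nlinarith [hS' y hy, half_le_liouvilleLogDeriv k (ha.trans_le hy)]
  have hupper : 0 ≤ 2 * S y - e y := nonneg_of_deriv_add_liouville_nonneg k ha
    (F := fun y => 2 * S y - e y) (fun z hz => ((hS z hz).const_mul 2).sub (he z hz))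
    (fun z hz => by linarith [supersolution z hz, (abs_le.1 (h z hz)).2])
    (by linarith [(abs_le.1 hea).2]) hy
  have hlower : 0 ≤ 2 * S y + e y := nonneg_of_deriv_add_liouville_nonneg k ha
    (F := fun y => 2 * S y + e y) (fun z hz => ((hS z hz).const_mul 2).add (he z hz))
    (fun z hz => by linarith [supersolution z hz, (abs_le.1 (h z hz)).1])
    (by linarith [(abs_le.1 hea).1]) hy
  exact abs_le.2 ⟨by linarith, by linarith⟩

lemma abs_sq_sub_quarter_le : |(k : ℝ) ^ 2 - 1 / 4| ≤ 1 + (k : ℝ) ^ 2 :=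
  abs_le.2 ⟨by linarith [sq_nonneg (k : ℝ)], by linarith⟩

end Liouville

section

variable {x : ℝ} (k : ℤ)

lemma skellamScore_eq :
    skellamScore x k = liouvilleLogDeriv k.natAbs x - 1 - 1 / (2 * x) := by
  rw [skellamScore, liouvilleLogDeriv]
  field_simp
  ring

lemma skellamScoreDeriv_eq (hx : 0 < x) :
    skellamScoreDeriv x k = -riccatiDefect k.natAbs x + 1 / (2 * x ^ 2) := by
  simp only [skellamScoreDeriv, riccatiDefect, liouvilleLogDeriv]
  field_simp
  ring

lemma skellamScoreDeriv₂_eq (hx : 0 < x) :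
    skellamScoreDeriv₂ x k = -riccatiDefectDeriv k.natAbs x - 1 / x ^ 3 := by
  simp only [skellamScoreDeriv₂, riccatiDefectDeriv, riccatiDefect, liouvilleLogDeriv]
  field_simp
  ring

end

section LargeArgument

variable (k : ℕ) {x : ℝ} (hx : 16 ≤ x)
include hx

lemma abs_riccatiDefect_le : |riccatiDefect k x| ≤ 2 ^ 13 * (1 + (k : ℝ) ^ 2) / x ^ 3 := by
  set M := 1 + (k : ℝ) ^ 2
  have initial : |riccatiDefect k 16| ≤ 2 * (2 ^ 12 * M / 16 ^ 3) := by
    have hbound := abs_skellamScoreDeriv_le (x := 16) (by norm_num) k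
    rw [skellamScoreDeriv_eq _ (by norm_num), Int.natAbs_natCast, abs_le] at hbound
    rw [abs_le]
    constructor <;> nlinarith [sq_nonneg ((k : ℝ) - 1)]
  refine (abs_le_of_abs_deriv_add_liouville_le k (a := 16) (S := fun y => 2 ^ 12 * M / y ^ 3)
    (S' := fun y => -(3 / y) * (2 ^ 12 * M / y ^ 3)) (by norm_num)
    (fun y hy => hasDerivAt_riccatiDefect k (by linarith)) (fun y hy => ?_) (fun y hy => ?_)
    (fun y hy => ?_) initial hx).trans_eq (by ring)
  all_goals have hy0 : 0 < y := by linarith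
  · refine ((hasDerivAt_const y (2 ^ 12 * M)).div (hasDerivAt_pow 3 y)
      (pow_ne_zero 3 hy0.ne')).congr_deriv ?_
    field_simp
    ring
  · have hy3 : 3 / y ≤ 1 / 2 := by rw [div_le_div_iff₀ hy0 two_pos]; linarith
    have : 0 ≤ 2 ^ 12 * M / y ^ 3 := by positivity
    nlinarith
  · rw [riccatiDefectDeriv, sub_add_cancel, abs_div, abs_mul, abs_two, abs_of_pos (pow_pos hy0 3)]
    have := abs_sq_sub_quarter_le k
    gcongr
    norm_num

lemma abs_liouvilleLogDeriv_sub_one_le :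
    |liouvilleLogDeriv k x - 1| ≤ 2 ^ 10 * (1 + (k : ℝ) ^ 2) / x ^ 2 := by
  have hx0 : 0 < x := by linarith
  have hhalf := half_le_liouvilleLogDeriv k hx0
  have factor : (liouvilleLogDeriv k x - 1) * (liouvilleLogDeriv k x + 1) =
      riccatiDefect k x + ((k : ℝ) ^ 2 - 1 / 4) / x ^ 2 := by
    rw [riccatiDefect]
    ring
  calc |liouvilleLogDeriv k x - 1|
      ≤ |liouvilleLogDeriv k x - 1| * |liouvilleLogDeriv k x + 1| :=
        le_mul_of_one_le_right (abs_nonneg _) (le_abs.2 (.inl (by linarith)))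
    _ = |riccatiDefect k x + ((k : ℝ) ^ 2 - 1 / 4) / x ^ 2| := by rw [← abs_mul, factor]
    _ ≤ 2 ^ 13 * (1 + (k : ℝ) ^ 2) / x ^ 3 + (1 + (k : ℝ) ^ 2) / x ^ 2 := by
        refine (abs_add_le _ _).trans (add_le_add (abs_riccatiDefect_le k hx) ?_)
        rw [abs_div, abs_of_pos (pow_pos hx0 2)]
        gcongr
        exact abs_sq_sub_quarter_le k
    _ = (2 ^ 13 / x + 1) * (1 + (k : ℝ) ^ 2) / x ^ 2 := by field_simp
    _ ≤ 2 ^ 10 * (1 + (k : ℝ) ^ 2) / x ^ 2 := by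
        gcongr
        have : 2 ^ 13 / x ≤ 2 ^ 13 / 16 := by gcongr
        linarith

lemma abs_riccatiDefectDeriv_le : |riccatiDefectDeriv k x| ≤
    2 ^ 28 * ((1 + (k : ℝ) ^ 2) / x ^ 4 + (1 + (k : ℝ) ^ 2) ^ 2 / x ^ 6) := by
  set M := 1 + (k : ℝ) ^ 2
  have hM : 0 < M := by positivity
  have initial : |riccatiDefectDeriv k 16| ≤ 2 * (2 ^ 27 * (M / 16 ^ 4 + M ^ 2 / 16 ^ 6)) := by
    have hbound := abs_skellamScoreDeriv₂_le (x := 16) (by norm_num) k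
    rw [skellamScoreDeriv₂_eq _ (by norm_num), Int.natAbs_natCast, abs_le] at hbound
    have hkM : (k : ℝ) ≤ M := by nlinarith [sq_nonneg ((k : ℝ) - 1)]
    have : 1 ≤ M := le_add_of_nonneg_right (sq_nonneg _)
    rw [abs_le]
    constructor <;> nlinarith
  refine (abs_le_of_abs_deriv_add_liouville_le k (a := 16)
    (S := fun y => 2 ^ 27 * (M / y ^ 4 + M ^ 2 / y ^ 6))
    (S' := fun y => -(1 / y) * (2 ^ 27 * (4 * (M / y ^ 4) + 6 * (M ^ 2 / y ^ 6)))) (by norm_num)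
    (fun y hy => hasDerivAt_riccatiDefectDeriv k (by linarith)) (fun y hy => ?_) (fun y hy => ?_)
    (fun y hy => ?_) initial hx).trans_eq (by ring)
  all_goals have hy0 : 0 < y := by linarith
  · refine ((((hasDerivAt_const y M).div (hasDerivAt_pow 4 y) (pow_ne_zero 4 hy0.ne')).add
      ((hasDerivAt_const y (M ^ 2)).div (hasDerivAt_pow 6 y)
        (pow_ne_zero 6 hy0.ne'))).const_mul _).congr_deriv ?_
    field_simp
    ring
  · have hy12 : 1 / y ≤ 1 / 12 := one_div_le_one_div_of_le (by norm_num) (by linarith)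
    have hfour : 0 ≤ M / y ^ 4 := by positivity
    have hsix : 0 ≤ M ^ 2 / y ^ 6 := by positivity
    nlinarith
  · have square : riccatiDefect k y ^ 2 ≤ 2 ^ 26 * (M ^ 2 / y ^ 6) := by
      rw [← sq_abs]
      exact (pow_le_pow_left₀ (abs_nonneg _) (abs_riccatiDefect_le k hy) 2).trans_eq (by ring)
    have source : |6 * ((k : ℝ) ^ 2 - 1 / 4) / y ^ 4| ≤ 6 * (M / y ^ 4) := by
      rw [abs_div, abs_mul, abs_of_pos (pow_pos hy0 4), mul_div_assoc, abs_of_pos (by norm_num)]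
      gcongr
      exact abs_sq_sub_quarter_le k
    have hfour : 0 ≤ M / y ^ 4 := by positivity
    rw [sub_add_cancel]
    refine (abs_sub _ _).trans ((add_le_add (abs_of_nonneg (by positivity)).le source).trans ?_)
    linarith

end LargeArgument

/-- The polynomial in `k` whose powers bound the score and its derivatives for large `x`; its
moments under the Skellam distribution are bounded uniformly in `x ≥ 1`. -/
def scoreEnvelope (x : ℝ) (k : ℤ) : ℝ := 1 + (k : ℝ) ^ 2 / x

section

variable {x : ℝ}

lemma one_le_scoreEnvelope (hx : 0 < x) (k : ℤ) : 1 ≤ scoreEnvelope x k :=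
  le_add_of_nonneg_right (by positivity)

lemma polyGrowth_scoreEnvelope (x : ℝ) : PolyGrowth (scoreEnvelope x) :=
  (PolyGrowth.const 1).add ((PolyGrowth.cast.pow 2).div_const x)

lemma one_add_sq_le_mul_scoreEnvelope (hx : 1 ≤ x) (k : ℤ) :
    1 + (k.natAbs : ℝ) ^ 2 ≤ x * scoreEnvelope x k := by
  have : 0 < x := by linarith
  rw [scoreEnvelope, natAbs_cast_sq, mul_add, mul_one, mul_div_cancel₀ _ this.ne']
  gcongr

lemma scoreEnvelope_le_two_mul {y : ℝ} (hx : 0 < x) (hxy : x / 2 ≤ y) (k : ℤ) :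
    scoreEnvelope y k ≤ 2 * scoreEnvelope x k := by
  have hdiv : (k : ℝ) ^ 2 / y ≤ (k : ℝ) ^ 2 / (x / 2) :=
    div_le_div_of_nonneg_left (sq_nonneg _) (half_pos hx) hxy
  rw [div_div_eq_mul_div, mul_comm, mul_div_assoc] at hdiv
  rw [scoreEnvelope, scoreEnvelope]
  linarith

lemma integral_scoreEnvelope_pow_four_le (hx : 1 ≤ x) :
    ∫ k, scoreEnvelope x k ^ 4 ∂skellamMeasure x ≤ 3040 := by
  have hx0 : 0 < x := by linarith
  have growth := (PolyGrowth.const 1).add ((PolyGrowth.cast.pow 8).div_const (x ^ 4))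
  have pointwise (k : ℤ) : scoreEnvelope x k ^ 4 ≤ 8 * (1 + (k : ℝ) ^ 8 / x ^ 4) := by
    refine (add_pow_le zero_le_one (by positivity) 4).trans_eq ?_
    rw [div_pow, ← pow_mul]
    norm_num
  refine (((polyGrowth_scoreEnvelope x).pow 4).integral_mono (growth.const_mul 8) hx0
    pointwise).trans ?_
  rw [integral_const_mul, integral_add (integrable_const _)
    ((integrable_cast_pow hx0 8).div_const _), integral_div, integral_cast_pow_eight hx0,
    integral_const, probReal_univ, one_smul]
  have moment : (105 * x ^ 4 + 210 * x ^ 3 + 63 * x ^ 2 + x) / x ^ 4 ≤ 379 := by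
    rw [div_le_iff₀ (by positivity)]
    have hcube : x ^ 3 ≤ x ^ 4 := pow_le_pow_right₀ hx (by norm_num)
    have hsq : x ^ 2 ≤ x ^ 4 := pow_le_pow_right₀ hx (by norm_num)
    have hone : x ≤ x ^ 4 := le_self_pow₀ hx (by norm_num)
    linarith
  linarith

lemma abs_integral_le_of_abs_le_scoreEnvelope {φ : ℤ → ℝ} {c : ℝ} (hx : 1 ≤ x) (hc : 0 ≤ c)
    (h : ∀ k, |φ k| ≤ c * scoreEnvelope x k ^ 4) :
    |∫ k, φ k ∂skellamMeasure x| ≤ 3040 * c := by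
  have hx0 : 0 < x := by linarith
  have growth := ((polyGrowth_scoreEnvelope x).pow 4).const_mul c
  calc ‖∫ k, φ k ∂skellamMeasure x‖ ≤ ∫ k, c * scoreEnvelope x k ^ 4 ∂skellamMeasure x :=
        norm_integral_le_of_norm_le (growth.integrable hx0) (ae_of_all _ h)
    _ = c * ∫ k, scoreEnvelope x k ^ 4 ∂skellamMeasure x := integral_const_mul _ _
    _ ≤ c * 3040 := mul_le_mul_of_nonneg_left (integral_scoreEnvelope_pow_four_le hx) hc
    _ = 3040 * c := mul_comm _ _

end

/-- The score of the centred normal distribution with variance `x`, which the Skellam distribution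
approaches as `x → ∞`. -/
def gaussianScore (x : ℝ) (k : ℤ) : ℝ := ((k : ℝ) ^ 2 / x - 1) / (2 * x)

lemma polyGrowth_gaussianScore (x : ℝ) : PolyGrowth (gaussianScore x) :=
  (((PolyGrowth.cast.pow 2).div_const x).sub_const 1).div_const (2 * x)

section

variable {x : ℝ} (hx : 16 ≤ x) (k : ℤ)
include hx

lemma abs_liouvilleLogDeriv_sub_one_le_scoreEnvelope :
    |liouvilleLogDeriv k.natAbs x - 1| ≤ 2 ^ 10 * (scoreEnvelope x k / x) := by
  have : 0 < x := by linarith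
  refine (abs_liouvilleLogDeriv_sub_one_le k.natAbs hx).trans ?_
  rw [mul_div_assoc]
  refine mul_le_mul_of_nonneg_left ?_ (by norm_num)
  calc (1 + (k.natAbs : ℝ) ^ 2) / x ^ 2 ≤ x * scoreEnvelope x k / x ^ 2 := by
        gcongr
        exact one_add_sq_le_mul_scoreEnvelope (by linarith) k
    _ = _ := by field_simp

lemma abs_riccatiDefect_le_scoreEnvelope :
    |riccatiDefect k.natAbs x| ≤ 2 ^ 13 * (scoreEnvelope x k / x ^ 2) := by
  have : 0 < x := by linarith
  refine (abs_riccatiDefect_le k.natAbs hx).trans ?_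
  rw [mul_div_assoc]
  refine mul_le_mul_of_nonneg_left ?_ (by norm_num)
  calc (1 + (k.natAbs : ℝ) ^ 2) / x ^ 3 ≤ x * scoreEnvelope x k / x ^ 3 := by
        gcongr
        exact one_add_sq_le_mul_scoreEnvelope (by linarith) k
    _ = _ := by field_simp

lemma abs_skellamScore_le_scoreEnvelope :
    |skellamScore x k| ≤ 2 ^ 11 * (scoreEnvelope x k / x) := by
  have hx0 : 0 < x := by linarith
  have hone : 1 / (2 * x) ≤ scoreEnvelope x k / x := by
    have := one_le_scoreEnvelope hx0 k
    gcongr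
    linarith
  rw [skellamScore_eq]
  refine (abs_sub _ _).trans ((add_le_add
    (abs_liouvilleLogDeriv_sub_one_le_scoreEnvelope hx k)
    ((abs_of_pos (by positivity)).trans_le hone)).trans ?_)
  have := (by positivity : 0 ≤ 1 / (2 * x)).trans hone
  linarith

lemma abs_skellamScoreDeriv_le_scoreEnvelope :
    |skellamScoreDeriv x k| ≤ 2 ^ 14 * (scoreEnvelope x k / x ^ 2) := by
  have hx0 : 0 < x := by linarith
  have hone : 1 / (2 * x ^ 2) ≤ scoreEnvelope x k / x ^ 2 := by
    have := one_le_scoreEnvelope hx0 k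
    gcongr
    linarith [sq_nonneg x]
  rw [skellamScoreDeriv_eq _ hx0]
  refine (abs_add_le _ _).trans ((add_le_add
    ((abs_neg _).trans_le (abs_riccatiDefect_le_scoreEnvelope hx k))
    ((abs_of_pos (by positivity)).trans_le hone)).trans ?_)
  have := (by positivity : 0 ≤ 1 / (2 * x ^ 2)).trans hone
  linarith

lemma abs_skellamScoreDeriv₂_le_scoreEnvelope :
    |skellamScoreDeriv₂ x k| ≤ 2 ^ 30 * (scoreEnvelope x k ^ 2 / x ^ 3) := by
  have hx0 : 0 < x := by linarith
  have hM := one_add_sq_le_mul_scoreEnvelope (by linarith : 1 ≤ x) k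
  have hQ := one_le_scoreEnvelope hx0 k
  set Q := scoreEnvelope x k
  have linear : (1 + (k.natAbs : ℝ) ^ 2) / x ^ 4 ≤ Q ^ 2 / x ^ 3 := by
    calc (1 + (k.natAbs : ℝ) ^ 2) / x ^ 4 ≤ x * Q / x ^ 4 := by gcongr
      _ = Q / x ^ 3 := by field_simp
      _ ≤ Q ^ 2 / x ^ 3 := by gcongr; exact le_self_pow₀ hQ two_ne_zero
  have quadratic : (1 + (k.natAbs : ℝ) ^ 2) ^ 2 / x ^ 6 ≤ Q ^ 2 / x ^ 3 := by
    calc (1 + (k.natAbs : ℝ) ^ 2) ^ 2 / x ^ 6 ≤ (x * Q) ^ 2 / x ^ 6 := by gcongr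
      _ = Q ^ 2 / x ^ 4 := by field_simp
      _ ≤ Q ^ 2 / x ^ 3 := by gcongr <;> linarith
  have hone : 1 / x ^ 3 ≤ Q ^ 2 / x ^ 3 := by
    gcongr
    exact one_le_pow₀ hQ
  rw [skellamScoreDeriv₂_eq _ hx0]
  refine (abs_sub _ _).trans ((add_le_add
    ((abs_neg _).trans_le (abs_riccatiDefectDeriv_le k.natAbs hx))
    ((abs_of_pos (by positivity)).trans_le hone)).trans ?_)
  have := (by positivity : 0 ≤ 1 / x ^ 3).trans hone
  linarith

-- Both errors come from `v - 1 = (v² - 1) / 2 - (v - 1)² / 2` for `v = liouvilleLogDeriv |k| x`.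
lemma abs_skellamScore_sub_le :
    |skellamScore x k - gaussianScore x k| ≤
      2 ^ 20 * (scoreEnvelope x k ^ 2 / x ^ 2) := by
  have hx0 : 0 < x := by linarith
  have hQ := one_le_scoreEnvelope hx0 k
  have hdefect := abs_riccatiDefect_le_scoreEnvelope hx k
  have hv := abs_liouvilleLogDeriv_sub_one_le_scoreEnvelope hx k
  set Q := scoreEnvelope x k
  have expand : skellamScore x k - gaussianScore x k =
      riccatiDefect k.natAbs x / 2 - 1 / (8 * x ^ 2)
        - (liouvilleLogDeriv k.natAbs x - 1) ^ 2 / 2 := by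
    rw [skellamScore_eq, gaussianScore, riccatiDefect, natAbs_cast_sq]
    field_simp
    ring
  have square : (liouvilleLogDeriv k.natAbs x - 1) ^ 2 ≤ 2 ^ 20 * (Q ^ 2 / x ^ 2) := by
    rw [← sq_abs]
    exact (pow_le_pow_left₀ (abs_nonneg _) hv 2).trans_eq (by ring)
  have hQsq : Q / x ^ 2 ≤ Q ^ 2 / x ^ 2 := by
    gcongr
    exact le_self_pow₀ hQ two_ne_zero
  have hone : 1 / (8 * x ^ 2) ≤ Q ^ 2 / x ^ 2 := by
    gcongr
    · exact one_le_pow₀ hQ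
    · linarith [sq_nonneg x]
  have : 0 < 1 / (8 * x ^ 2) := by positivity
  rw [expand, abs_le]
  constructor <;> linarith [abs_le.1 hdefect, sq_nonneg (liouvilleLogDeriv k.natAbs x - 1)]

lemma abs_skellamScore_sq_sub_gaussian_le :
    |skellamScore x k ^ 2 - gaussianScore x k ^ 2| ≤
      2 ^ 32 / x ^ 3 * scoreEnvelope x k ^ 4 := by
  have hx0 : 0 < x := by linarith
  have hQ := one_le_scoreEnvelope hx0 k
  have leading : |gaussianScore x k| ≤ scoreEnvelope x k / x := by
    have hdiv : 0 ≤ (k : ℝ) ^ 2 / x := by positivity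
    have hnum : |(k : ℝ) ^ 2 / x - 1| ≤ scoreEnvelope x k := by
      rw [scoreEnvelope, abs_le]
      constructor <;> linarith
    rw [gaussianScore, abs_div, abs_of_pos (by positivity : 0 < 2 * x)]
    gcongr
    linarith
  have hscore := abs_skellamScore_le_scoreEnvelope hx k
  have herror := abs_skellamScore_sub_le hx k
  set Q := scoreEnvelope x k
  rw [sq_sub_sq, abs_mul]
  calc |skellamScore x k + gaussianScore x k| *
        |skellamScore x k - gaussianScore x k|
      ≤ (2 ^ 11 * (Q / x) + Q / x) * (2 ^ 20 * (Q ^ 2 / x ^ 2)) := by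
        gcongr
        exact (abs_add_le _ _).trans (add_le_add hscore leading)
    _ ≤ 2 ^ 32 / x ^ 3 * Q ^ 3 := by
        rw [show (2 ^ 11 * (Q / x) + Q / x) * (2 ^ 20 * (Q ^ 2 / x ^ 2)) =
          ((2 ^ 11 + 1) * 2 ^ 20) / x ^ 3 * Q ^ 3 by ring]
        gcongr
        norm_num
    _ ≤ 2 ^ 32 / x ^ 3 * Q ^ 4 := by gcongr; norm_num

end

lemma integral_gaussianScore_sq {x : ℝ} (hx : 0 < x) :
    ∫ k : ℤ, gaussianScore x k ^ 2 ∂skellamMeasure x =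
      1 / (2 * x ^ 2) + 1 / (4 * x ^ 3) := by
  have expand (k : ℤ) : gaussianScore x k ^ 2 =
      1 / (4 * x ^ 4) * (k : ℝ) ^ 4 - 1 / (2 * x ^ 3) * (k : ℝ) ^ 2 + 1 / (4 * x ^ 2) := by
    rw [gaussianScore]
    field_simp
    ring
  have hfour := (integrable_cast_pow hx 4).const_mul (1 / (4 * x ^ 4))
  have hsq := (integrable_cast_pow hx 2).const_mul (1 / (2 * x ^ 3))
  simp only [expand]
  have sum_integral := integral_add (hfour.sub hsq) (integrable_const (1 / (4 * x ^ 2)))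
  simp only [Pi.sub_apply] at sum_integral
  rw [sum_integral, integral_sub hfour hsq,
    integral_const_mul, integral_const_mul, integral_cast_pow_four hx, integral_cast_sq hx,
    integral_const, probReal_univ, one_smul]
  field_simp
  ring

lemma exists_abs_skellamInfo_sub_le :
    ∃ C, ∀ x, 16 ≤ x → |skellamInfo x - 1 / (2 * x ^ 2)| ≤ C / x ^ 3 := by
  refine ⟨3040 * 2 ^ 32 + 1 / 4, fun x hx => ?_⟩
  have hx0 : 0 < x := by linarith
  have error := abs_integral_le_of_abs_le_scoreEnvelope (by linarith) (by positivity)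
    (abs_skellamScore_sq_sub_gaussian_le hx)
  rw [integral_sub (((polyGrowth_skellamScore hx0).pow 2).integrable hx0)
    (((polyGrowth_gaussianScore x).pow 2).integrable hx0),
    ← skellamInfo, integral_gaussianScore_sq hx0] at error
  calc |skellamInfo x - 1 / (2 * x ^ 2)|
      = |(skellamInfo x - (1 / (2 * x ^ 2) + 1 / (4 * x ^ 3))) + 1 / (4 * x ^ 3)| := by
        congr 1
        ring
    _ ≤ 3040 * (2 ^ 32 / x ^ 3) + 1 / (4 * x ^ 3) :=
        (abs_add_le _ _).trans (add_le_add error (abs_of_pos (by positivity)).le)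
    _ = _ := by field_simp

lemma tendsto_mul_skellamInfo_atTop :
    Tendsto (fun x => 2 * x ^ 2 * skellamInfo x) atTop (𝓝 1) := by
  obtain ⟨C, hC⟩ := exists_abs_skellamInfo_sub_le
  refine tendsto_iff_norm_sub_tendsto_zero.2 (squeeze_zero' (.of_forall fun _ => norm_nonneg _) ?_
    (tendsto_const_nhds.div_atTop tendsto_id : Tendsto (fun x : ℝ => 2 * C / x) atTop (𝓝 0)))
  filter_upwards [eventually_ge_atTop 16] with x hx
  have : 0 < x := by linarith
  calc ‖2 * x ^ 2 * skellamInfo x - 1‖ = 2 * x ^ 2 * |skellamInfo x - 1 / (2 * x ^ 2)| := by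
        rw [Real.norm_eq_abs, ← abs_of_pos (by positivity : 0 < 2 * x ^ 2), ← abs_mul,
          abs_of_pos (by positivity : 0 < 2 * x ^ 2)]
        congr 1
        field_simp
    _ ≤ 2 * x ^ 2 * (C / x ^ 3) := by gcongr; exact hC x hx
    _ = 2 * C / x := by field_simp

/-! ### Bounds uniform in the scale -/

lemma exists_forall_pos_le_of_tendsto {f : ℝ → ℝ} {a b : ℝ} (hf : ContinuousOn f (Set.Ioi 0))
    (hzero : Tendsto f (𝓝[>] 0) (𝓝 a)) (htop : Tendsto f atTop (𝓝 b)) :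
    ∃ C, ∀ x, 0 < x → f x ≤ C := by
  obtain ⟨δ, hδ, near_zero⟩ := mem_nhdsGT_iff_exists_Ioo_subset.1
    (hzero.eventually_lt_const (lt_add_one a))
  obtain ⟨M, near_top⟩ := eventually_atTop.1 (htop.eventually_lt_const (lt_add_one b))
  obtain ⟨K, hK⟩ := isCompact_Icc.bddAbove_image
    (hf.mono fun x hx => Set.mem_Ioi.2 (lt_of_lt_of_le hδ hx.1))
  refine ⟨max K (max (a + 1) (b + 1)), fun x hx => ?_⟩
  rcases lt_or_ge x δ with hlt | hge
  · exact (near_zero ⟨hx, hlt⟩).le.trans ((le_max_left _ _).trans (le_max_right _ _))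
  rcases le_or_gt x M with hle | hgt
  · exact (hK (Set.mem_image_of_mem f ⟨hge, hle⟩)).trans (le_max_left _ _)
  · exact (near_top x hgt.le).le.trans ((le_max_right _ _).trans (le_max_right _ _))

lemma exists_forall_pos_le_div {f : ℝ → ℝ} {p : ℕ} {r A B : ℝ} (hr : 0 < r) (hA : 0 ≤ A)
    (hB : 0 ≤ B) (small : ∀ x, 0 < x → x < r → f x ≤ A / x ^ p)
    (large : ∀ x, r ≤ x → f x ≤ B / x ^ (p + 1)) :
    ∃ C, 0 ≤ C ∧ ∀ x, 0 < x → f x ≤ C / (x ^ p * (1 + x)) := by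
  refine ⟨A * (1 + r) + B * (1 / r + 1), by positivity, fun x hx => ?_⟩
  have hA' : 0 ≤ A * (1 + r) := by positivity
  have hB' : 0 ≤ B * (1 / r + 1) := by positivity
  rcases lt_or_ge x r with hxr | hrx
  · calc f x ≤ A / x ^ p := small x hx hxr
      _ = A * (1 + x) / (x ^ p * (1 + x)) := by field_simp
      _ ≤ _ := by
        gcongr
        exact (mul_le_mul_of_nonneg_left (by linarith) hA).trans (le_add_of_nonneg_right hB')
  · calc f x ≤ B / x ^ (p + 1) := large x hrx
      _ = B * (1 / x + 1) / (x ^ p * (1 + x)) := by field_simp; ring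
      _ ≤ _ := by
        gcongr
        refine le_trans ?_ (le_add_of_nonneg_left hA')
        gcongr

lemma tendsto_mul_one_add_mul_skellamInfo_zero :
    Tendsto (fun x => x * (1 + x) * skellamInfo x) (𝓝[>] 0) (𝓝 1) := by
  have hlin : Tendsto (fun x : ℝ => 1 + x) (𝓝[>] 0) (𝓝 1) :=
    (Continuous.tendsto' (by fun_prop) 0 1 (add_zero 1)).mono_left nhdsWithin_le_nhds
  refine ((hlin.mul tendsto_mul_skellamInfo_zero).congr fun x => ?_).trans_eq (by rw [mul_one])
  ring

lemma tendsto_mul_one_add_mul_skellamInfo_atTop :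
    Tendsto (fun x => x * (1 + x) * skellamInfo x) atTop (𝓝 (1 / 2)) := by
  have hlin : Tendsto (fun x : ℝ => (x⁻¹ + 1) / 2) atTop (𝓝 ((0 + 1) / 2)) :=
    (tendsto_inv_atTop_zero.add_const 1).div_const 2
  rw [zero_add] at hlin
  refine ((hlin.mul tendsto_mul_skellamInfo_atTop).congr' ?_).trans_eq (by rw [mul_one])
  filter_upwards [eventually_gt_atTop 0] with x hx
  field_simp

lemma continuousOn_mul_one_add_mul_skellamInfo :
    ContinuousOn (fun x => x * (1 + x) * skellamInfo x) (Set.Ioi 0) := by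
  have hinfo : ContinuousOn skellamInfo (Set.Ioi 0) := fun x hx =>
    (continuousAt_skellamInfo hx).continuousWithinAt
  fun_prop

lemma exists_mul_one_add_mul_skellamInfo_le :
    ∃ C, ∀ x, 0 < x → x * (1 + x) * skellamInfo x ≤ C :=
  exists_forall_pos_le_of_tendsto continuousOn_mul_one_add_mul_skellamInfo
    tendsto_mul_one_add_mul_skellamInfo_zero tendsto_mul_one_add_mul_skellamInfo_atTop

lemma exists_inv_le_mul_skellamInfo :
    ∃ C, 0 < C ∧ ∀ x, 0 < x → 1 / (x * (1 + x)) ≤ C * skellamInfo x := by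
  have pos (x : ℝ) (hx : 0 < x) : 0 < x * (1 + x) * skellamInfo x :=
    mul_pos (by positivity) (skellamInfo_pos hx)
  obtain ⟨C, hC⟩ := exists_forall_pos_le_of_tendsto
    (continuousOn_mul_one_add_mul_skellamInfo.inv₀ fun x hx => (pos x hx).ne')
    (tendsto_mul_one_add_mul_skellamInfo_zero.inv₀ one_ne_zero)
    (tendsto_mul_one_add_mul_skellamInfo_atTop.inv₀ one_half_pos.ne')
  refine ⟨C, (inv_pos.2 (pos 1 one_pos)).trans_le (hC 1 one_pos), fun x hx => ?_⟩
  have hinfo := skellamInfo_pos hx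
  calc 1 / (x * (1 + x)) = (x * (1 + x) * skellamInfo x)⁻¹ * skellamInfo x := by field_simp
    _ ≤ C * skellamInfo x := mul_le_mul_of_nonneg_right (hC x hx) hinfo.le

lemma exists_le_mul_skellamInfo_sq {f : ℝ → ℝ} {A : ℝ} (hA : 0 ≤ A)
    (hf : ∀ x, 0 < x → f x ≤ A / (x ^ 3 * (1 + x))) :
    ∃ C, ∀ x, 0 < x → f x ≤ C * ((1 + 1 / x) * skellamInfo x ^ 2) := by
  obtain ⟨C, _, hC⟩ := exists_inv_le_mul_skellamInfo
  refine ⟨A * C ^ 2, fun x hx => ?_⟩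
  calc f x ≤ A / (x ^ 3 * (1 + x)) := hf x hx
    _ = A * ((1 + 1 / x) * (1 / (x * (1 + x))) ^ 2) := by field_simp; ring
    _ ≤ A * ((1 + 1 / x) * (C * skellamInfo x) ^ 2) := by gcongr; exact hC x hx
    _ = _ := by ring

lemma exists_integral_skellamScore_pow_four_le :
    ∃ C, ∀ x, 0 < x → ∫ k, skellamScore x k ^ 4 ∂skellamMeasure x ≤
      C * ((1 + 1 / x) * skellamInfo x ^ 2) := by
  have small (x : ℝ) (hx : 0 < x) (hx16 : x < 16) :
      ∫ k, skellamScore x k ^ 4 ∂skellamMeasure x ≤ 8 * (3 * 16 + 1 + 16 ^ 3) / x ^ 3 :=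
    calc ∫ k, skellamScore x k ^ 4 ∂skellamMeasure x
        ≤ 8 * ((3 * x ^ 2 + x) / x ^ 4 + 1) := integral_skellamScore_pow_four_le hx
      _ = 8 * (3 * x + 1 + x ^ 3) / x ^ 3 := by field_simp
      _ ≤ _ := by gcongr
  have large (x : ℝ) (hx : 16 ≤ x) :
      ∫ k, skellamScore x k ^ 4 ∂skellamMeasure x ≤ 3040 * 2 ^ 44 / x ^ (3 + 1) := by
    rw [mul_div_assoc]
    refine (le_abs_self _).trans (abs_integral_le_of_abs_le_scoreEnvelope (by linarith)
      (by positivity) fun k => ?_)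
    calc |skellamScore x k ^ 4| = |skellamScore x k| ^ 4 := abs_pow _ _
      _ ≤ (2 ^ 11 * (scoreEnvelope x k / x)) ^ 4 := by
        gcongr
        exact abs_skellamScore_le_scoreEnvelope hx k
      _ = _ := by ring
  obtain ⟨A, hA, bound⟩ := exists_forall_pos_le_div (by norm_num) (by norm_num) (by norm_num)
    small large
  exact exists_le_mul_skellamInfo_sq hA bound

lemma exists_integral_skellamScoreDeriv_sq_le :
    ∃ C, ∀ x, 0 < x → ∫ k, skellamScoreDeriv x k ^ 2 ∂skellamMeasure x ≤
      C * ((1 + 1 / x) * skellamInfo x ^ 2) := by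
  have small (x : ℝ) (hx : 0 < x) (hx16 : x < 16) :
      ∫ k, skellamScoreDeriv x k ^ 2 ∂skellamMeasure x ≤ 2 * (1 + 16 ^ 3) / x ^ 3 :=
    calc ∫ k, skellamScoreDeriv x k ^ 2 ∂skellamMeasure x
        ≤ 2 * (1 / x ^ 3 + 1) := integral_skellamScoreDeriv_sq_le hx
      _ = 2 * (1 + x ^ 3) / x ^ 3 := by field_simp
      _ ≤ _ := by gcongr
  have large (x : ℝ) (hx : 16 ≤ x) :
      ∫ k, skellamScoreDeriv x k ^ 2 ∂skellamMeasure x ≤ 3040 * 2 ^ 28 / x ^ (3 + 1) := by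
    rw [mul_div_assoc]
    refine (le_abs_self _).trans (abs_integral_le_of_abs_le_scoreEnvelope (by linarith)
      (by positivity) fun k => ?_)
    have hQ := one_le_scoreEnvelope (by linarith : 0 < x) k
    calc |skellamScoreDeriv x k ^ 2| = |skellamScoreDeriv x k| ^ 2 := abs_pow _ _
      _ ≤ (2 ^ 14 * (scoreEnvelope x k / x ^ 2)) ^ 2 := by
        gcongr
        exact abs_skellamScoreDeriv_le_scoreEnvelope hx k
      _ = 2 ^ 28 / x ^ (3 + 1) * scoreEnvelope x k ^ 2 := by ring
      _ ≤ _ := by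
        gcongr
        norm_num
  obtain ⟨A, hA, bound⟩ := exists_forall_pos_le_div (by norm_num) (by norm_num) (by norm_num)
    small large
  exact exists_le_mul_skellamInfo_sq hA bound

/-- A bound for `x ∂³ log f` on `[x / 2, ∞)`, where `f` is the Skellam mass at `k`; the large-`x`
branch makes its mean comparable to `skellamInfo x`. -/
def scoreModulus (x : ℝ) (k : ℤ) : ℝ :=
  if x < 32 then 2 * x + 4 * (k.natAbs + 1) + 16 * k.natAbs / x ^ 2
  else 2 ^ 35 * (scoreEnvelope x k ^ 2 / x ^ 2)

lemma scoreModulus_nonneg {x : ℝ} (hx : 0 < x) (k : ℤ) : 0 ≤ scoreModulus x k := by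
  unfold scoreModulus
  split_ifs <;> positivity

lemma polyGrowth_scoreModulus (x : ℝ) : PolyGrowth (scoreModulus x) := by
  unfold scoreModulus
  split_ifs
  · exact ((PolyGrowth.const _).add ((PolyGrowth.natAbs.add (.const 1)).const_mul 4)).add
      ((PolyGrowth.natAbs.const_mul 16).div_const _)
  · exact (((polyGrowth_scoreEnvelope x).pow 2).div_const _).const_mul _

lemma abs_skellamScoreDeriv₂_le_scoreModulus_div {x z : ℝ} (hx : 0 < x) (hz : x / 2 ≤ z) (k : ℤ) :
    |skellamScoreDeriv₂ z k| ≤ scoreModulus x k / x := by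
  have hz0 : 0 < z := by linarith
  unfold scoreModulus
  split_ifs with h
  · calc |skellamScoreDeriv₂ z k| ≤ 2 + 2 * (k.natAbs + 1) / z + 2 * k.natAbs / z ^ 3 :=
        abs_skellamScoreDeriv₂_le hz0 k
      _ ≤ 2 + 2 * (k.natAbs + 1) / (x / 2) + 2 * k.natAbs / (x / 2) ^ 3 := by gcongr
      _ = _ := by field_simp; ring
  · have hQ := one_le_scoreEnvelope hz0 k
    calc |skellamScoreDeriv₂ z k| ≤ 2 ^ 30 * (scoreEnvelope z k ^ 2 / z ^ 3) :=
        abs_skellamScoreDeriv₂_le_scoreEnvelope (by linarith) k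
      _ ≤ 2 ^ 30 * ((2 * scoreEnvelope x k) ^ 2 / (x / 2) ^ 3) := by
        gcongr
        exact scoreEnvelope_le_two_mul hx hz k
      _ = _ := by field_simp

lemma abs_skellamScoreDeriv_sub_le {x z : ℝ} (hx : 0 < x) (hz : x / 2 ≤ z) (k : ℤ) :
    |skellamScoreDeriv z k - skellamScoreDeriv x k| ≤ |z - x| / x * scoreModulus x k := by
  have lipschitz := (convex_Ici (x / 2)).norm_image_sub_le_of_norm_hasDerivWithin_le
    (fun u hu => (hasDerivAt_skellamScoreDeriv
      ((half_pos hx).trans_le hu) k).hasDerivWithinAt)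
    (fun u hu => abs_skellamScoreDeriv₂_le_scoreModulus_div hx hu k)
    (Set.mem_Ici.2 (half_le_self hx.le)) (Set.mem_Ici.2 hz)
  exact lipschitz.trans_eq (by rw [Real.norm_eq_abs]; ring)

lemma exists_integral_scoreModulus_le :
    ∃ C, ∀ x, 0 < x → ∫ k, scoreModulus x k ∂skellamMeasure x ≤ C * skellamInfo x := by
  have small (x : ℝ) (hx : 0 < x) (hx32 : x < 32) :
      ∫ k, scoreModulus x k ∂skellamMeasure x ≤ (6 * 32 ^ 2 + 4 * 32 + 16) / x ^ 1 := by
    have affine (k : ℤ) :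
        scoreModulus x k = (2 * x + 4) + (4 + 16 / x ^ 2) * (k.natAbs : ℝ) := by
      rw [scoreModulus, if_pos hx32]
      ring
    simp only [affine]
    rw [integral_add (integrable_const _) ((PolyGrowth.natAbs.integrable hx).const_mul _),
      integral_const_mul, integral_const, probReal_univ, one_smul]
    calc 2 * x + 4 + (4 + 16 / x ^ 2) * ∫ k, (k.natAbs : ℝ) ∂skellamMeasure x
        ≤ 2 * x + 4 + (4 + 16 / x ^ 2) * x := by gcongr; exact integral_natAbs_le hx
      _ = (6 * x ^ 2 + 4 * x + 16) / x ^ 1 := by field_simp; ring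
      _ ≤ _ := by gcongr
  have large (x : ℝ) (hx : 32 ≤ x) :
      ∫ k, scoreModulus x k ∂skellamMeasure x ≤ 3040 * 2 ^ 35 / x ^ (1 + 1) := by
    rw [mul_div_assoc]
    refine (le_abs_self _).trans (abs_integral_le_of_abs_le_scoreEnvelope (by linarith)
      (by positivity) fun k => ?_)
    have hQ := one_le_scoreEnvelope (by linarith : 0 < x) k
    rw [scoreModulus, if_neg hx.not_gt, abs_of_nonneg (by positivity)]
    calc 2 ^ 35 * (scoreEnvelope x k ^ 2 / x ^ 2)
        = 2 ^ 35 / x ^ (1 + 1) * scoreEnvelope x k ^ 2 := by ring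
      _ ≤ _ := by
        gcongr
        norm_num
  obtain ⟨A, hA, bound⟩ := exists_forall_pos_le_div (by norm_num) (by norm_num) (by norm_num)
    small large
  obtain ⟨C, _, hC⟩ := exists_inv_le_mul_skellamInfo
  refine ⟨A * C, fun x hx => (bound x hx).trans ?_⟩
  rw [pow_one, div_eq_mul_one_div, mul_assoc]
  exact mul_le_mul_of_nonneg_left (hC x hx) hA

/-! ### The increments of the process -/

lemma norm_intChar (t : ℝ) (z : ℤ) : ‖intChar t z‖ = 1 := by
  rw [intChar]
  exact_mod_cast Complex.norm_exp_ofReal_mul_I (t * z)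

lemma intChar_sum {ι : Type*} (t : ℝ) (s : Finset ι) (f : ι → ℤ) :
    intChar t (∑ i ∈ s, f i) = ∏ i ∈ s, intChar t (f i) := by
  simp only [intChar]
  rw [← Complex.exp_sum, ← Finset.sum_mul, ← Finset.mul_sum, Int.cast_sum]

section

variable {Ω : Type*} [MeasurableSpace Ω] {P : Measure Ω} [IsProbabilityMeasure P]

omit [IsProbabilityMeasure P] in
lemma charFun_map_intCast {D : Ω → ℤ} (hD : Measurable D) (t : ℝ) :
    charFun (P.map fun ω => (D ω : ℝ)) t = ∫ ω, intChar t (D ω) ∂P := by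
  rw [charFun_apply_real, integral_map (by fun_prop) (by fun_prop)]
  simp only [intChar, Complex.ofReal_intCast]

lemma hasLaw_of_integral_intChar_eq {D : Ω → ℤ} (hD : Measurable D) {μ : Measure ℤ}
    [IsProbabilityMeasure μ] (h : ∀ t, ∫ ω, intChar t (D ω) ∂P = ∫ k, intChar t k ∂μ) :
    HasLaw D μ P := by
  refine ⟨hD.aemeasurable, Int.isClosedEmbedding_coe_real.measurableEmbedding.map_injective ?_⟩
  have := Measure.isProbabilityMeasure_map (μ := P) hD.aemeasurable
  have (ν : Measure ℤ) [IsProbabilityMeasure ν] :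
      IsProbabilityMeasure (ν.map (Int.cast : ℤ → ℝ)) :=
    Measure.isProbabilityMeasure_map (by fun_prop)
  refine Measure.ext_of_charFun (funext fun t => ?_)
  rw [Measure.map_map (by fun_prop) hD]
  exact (charFun_map_intCast hD t).trans ((h t).trans (charFun_map_intCast measurable_id t).symm)

lemma iIndepFun_of_integral_prod_intChar_eq {ι : Type*} [Fintype ι] {D : ι → Ω → ℤ}
    (hD : ∀ i, Measurable (D i))
    (h : ∀ t : ι → ℝ, ∫ ω, ∏ i, intChar (t i) (D i ω) ∂P = ∏ i, ∫ ω, intChar (t i) (D i ω) ∂P) :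
    iIndepFun D P := by
  have cast_indep : iIndepFun (fun i ω => (D i ω : ℝ)) P := by
    refine (iIndepFun_iff_charFun_pi fun i => by fun_prop).2 fun t => ?_
    simp only [charFun_map_intCast (hD _)]
    rw [← h, charFun_apply, integral_map (by fun_prop) (by fun_prop)]
    refine integral_congr_ae (ae_of_all _ fun ω => ?_)
    simp only [intChar, ← Complex.exp_sum, ← Finset.sum_mul, PiLp.inner_apply, Real.inner_apply]
    push_cast
    simp only [mul_comm]
  simpa only [Function.comp_def, Int.floor_intCast] using
    cast_indep.comp (fun _ => Int.floor) fun _ => Int.measurable_floor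

lemma integral_prodMk_of_indepFun {α β E : Type*} [MeasurableSpace α] [MeasurableSpace β]
    [NormedAddCommGroup E] [NormedSpace ℝ E] {X : Ω → α} {Y : Ω → β} (hX : Measurable X)
    (hY : Measurable Y) (h : IndepFun X Y P) {F : α × β → E} (hF : StronglyMeasurable F) {C : ℝ}
    (hFC : ∀ p, ‖F p‖ ≤ C) :
    ∫ ω, F (X ω, Y ω) ∂P = ∫ ω', ∫ ω, F (X ω, Y ω') ∂P ∂P := by
  have := Measure.isProbabilityMeasure_map (μ := P) hX.aemeasurable
  have := Measure.isProbabilityMeasure_map (μ := P) hY.aemeasurable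
  have inner (y : β) : ∫ x, F (x, y) ∂P.map X = ∫ ω, F (X ω, y) ∂P :=
    integral_map hX.aemeasurable (hF.comp_measurable measurable_prodMk_right).aestronglyMeasurable
  rw [← integral_map (φ := fun ω => (X ω, Y ω)) (hX.prodMk hY).aemeasurable
    hF.aestronglyMeasurable, h.map_prod_eq_prod_map_map hX.aemeasurable hY.aemeasurable,
    integral_prod_symm F (.of_bound hF.aestronglyMeasurable C (ae_of_all _ hFC)),
    integral_map hY.aemeasurable hF.integral_prod_left'.aestronglyMeasurable]
  simp only [inner]

end

section

variable {Ω : Type*} {N : ℝ≥0 → Ω → ℕ} {ε : ℕ → Ω → ℤ}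

lemma process_sub_process {u v : ℝ≥0} {ω : Ω} (h : N u ω ≤ N v ω) :
    process N ε v ω - process N ε u ω = ∑ i ∈ Finset.Ico (N u ω) (N v ω), ε i ω := by
  rw [process, process, Finset.sum_Ico_eq_sub _ h]

lemma measurable_process [MeasurableSpace Ω] (hN : ∀ t, Measurable (N t))
    (hε : ∀ i, Measurable (ε i)) (t : ℝ≥0) : Measurable (process N ε t) := by
  have hsum : Measurable fun p : Ω × ℕ => ∑ i ∈ Finset.range p.2, ε i p.1 :=
    measurable_from_prod_countable_left fun n =>
      Finset.measurable_fun_sum (Finset.range n) fun i _ => hε i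
  exact hsum.comp (measurable_id.prodMk (hN t))

end

namespace IsPoissonProcess

variable {Ω : Type*} [MeasurableSpace Ω] {P : Measure Ω} {N : ℝ≥0 → Ω → ℕ} {ϑ : ℝ}
  (h : IsPoissonProcess N ϑ P) (hϑ : 0 ≤ ϑ)
include h hϑ

lemma integral_pow_sub {u v : ℝ≥0} (huv : u ≤ v) (c : ℂ) :
    ∫ ω, c ^ (N v ω - N u ω) ∂P = Complex.exp (ϑ * (v - u) * (c - 1)) := by
  have mean_nonneg : 0 ≤ ϑ * ((v : ℝ) - u) := mul_nonneg hϑ (sub_nonneg.2 huv)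
  have toNat_law := (h.increments u v huv).integral_comp (f := fun z : ℤ => c ^ z.toNat)
    (by fun_prop)
  rw [integral_map (by fun_prop) (by fun_prop)] at toNat_law
  simpa [Function.comp_def, integral_pow_poissonMeasure, mean_nonneg] using toNat_law

lemma integral_prod_pow_sub {t : ℕ → ℝ≥0} (ht : Monotone t) (s : Finset ℕ) (c : s → ℂ) :
    ∫ ω, ∏ j : s, c j ^ (N (t (j + 1)) ω - N (t j) ω) ∂P =
      ∏ j : s, Complex.exp (ϑ * (t (j + 1) - t j) * (c j - 1)) := by
  have measurable_sub (j : s) : Measurable fun ω => (N (t (j + 1)) ω : ℤ) - N (t j) ω :=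
    (measurable_from_top.comp (h.measurable _)).sub (measurable_from_top.comp (h.measurable _))
  have factor := iIndepFun.integral_fun_prod_comp
    ((h.indep_increments.nat ht).precomp (Subtype.val_injective (p := (· ∈ s))))
    (f := fun j z => c j ^ z.toNat) (fun j => (measurable_sub j).aemeasurable)
    (fun j => by fun_prop)
  simpa only [Function.comp_def, Int.toNat_sub,
    h.integral_pow_sub hϑ (ht (Nat.le_succ _))] using factor

end IsPoissonProcess

namespace IsModel

variable {Ω : Type*} [MeasurableSpace Ω] {P : Measure Ω} {N : ℝ≥0 → Ω → ℕ} {ε : ℕ → Ω → ℤ}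
  {ϑ : ℝ} (h : IsModel N ε ϑ P)
include h

lemma measurable_process (t : ℝ≥0) : Measurable (process N ε t) :=
  TimeScales.measurable_process h.poisson.measurable h.jump_measurable t

lemma integral_intChar_jump [IsProbabilityMeasure P] (t : ℝ) (i : ℕ) :
    ∫ ω, intChar t (ε i ω) ∂P = Real.cos t := by
  have := Measure.isProbabilityMeasure_map (μ := P) (h.jump_measurable i).aemeasurable
  have mass (z : ℤ) : P.map (ε i) {z} = P {ω | ε i ω = z} :=
    Measure.map_apply (h.jump_measurable i) (measurableSet_singleton z)
  have mass_one : P.map (ε i) {1} = 1 / 2 := (mass 1).trans (h.jump_pos i)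
  have mass_neg_one : P.map (ε i) {-1} = 1 / 2 := (mass (-1)).trans (h.jump_neg i)
  have mass_pair : P.map (ε i) ({1, -1} : Finset ℤ) = 1 := by
    rw [Finset.coe_pair, Set.insert_eq, measure_union (by simp) (measurableSet_singleton _),
      mass_one, mass_neg_one, ENNReal.add_halves]
  have concentrated : ∀ᵐ z ∂P.map (ε i), z ∈ (({1, -1} : Finset ℤ) : Set ℤ) :=
    (prob_compl_eq_zero_iff (Finset.measurableSet _)).2 mass_pair
  have integrableOn_intChar : IntegrableOn (intChar t) ({1, -1} : Finset ℤ) (P.map (ε i)) :=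
    .of_bound (measure_lt_top _ _) (by fun_prop) 1 (ae_of_all _ fun z => (norm_intChar t z).le)
  rw [← integral_map (h.jump_measurable i).aemeasurable (f := intChar t) (by fun_prop),
    ← Measure.restrict_eq_self_of_ae_mem concentrated,
    setIntegral_finset _ integrableOn_intChar, Finset.sum_pair (by decide)]
  simp only [measureReal_def, mass_one, mass_neg_one]
  simp [intChar, Complex.cos]
  ring

lemma integral_prod_intChar_sum_jump [IsProbabilityMeasure P] {κ : Type*} [Fintype κ]
    {S : κ → Finset ℕ} (hS : Pairwise (Function.onFun Disjoint S)) (u : κ → ℝ) :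
    ∫ ω, ∏ j, intChar (u j) (∑ i ∈ S j, ε i ω) ∂P =
      ∏ j, (Real.cos (u j) : ℂ) ^ (S j).card := by
  have index_injective : Function.Injective fun p : Σ j, S j => (p.2 : ℕ) := by
    rintro ⟨j, i, hi⟩ ⟨j', i', hi'⟩ (rfl : i = i')
    obtain rfl : j = j' := by
      by_contra hne
      exact Finset.disjoint_left.1 (hS hne) hi hi'
    rfl
  have factor := iIndepFun.integral_fun_prod_comp (h.jump_indep.precomp index_injective)
    (f := fun p => intChar (u p.1)) (fun p => (h.jump_measurable _).aemeasurable)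
    (fun p => by fun_prop)
  have sum_subtype (j : κ) (ω : Ω) : ∑ i : S j, ε i ω = ∑ i ∈ S j, ε i ω :=
    Finset.sum_coe_sort (S j) fun i => ε i ω
  simpa only [h.integral_intChar_jump, Fintype.prod_sigma, Finset.prod_const, Finset.card_univ,
    Fintype.card_coe, ← intChar_sum, sum_subtype] using factor

variable [IsProbabilityMeasure P] (hϑ : 0 ≤ ϑ)
include hϑ

-- By independence the Poisson process can be frozen while the jumps are integrated out.
lemma integral_prod_intChar_increments {t : ℕ → ℝ≥0} (ht : Monotone t) (s : Finset ℕ)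
    (u : s → ℝ) :
    ∫ ω, ∏ j : s, intChar (u j) (process N ε (t (j + 1)) ω - process N ε (t j) ω) ∂P =
      ∏ j : s, Complex.exp (ϑ * (t (j + 1) - t j) * (Real.cos (u j) - 1)) := by
  let counts (ω : Ω) (j : s) : ℕ × ℕ := (N (t j) ω, N (t (j + 1)) ω)
  let F (p : (ℕ → ℤ) × (s → ℕ × ℕ)) : ℂ :=
    ∏ j : s, intChar (u j) (∑ i ∈ Finset.Ico (p.2 j).1 (p.2 j).2, p.1 i)
  have measurable_F : Measurable F := measurable_from_prod_countable_left fun m =>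
    Finset.measurable_fun_prod Finset.univ fun j _ =>
      (Measurable.of_discrete (f := intChar (u j))).comp
        (Finset.measurable_fun_sum (Finset.Ico (m j).1 (m j).2) fun i _ => measurable_pi_apply i)
  have norm_F (p) : ‖F p‖ ≤ 1 := by
    simp only [F, norm_prod, norm_intChar, Finset.prod_const_one, le_refl]
  have measurable_counts : Measurable counts := measurable_pi_lambda _ fun j =>
    (h.poisson.measurable _).prodMk (h.poisson.measurable _)
  have indep_counts : IndepFun (fun ω i => ε i ω) counts P := by
    have measurable_select : Measurable fun (f : ℝ≥0 → ℕ) (j : s) => (f (t j), f (t (j + 1))) := by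
      fun_prop
    exact h.indep.comp measurable_id measurable_select
  have monotone_counts : ∀ᵐ ω ∂P, Monotone fun j => N (t j) ω := by
    filter_upwards [h.poisson.paths] with ω hω using hω.1.comp ht
  calc _ = ∫ ω, F (fun i => ε i ω, counts ω) ∂P := by
        refine integral_congr_ae ?_
        filter_upwards [monotone_counts] with ω hω
        simp only [F, counts, process_sub_process (hω (Nat.le_succ _))]
    _ = ∫ ω', ∫ ω, F (fun i => ε i ω, counts ω') ∂P ∂P :=
        integral_prodMk_of_indepFun (measurable_pi_lambda _ h.jump_measurable) measurable_counts
          indep_counts measurable_F.stronglyMeasurable norm_F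
    _ = ∫ ω', ∏ j : s, (Real.cos (u j) : ℂ) ^ (N (t (j + 1)) ω' - N (t j) ω') ∂P := by
        refine integral_congr_ae ?_
        filter_upwards [monotone_counts] with ω' hω'
        have disjoint : Pairwise (Function.onFun Disjoint fun j : s =>
            Finset.Ico (N (t j) ω') (N (t (j + 1)) ω')) := fun i j hij =>
          Finset.disjoint_coe.1 <| by
            simpa using hω'.pairwise_disjoint_on_Ico_succ (Subtype.coe_injective.ne hij)
        simpa only [Nat.card_Ico] using h.integral_prod_intChar_sum_jump disjoint u
    _ = _ := h.poisson.integral_prod_pow_sub hϑ ht s _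

lemma hasLaw_increment {u v : ℝ≥0} (huv : u ≤ v) :
    HasLaw (fun ω => process N ε v ω - process N ε u ω) (skellamMeasure (ϑ * (v - u))) P := by
  have monotone_times : Monotone fun j : ℕ => if j = 0 then u else v :=
    monotone_nat_of_le_succ fun j => by rcases j with _ | j <;> simp [huv]
  refine hasLaw_of_integral_intChar_eq ((h.measurable_process v).sub (h.measurable_process u))
    fun z => ?_
  rw [integral_intChar_skellamMeasure (mul_nonneg hϑ (sub_nonneg.2 (NNReal.coe_le_coe.2 huv)))]
  simpa using h.integral_prod_intChar_increments hϑ monotone_times {0} fun _ => z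

lemma iIndepFun_increments {t : ℕ → ℝ≥0} (ht : Monotone t) :
    iIndepFun (fun j ω => process N ε (t (j + 1)) ω - process N ε (t j) ω) P := by
  refine iIndepFun_iff_finset.2 fun s => iIndepFun_of_integral_prod_intChar_eq
    (fun j => (h.measurable_process _).sub (h.measurable_process _)) fun u => ?_
  have intChar_increment (j : ℕ) (z : ℝ) :
      ∫ ω, intChar z (process N ε (t (j + 1)) ω - process N ε (t j) ω) ∂P =
        Complex.exp (ϑ * (t (j + 1) - t j) * (Real.cos z - 1)) := by
    have le_succ : t j ≤ t (j + 1) := ht (Nat.le_succ j)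
    have law := (h.hasLaw_increment hϑ le_succ).integral_comp (f := intChar z) (by fun_prop)
    rw [integral_intChar_skellamMeasure
      (mul_nonneg hϑ (sub_nonneg.2 (NNReal.coe_le_coe.2 le_succ)))] at law
    simpa using law
  simpa only [Finset.restrict_def, intChar_increment] using
    h.integral_prod_intChar_increments hϑ ht s u

lemma hasLaw_process (v : ℝ≥0) : HasLaw (process N ε v) (skellamMeasure (ϑ * v)) P := by
  have law := h.hasLaw_increment hϑ (zero_le (a := v))
  simp only [NNReal.coe_zero, sub_zero] at law
  refine law.congr ?_
  filter_upwards [h.poisson.zero] with ω hω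
  simp [process, hω]

end IsModel

/-! ### The likelihood -/

section

variable {Ω : Type*} [MeasurableSpace Ω] {P : ℝ → Measure Ω} [∀ ϑ, IsProbabilityMeasure (P ϑ)]
  {N : ℝ≥0 → Ω → ℕ} {ε : ℕ → Ω → ℤ} (hmodel : ∀ ϑ : ℝ, 0 < ϑ → IsModel N ε ϑ (P ϑ)) {Δ : ℝ≥0}
  {ϑ : ℝ} (hϑ : 0 < ϑ)
include hmodel hϑ

lemma information_eq (T Δ : ℝ≥0) :
    information P (process N ε) T Δ ϑ = T * Δ * skellamInfo (ϑ * Δ) := by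
  rw [information, skellamInfo, ← ((hmodel ϑ hϑ).hasLaw_process hϑ.le Δ).integral_comp
    (f := fun k => skellamScore (ϑ * Δ) k ^ 2) (by fun_prop)]
  simp only [Function.comp_def, skellamScore, besselRatio, besselQuot, Nat.cast_natAbs,
    Int.cast_abs, div_eq_inv_mul |((process N ε Δ _ : ℤ) : ℝ)|]

variable (hΔ : 0 < Δ)
include hΔ

lemma likelihood_eq (k : ℤ) : likelihood P (process N ε) Δ ϑ k = skellam (ϑ * Δ) k := by
  rw [likelihood, ← skellamMeasure_real_singleton (by positivity)]
  exact ((hmodel ϑ hϑ).hasLaw_process hϑ.le Δ).measureReal_eq (p := fun z => z = k)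
    (measurableSet_singleton k)

lemma score_eq (k : ℤ) :
    score (likelihood P (process N ε) Δ) ϑ k = Δ * skellamScore (ϑ * Δ) k := by
  have log_likelihood : (fun θ => Real.log (likelihood P (process N ε) Δ θ k)) =ᶠ[𝓝 ϑ]
      fun θ => Real.log (skellam (θ * Δ) k) := by
    filter_upwards [lt_mem_nhds hϑ] with θ hθ
    rw [likelihood_eq hmodel hθ hΔ]
  have scale : HasDerivAt (fun θ : ℝ => θ * Δ) (1 * Δ) ϑ := (hasDerivAt_id' ϑ).mul_const _
  have log_skellam : HasDerivAt (fun θ : ℝ => Real.log (skellam (θ * Δ) k))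
      (skellamScore (ϑ * Δ) k * (1 * Δ)) ϑ :=
    (hasDerivAt_log_skellam (by positivity) k).comp ϑ scale
  rw [score, log_likelihood.deriv_eq, log_skellam.deriv, one_mul, mul_comm]

lemma hasDerivAt_score (k : ℤ) :
    HasDerivAt (fun θ => score (likelihood P (process N ε) Δ) θ k)
      (Δ ^ 2 * skellamScoreDeriv (ϑ * Δ) k) ϑ := by
  have scale : HasDerivAt (fun θ : ℝ => θ * Δ) (1 * Δ) ϑ := (hasDerivAt_id' ϑ).mul_const _
  have scaled_score : HasDerivAt (fun θ : ℝ => (Δ : ℝ) * skellamScore (θ * Δ) k)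
      (Δ * (skellamScoreDeriv (ϑ * Δ) k * (1 * Δ))) ϑ :=
    ((hasDerivAt_skellamScore (by positivity) k).comp ϑ scale).const_mul _
  refine (scaled_score.congr_of_eventuallyEq ?_).congr_deriv (by ring)
  filter_upwards [lt_mem_nhds hϑ] with θ hθ using score_eq hmodel hθ hΔ k

lemma scoreDeriv_eq (k : ℤ) :
    scoreDeriv (likelihood P (process N ε) Δ) ϑ k = Δ ^ 2 * skellamScoreDeriv (ϑ * Δ) k :=
  (hasDerivAt_score hmodel hϑ hΔ k).deriv

lemma fisherInformation_eq (T : ℝ≥0) :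
    fisherInformation P (process N ε) T Δ ϑ = numObs T Δ * Δ ^ 2 * skellamInfo (ϑ * Δ) := by
  rw [fisherInformation, skellamInfo, ← ((hmodel ϑ hϑ).hasLaw_process hϑ.le Δ).integral_comp
    (f := fun k => skellamScore (ϑ * Δ) k ^ 2) (by fun_prop)]
  simp only [score_eq hmodel hϑ hΔ, mul_pow, integral_const_mul, Function.comp_def, mul_assoc]

end

/-! ### Row sums of triangular arrays -/

section RowSums

variable {Ω : Type*} [MeasurableSpace Ω] {P : Measure Ω}

lemma norm_exp_mul_I_sub_taylor_le (y : ℝ) :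
    ‖Complex.exp (y * Complex.I) - (1 + y * Complex.I - (y ^ 2 / 2 : ℝ))‖ ≤ 4 * |y| ^ 3 := by
  rcases le_or_gt |y| 1 with hy | hy
  · have hnorm : ‖(y * Complex.I : ℂ)‖ = |y| := by simp
    have htaylor := Complex.norm_exp_sub_sum_le_norm_mul_exp (y * Complex.I) 3
    have hsum : ∑ m ∈ Finset.range 3, (y * Complex.I : ℂ) ^ m / m.factorial =
        1 + y * Complex.I - (y ^ 2 / 2 : ℝ) := by
      simp [Finset.sum_range_succ, mul_pow]
      ring
    rw [hnorm, hsum] at htaylor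
    calc _ ≤ |y| ^ 3 * Real.exp |y| := htaylor
      _ ≤ |y| ^ 3 * 4 := by
        gcongr
        linarith [Real.exp_le_exp.2 hy, Real.exp_one_lt_d9]
      _ = 4 * |y| ^ 3 := mul_comm _ _
  · have hlin : |y| ≤ |y| ^ 3 := le_self_pow₀ hy.le (by norm_num)
    have hquad : |y| ^ 2 ≤ |y| ^ 3 := pow_le_pow_right₀ hy.le (by norm_num)
    calc _ ≤ ‖Complex.exp (y * Complex.I)‖ + (‖(1 : ℂ)‖ + ‖(y * Complex.I : ℂ)‖ +
          ‖((y ^ 2 / 2 : ℝ) : ℂ)‖) :=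
        (norm_sub_le _ _).trans (add_le_add_right
          ((norm_sub_le _ _).trans (add_le_add_left (norm_add_le _ _) _)) _)
      _ = 2 + |y| + |y| ^ 2 / 2 := by
        rw [Complex.norm_exp_ofReal_mul_I]
        simp
        ring
      _ ≤ 4 * |y| ^ 3 := by linarith

lemma norm_charFun_sub_taylor_le [IsProbabilityMeasure P] {X : Ω → ℝ} (hX : MemLp X 3 P)
    (hmean : P[X] = 0) (t : ℝ) :
    ‖charFun (P.map X) t - (1 - t ^ 2 / 2 * ∫ ω, X ω ^ 2 ∂P : ℝ)‖ ≤
      4 * |t| ^ 3 * ∫ ω, |X ω| ^ 3 ∂P := by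
  have hcube : Integrable (fun ω => |X ω| ^ 3) P := hX.integrable_norm_pow (by norm_num)
  have hsq : Integrable (fun ω => X ω ^ 2) P := (hX.mono_exponent (by norm_num)).integrable_sq
  have hintegrable : Integrable X P := hX.integrable (by norm_num)
  have hlin : Integrable (fun ω => 1 + ((t * X ω : ℝ) : ℂ) * Complex.I) P :=
    (integrable_const _).add ((hintegrable.const_mul t).ofReal.mul_const _)
  have hquad : Integrable (fun ω => (((t * X ω) ^ 2 / 2 : ℝ) : ℂ)) P := by
    simp only [mul_pow]
    exact ((hsq.const_mul (t ^ 2)).div_const 2).ofReal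
  have hpoly : Integrable (fun ω => 1 + ((t * X ω : ℝ) : ℂ) * Complex.I -
      ((t * X ω) ^ 2 / 2 : ℝ)) P := hlin.sub hquad
  have hexp : Integrable (fun ω => Complex.exp ((t * X ω : ℝ) * Complex.I)) P :=
    .of_bound (by have := hintegrable.aemeasurable; fun_prop) 1
      (ae_of_all _ fun ω => (Complex.norm_exp_ofReal_mul_I _).le)
  have hchar : charFun (P.map X) t = ∫ ω, Complex.exp ((t * X ω : ℝ) * Complex.I) ∂P := by
    rw [charFun_apply_real, integral_map hintegrable.aemeasurable (by fun_prop)]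
    simp
  have htaylor : ∫ ω, (1 + ((t * X ω : ℝ) : ℂ) * Complex.I - ((t * X ω) ^ 2 / 2 : ℝ)) ∂P =
      (1 - t ^ 2 / 2 * ∫ ω, X ω ^ 2 ∂P : ℝ) := by
    rw [integral_sub hlin hquad, integral_add (integrable_const _)
      ((hintegrable.const_mul t).ofReal.mul_const _), integral_mul_const, integral_complex_ofReal,
      integral_complex_ofReal, integral_const_mul, hmean, integral_div]
    simp only [mul_pow, integral_const_mul]
    simp
    ring
  rw [hchar, ← htaylor, ← integral_sub hexp hpoly, ← integral_const_mul]
  refine norm_integral_le_of_norm_le (hcube.const_mul _) (ae_of_all _ fun ω => ?_)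
  exact (norm_exp_mul_I_sub_taylor_le (t * X ω)).trans_eq (by rw [abs_mul]; ring)

lemma sq_integral_abs_pow_three_le [IsFiniteMeasure P] {X : Ω → ℝ} (hX : MemLp X 4 P) :
    (∫ ω, |X ω| ^ 3 ∂P) ^ 2 ≤ (∫ ω, X ω ^ 2 ∂P) * ∫ ω, X ω ^ 4 ∂P := by
  have hcube : Integrable (fun ω => |X ω| ^ 3) P :=
    (hX.mono_exponent (by norm_num : (3 : ℝ≥0∞) ≤ 4)).integrable_norm_pow (by norm_num)
  have hsq : Integrable (fun ω => X ω ^ 2) P := (hX.mono_exponent (by norm_num)).integrable_sq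
  have hfour : Integrable (fun ω => X ω ^ 4) P := by
    simpa [Even.pow_abs (by decide : Even 4)] using hX.integrable_norm_pow (p := 4) (by norm_num)
  have hnonneg (s : ℝ) : 0 ≤ (∫ ω, X ω ^ 2 ∂P) * (s * s) + 2 * (∫ ω, |X ω| ^ 3 ∂P) * s +
      ∫ ω, X ω ^ 4 ∂P := by
    calc 0 ≤ ∫ ω, (s * |X ω| + |X ω| ^ 2) ^ 2 ∂P := integral_nonneg fun ω => sq_nonneg _
      _ = ∫ ω, (s * s * X ω ^ 2 + 2 * s * |X ω| ^ 3 + X ω ^ 4) ∂P := by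
        congr! 2 with ω
        rw [← sq_abs (X ω), show X ω ^ 4 = |X ω| ^ 4 from (Even.pow_abs (by decide) _).symm]
        ring
      _ = _ := by
        rw [integral_add ((hsq.const_mul _).fun_add (hcube.const_mul _)) hfour,
          integral_add (hsq.const_mul _) (hcube.const_mul _), integral_const_mul,
          integral_const_mul]
        ring
  have hdiscrim := discrim_le_zero hnonneg
  rw [discrim] at hdiscrim
  linarith

lemma tendsto_one_add_pow_exp {ι : Type*} {l : Filter ι} {g : ι → ℂ} {n : ι → ℕ} {t : ℂ}
    (hn : Tendsto n l atTop) (hg : Tendsto (fun T => n T * g T) l (𝓝 t)) :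
    Tendsto (fun T => (1 + g T) ^ n T) l (𝓝 (Complex.exp t)) := by
  have hninv : Tendsto (fun T => ((n T : ℂ))⁻¹) l (𝓝 0) :=
    (tendsto_inv_atTop_nhds_zero_nat (𝕜 := ℂ)).comp hn
  have hn0 : ∀ᶠ T in l, (n T : ℂ) ≠ 0 :=
    (hn.eventually_ne_atTop 0).mono fun T hT => Nat.cast_ne_zero.2 hT
  have hg0 : Tendsto g l (𝓝 0) := by
    refine ((zero_mul t) ▸ hninv.mul hg).congr' ?_
    filter_upwards [hn0] with T hT
    rw [inv_mul_cancel_left₀ hT]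
  have hlog : Tendsto (fun T => n T * Complex.log (1 + g T)) l (𝓝 t) := by
    have herr : (fun T => n T * (Complex.log (1 + g T) - g T)) =O[l]
        fun T => (n T * g T) * g T := by
      simpa [sq, mul_assoc] using (Asymptotics.isBigO_refl (fun T => (n T : ℂ)) l).mul
        (Complex.log_sub_self_isBigO.comp_tendsto hg0)
    have herr0 := herr.trans_tendsto (mul_zero t ▸ hg.mul hg0)
    simpa [mul_sub] using herr0.add hg
  refine ((Complex.continuous_exp.tendsto t).comp hlog).congr' ?_
  filter_upwards [hg0.eventually_ne (show (0 : ℂ) ≠ -1 by simp)] with T hT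
  rw [Function.comp_apply, Complex.exp_nat_mul, Complex.exp_log]
  rwa [ne_eq, add_comm, add_eq_zero_iff_eq_neg]

lemma charFun_map_sum_range {X : ℕ → Ω → ℝ} (hindep : iIndepFun X P)
    (hident : ∀ i, IdentDistrib (X i) (X 0) P P) (n : ℕ) (t : ℝ) :
    charFun (P.map fun ω => ∑ i ∈ Finset.range n, X i ω) t = charFun (P.map (X 0)) t ^ n := by
  rw [(hindep.restrict _).charFun_map_fun_finsetSum_eq_prod
    fun i _ => (hident i).aemeasurable_fst]
  simp [fun i => (hident i).map_eq]

section CentralLimit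

variable [IsProbabilityMeasure P] {ι : Type*} {l : Filter ι} {X : ι → ℕ → Ω → ℝ} {n : ι → ℕ}

lemma tendsto_mul_integral_abs_pow_three (hX : ∀ᶠ T in l, MemLp (X T 0) 4 P)
    (hvar : ∀ᶠ T in l, n T * ∫ ω, X T 0 ω ^ 2 ∂P = 1)
    (hlyapunov : Tendsto (fun T => n T * ∫ ω, X T 0 ω ^ 4 ∂P) l (𝓝 0)) :
    Tendsto (fun T => n T * ∫ ω, |X T 0 ω| ^ 3 ∂P) l (𝓝 0) := by
  have hsqrt : Tendsto (fun T => √(n T * ∫ ω, X T 0 ω ^ 4 ∂P)) l (𝓝 0) := by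
    simpa only [Real.sqrt_zero, Function.comp_def] using
      (Real.continuous_sqrt.tendsto 0).comp hlyapunov
  refine squeeze_zero' (Eventually.of_forall fun T => by positivity) ?_ hsqrt
  filter_upwards [hX, hvar] with T hXT hvarT
  refine Real.le_sqrt_of_sq_le ?_
  calc (n T * ∫ ω, |X T 0 ω| ^ 3 ∂P) ^ 2 = (n T : ℝ) ^ 2 * (∫ ω, |X T 0 ω| ^ 3 ∂P) ^ 2 := by ring
    _ ≤ (n T : ℝ) ^ 2 * ((∫ ω, X T 0 ω ^ 2 ∂P) * ∫ ω, X T 0 ω ^ 4 ∂P) := by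
      gcongr
      exact sq_integral_abs_pow_three_le hXT
    _ = (n T * ∫ ω, X T 0 ω ^ 2 ∂P) * (n T * ∫ ω, X T 0 ω ^ 4 ∂P) := by ring
    _ = n T * ∫ ω, X T 0 ω ^ 4 ∂P := by rw [hvarT, one_mul]

lemma tendsto_charFun_pow_of_lyapunov (hX : ∀ᶠ T in l, MemLp (X T 0) 4 P)
    (hmean : ∀ᶠ T in l, P[X T 0] = 0) (hvar : ∀ᶠ T in l, n T * ∫ ω, X T 0 ω ^ 2 ∂P = 1)
    (hn : Tendsto n l atTop)
    (hlyapunov : Tendsto (fun T => n T * ∫ ω, X T 0 ω ^ 4 ∂P) l (𝓝 0)) (t : ℝ) :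
    Tendsto (fun T => charFun (P.map (X T 0)) t ^ n T) l (𝓝 (Complex.exp (-(t ^ 2) / 2))) := by
  suffices Tendsto (fun T => n T * (charFun (P.map (X T 0)) t - 1)) l (𝓝 (-(t ^ 2) / 2)) by
    simpa using tendsto_one_add_pow_exp hn this
  have hbound : Tendsto (fun T => 4 * |t| ^ 3 * (n T * ∫ ω, |X T 0 ω| ^ 3 ∂P)) l (𝓝 0) := by
    simpa using (tendsto_mul_integral_abs_pow_three hX hvar hlyapunov).const_mul (4 * |t| ^ 3)
  refine tendsto_iff_norm_sub_tendsto_zero.2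
    (squeeze_zero' (Eventually.of_forall fun _ => norm_nonneg _) ?_ hbound)
  filter_upwards [hX, hmean, hvar] with T hXT hmeanT hvarT
  have hvarC : (n T : ℂ) * (∫ ω, X T 0 ω ^ 2 ∂P : ℝ) = 1 := by exact_mod_cast hvarT
  calc ‖n T * (charFun (P.map (X T 0)) t - 1) - -(t : ℂ) ^ 2 / 2‖
      = ‖n T * (charFun (P.map (X T 0)) t - (1 - t ^ 2 / 2 * ∫ ω, X T 0 ω ^ 2 ∂P : ℝ))‖ := by
        congr 1
        push_cast
        linear_combination (t : ℂ) ^ 2 / 2 * (-hvarC)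
    _ ≤ n T * (4 * |t| ^ 3 * ∫ ω, |X T 0 ω| ^ 3 ∂P) := by
        rw [norm_mul, Complex.norm_natCast]
        gcongr
        exact norm_charFun_sub_taylor_le (hXT.mono_exponent (by norm_num)) hmeanT t
    _ = 4 * |t| ^ 3 * (n T * ∫ ω, |X T 0 ω| ^ 3 ∂P) := by ring

theorem tendstoInDistribution_sum_of_lyapunov [l.IsCountablyGenerated]
    (hindep : ∀ T, iIndepFun (X T) P) (hident : ∀ T i, IdentDistrib (X T i) (X T 0) P P)
    (hX : ∀ᶠ T in l, MemLp (X T 0) 4 P) (hmean : ∀ᶠ T in l, P[X T 0] = 0)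
    (hvar : ∀ᶠ T in l, n T * ∫ ω, X T 0 ω ^ 2 ∂P = 1) (hn : Tendsto n l atTop)
    (hlyapunov : Tendsto (fun T => n T * ∫ ω, X T 0 ω ^ 4 ∂P) l (𝓝 0)) :
    TendstoInDistribution (fun T ω => ∑ i ∈ Finset.range (n T), X T i ω) l (id : ℝ → ℝ)
      (fun _ => P) (gaussianReal 0 1) := by
  refine ⟨fun T => Finset.aemeasurable_fun_sum _ fun i _ => (hident T i).aemeasurable_fst,
    aemeasurable_id, tendsto_of_seq_tendsto fun u hu => ?_⟩
  refine ProbabilityMeasure.tendsto_iff_tendsto_charFun.2 fun t => ?_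
  have hchar := (tendsto_charFun_pow_of_lyapunov hX hmean hvar hn hlyapunov t).comp hu
  have hgauss : charFun ((gaussianReal 0 1).map id) t = Complex.exp (-(t ^ 2) / 2) := by
    rw [Measure.map_id, charFun_gaussianReal]
    push_cast
    ring_nf
  exact (hgauss ▸ hchar).congr fun k => (charFun_map_sum_range (hindep _) (hident _) _ t).symm

end CentralLimit

lemma measureReal_ge_sum_range_le {X : ℕ → Ω → ℝ} (hident : ∀ i, IdentDistrib (X i) (X 0) P P)
    (hintegrable : Integrable (X 0) P) (hnonneg : ∀ i ω, 0 ≤ X i ω) (n : ℕ) {c : ℝ} (hc : 0 < c) :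
    P.real {ω | c ≤ ∑ i ∈ Finset.range n, X i ω} ≤ n * P[X 0] / c := by
  have hintegrable' (i : ℕ) : Integrable (X i) P := (hident i).integrable_iff.2 hintegrable
  have hmarkov := mul_meas_ge_le_integral_of_nonneg
    (ae_of_all P fun ω => Finset.sum_nonneg fun i _ => hnonneg i ω)
    (integrable_finsetSum (Finset.range n) fun i _ => hintegrable' i) c
  rw [integral_finsetSum _ fun i _ => hintegrable' i] at hmarkov
  simp only [fun i => (hident i).integral_eq, Finset.sum_const, Finset.card_range,
    nsmul_eq_mul] at hmarkov
  rwa [le_div_iff₀ hc, mul_comm]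

lemma measureReal_ge_abs_sum_range_sub_le [IsProbabilityMeasure P] {X : ℕ → Ω → ℝ}
    (hindep : iIndepFun X P) (hident : ∀ i, IdentDistrib (X i) (X 0) P P) (hX : MemLp (X 0) 2 P)
    (n : ℕ) {c : ℝ} (hc : 0 < c) :
    P.real {ω | c ≤ |∑ i ∈ Finset.range n, X i ω - n * P[X 0]|} ≤
      n * (∫ ω, X 0 ω ^ 2 ∂P) / c ^ 2 := by
  have hmem (i : ℕ) : MemLp (X i) 2 P := (hident i).memLp_iff.2 hX
  have hvar : Var[fun ω => ∑ i ∈ Finset.range n, X i ω; P] ≤ n * ∫ ω, X 0 ω ^ 2 ∂P := by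
    rw [← Finset.sum_fn, IndepFun.variance_sum (fun i _ => hmem i)
      fun i _ j _ hij => hindep.indepFun hij]
    simp only [fun i => (hident i).variance_eq, Finset.sum_const, Finset.card_range, nsmul_eq_mul]
    gcongr
    exact variance_le_expectation_sq hX.aestronglyMeasurable
  have hchebyshev := meas_ge_le_variance_div_sq
    (memLp_finsetSum (Finset.range n) fun i _ => hmem i) hc
  rw [integral_finsetSum _ fun i _ => (hmem i).integrable (by norm_num)] at hchebyshev
  simp only [fun i => (hident i).integral_eq, Finset.sum_const, Finset.card_range,
    nsmul_eq_mul] at hchebyshev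
  calc _ ≤ Var[fun ω => ∑ i ∈ Finset.range n, X i ω; P] / c ^ 2 :=
        ENNReal.toReal_le_of_le_ofReal (div_nonneg (variance_nonneg _ _) (sq_nonneg c)) hchebyshev
    _ ≤ n * (∫ ω, X 0 ω ^ 2 ∂P) / c ^ 2 := by gcongr

end RowSums

/-! ### One Newton step from a preliminary estimator -/

lemma abs_newton_error_le {s x y G S B L δ K : ℝ} (hs : 0 < s) (hδ : δ ≤ 1 / 4)
    (hS : |S| ≤ K * s) (hx : s * |x - y| ≤ K) (hL : |L + s ^ 2| ≤ δ * s ^ 2)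
    (hB : |B - L| ≤ δ * s ^ 2) (hG : |G - S - L * (x - y)| ≤ δ * s ^ 2 * |x - y|) :
    |s * (x - G / B - y) - S / s| ≤ 8 * K * δ := by
  have hB_add : |B + s ^ 2| ≤ 2 * δ * s ^ 2 := by
    rw [show B + s ^ 2 = (B - L) + (L + s ^ 2) by ring]
    exact (abs_add_le _ _).trans (by linarith)
  have hB_ge : s ^ 2 / 2 ≤ |B| := by
    rw [abs_le] at hB_add
    rw [le_abs']
    left
    nlinarith [sq_nonneg s]
  have hB_ne : B ≠ 0 := abs_pos.1 (hB_ge.trans_lt' (by positivity))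
  have hK : 0 ≤ K := hx.trans' (by positivity)
  have hδ_nonneg : 0 ≤ δ := nonneg_of_mul_nonneg_left ((abs_nonneg _).trans hL) (by positivity)
  have herror : s * (x - G / B - y) - S / s =
      (s ^ 2 * (x - y) * (B - L) - s ^ 2 * (G - S - L * (x - y)) - S * (B + s ^ 2)) / (s * B) := by
    field_simp
    ring
  rw [herror, abs_div, abs_mul s, abs_of_pos hs, div_le_iff₀ (by positivity)]
  calc |s ^ 2 * (x - y) * (B - L) - s ^ 2 * (G - S - L * (x - y)) - S * (B + s ^ 2)|
      ≤ |s ^ 2 * (x - y) * (B - L)| + |s ^ 2 * (G - S - L * (x - y))| + |S * (B + s ^ 2)| :=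
        (abs_sub _ _).trans (add_le_add_left (abs_sub _ _) _)
    _ = s * (s * |x - y|) * |B - L| + s ^ 2 * |G - S - L * (x - y)| + |S| * |B + s ^ 2| := by
        simp only [abs_mul, abs_of_pos (pow_pos hs 2)]
        ring
    _ ≤ s * (s * |x - y|) * (δ * s ^ 2) + s ^ 2 * (δ * s ^ 2 * |x - y|) +
          K * s * (2 * δ * s ^ 2) := by gcongr
    _ = 2 * δ * s ^ 3 * (s * |x - y|) + 2 * δ * s ^ 3 * K := by ring
    _ ≤ 2 * δ * s ^ 3 * K + 2 * δ * s ^ 3 * K := by gcongr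
    _ = 8 * K * δ * (s * (s ^ 2 / 2)) := by ring
    _ ≤ 8 * K * δ * (s * |B|) := by gcongr

/-- The score `∑ᵢ ∂ₓ log f(x, dᵢ)` of a sample `d₀, …, dₙ₋₁` from a Skellam distribution. -/
def scoreSum (n : ℕ) (d : ℕ → ℤ) (x : ℝ) : ℝ := ∑ i ∈ Finset.range n, skellamScore x (d i)

/-- The derivative of `scoreSum` in the parameter. -/
def scoreDerivSum (n : ℕ) (d : ℕ → ℤ) (x : ℝ) : ℝ :=
  ∑ i ∈ Finset.range n, skellamScoreDeriv x (d i)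

lemma hasDerivAt_scoreSum {x : ℝ} (hx : 0 < x) (n : ℕ) (d : ℕ → ℤ) :
    HasDerivAt (scoreSum n d) (scoreDerivSum n d x) x :=
  .fun_sum fun i _ => hasDerivAt_skellamScore hx (d i)

lemma abs_scoreDerivSum_sub_le {y z : ℝ} (hy : 0 < y) (hz : y / 2 ≤ z) (n : ℕ) (d : ℕ → ℤ) :
    |scoreDerivSum n d z - scoreDerivSum n d y| ≤
      |z - y| / y * ∑ i ∈ Finset.range n, scoreModulus y (d i) := by
  rw [scoreDerivSum, scoreDerivSum, ← Finset.sum_sub_distrib, Finset.mul_sum]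
  exact (Finset.abs_sum_le_sum_abs _ _).trans
    (Finset.sum_le_sum fun i _ => abs_skellamScoreDeriv_sub_le hy hz (d i))

lemma abs_scoreSum_sub_linear_le {x y c : ℝ} (hx : 0 < x) (hy : 0 < y) (n : ℕ) (d : ℕ → ℤ)
    (hc : ∀ z ∈ Set.uIcc y x, |scoreDerivSum n d z - scoreDerivSum n d y| ≤ c) :
    |scoreSum n d x - scoreSum n d y - scoreDerivSum n d y * (x - y)| ≤ c * |x - y| := by
  have hmvt := (convex_uIcc y x).norm_image_sub_le_of_norm_hasDerivWithin_le
    (f := fun z => scoreSum n d z - scoreDerivSum n d y * z) (fun z hz =>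
      ((hasDerivAt_scoreSum ((lt_min hy hx).trans_le hz.1) n d).sub
        (hasDerivAt_const_mul (scoreDerivSum n d y))).hasDerivWithinAt)
    hc Set.left_mem_uIcc Set.right_mem_uIcc
  rw [Real.norm_eq_abs, Real.norm_eq_abs] at hmvt
  convert hmvt using 2
  ring

/-- Deterministic core of the one-step method: `s` plays the role of the square root of the
Fisher information `n * skellamInfo y`. -/
lemma abs_newton_sub_scoreSum_le {s x y δ K M : ℝ} {n : ℕ} {d : ℕ → ℤ} (hs : 0 < s) (hy : 0 < y)
    (hδ : 0 < δ) (hδ' : δ ≤ 1 / 4) (hx : s * |x - y| ≤ K) (hscore : |scoreSum n d y| ≤ K * s)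
    (hderiv : |scoreDerivSum n d y + s ^ 2| ≤ δ * s ^ 2)
    (hmodulus : ∑ i ∈ Finset.range n, scoreModulus y (d i) ≤ M * s ^ 2)
    (htwo : 2 * K ≤ s * y) (hM : K * M ≤ δ * (s * y)) :
    |s * (x - scoreSum n d x / scoreDerivSum n d x - y) - scoreSum n d y / s| ≤ 8 * K * δ := by
  have hxy : |x - y| ≤ y / 2 := by
    refine le_of_mul_le_mul_left ?_ hs
    linarith
  have hmodulus_nonneg : 0 ≤ ∑ i ∈ Finset.range n, scoreModulus y (d i) :=
    Finset.sum_nonneg fun i _ => scoreModulus_nonneg hy (d i)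
  have hM_nonneg : 0 ≤ M :=
    nonneg_of_mul_nonneg_left (hmodulus_nonneg.trans hmodulus) (pow_pos hs 2)
  have hderiv_near (z : ℝ) (hz : |z - y| ≤ |x - y|) :
      |scoreDerivSum n d z - scoreDerivSum n d y| ≤ δ * s ^ 2 := by
    have hz_ge : y / 2 ≤ z := by linarith [(abs_le.1 (hz.trans hxy)).1]
    calc |scoreDerivSum n d z - scoreDerivSum n d y|
        ≤ |z - y| / y * ∑ i ∈ Finset.range n, scoreModulus y (d i) :=
          abs_scoreDerivSum_sub_le hy hz_ge n d
      _ ≤ |x - y| / y * (M * s ^ 2) := by gcongr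
      _ = (s * |x - y|) * M * (s / y) := by ring
      _ ≤ K * M * (s / y) := by gcongr
      _ ≤ δ * (s * y) * (s / y) := by gcongr
      _ = δ * s ^ 2 := by field_simp
  have hx_pos : 0 < x := by linarith [(abs_le.1 hxy).1]
  exact abs_newton_error_le hs hδ' hscore hx hderiv (hderiv_near x le_rfl)
    (abs_scoreSum_sub_linear_le hx_pos hy n d fun z hz =>
      hderiv_near z (Set.abs_sub_left_of_mem_uIcc hz))

section Row

variable {Ω : Type*} [MeasurableSpace Ω] {P : Measure Ω} {D : ℕ → Ω → ℤ} {y : ℝ}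

lemma identDistrib_comp_of_hasLaw {μ : Measure ℤ} (hlaw : ∀ i, HasLaw (D i) μ P) (φ : ℤ → ℝ)
    (i : ℕ) : IdentDistrib (fun ω => φ (D i ω)) (fun ω => φ (D 0 ω)) P P :=
  IdentDistrib.comp ⟨(hlaw i).aemeasurable, (hlaw 0).aemeasurable,
    (hlaw i).map_eq.trans (hlaw 0).map_eq.symm⟩ Measurable.of_discrete

lemma PolyGrowth.memLp_comp {φ : ℤ → ℝ} (hφ : PolyGrowth φ) (hy : 0 < y) {X : Ω → ℤ}
    (hlaw : HasLaw X (skellamMeasure y) P) {p : ℕ} (hp : p ≠ 0) :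
    MemLp (fun ω => φ (X ω)) p P := by
  have hmem : MemLp φ p (skellamMeasure y) := by
    rw [← integrable_norm_rpow_iff (Measurable.of_discrete.aestronglyMeasurable)
      (by exact_mod_cast hp) (by simp)]
    simpa using ((hφ.pow p).integrable hy).norm
  exact (hlaw.map_eq.symm ▸ hmem).comp_of_map hlaw.aemeasurable

lemma integral_comp_of_hasLaw {μ : Measure ℤ} {X : Ω → ℤ} (hlaw : HasLaw X μ P) (φ : ℤ → ℝ) :
    ∫ ω, φ (X ω) ∂P = ∫ k, φ k ∂μ :=
  hlaw.integral_comp Measurable.of_discrete.aestronglyMeasurable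

variable (hy : 0 < y) (hlaw : ∀ i, HasLaw (D i) (skellamMeasure y) P) {n : ℕ} (hn : 0 < n)
include hy hlaw

lemma PolyGrowth.measureReal_ge_sum_le {φ : ℤ → ℝ} (hφ : PolyGrowth φ) (hnonneg : ∀ k, 0 ≤ φ k)
    (n : ℕ) {c : ℝ} (hc : 0 < c) :
    P.real {ω | c ≤ ∑ i ∈ Finset.range n, φ (D i ω)} ≤ n * (∫ k, φ k ∂skellamMeasure y) / c := by
  rw [← integral_comp_of_hasLaw (hlaw 0)]
  refine measureReal_ge_sum_range_le (identDistrib_comp_of_hasLaw hlaw φ) ?_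
    (fun i ω => hnonneg (D i ω)) n hc
  exact memLp_one_iff_integrable.1 (mod_cast hφ.memLp_comp hy (hlaw 0) one_ne_zero)

variable [IsProbabilityMeasure P] (hindep : iIndepFun D P)
include hindep

lemma PolyGrowth.measureReal_ge_abs_sum_sub_le {φ : ℤ → ℝ} (hφ : PolyGrowth φ) (n : ℕ) {c : ℝ}
    (hc : 0 < c) :
    P.real {ω | c ≤ |∑ i ∈ Finset.range n, φ (D i ω) - n * ∫ k, φ k ∂skellamMeasure y|} ≤
      n * (∫ k, φ k ^ 2 ∂skellamMeasure y) / c ^ 2 := by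
  rw [← integral_comp_of_hasLaw (hlaw 0), ← integral_comp_of_hasLaw (hlaw 0) fun k => φ k ^ 2]
  exact measureReal_ge_abs_sum_range_sub_le (hindep.comp _ fun _ => Measurable.of_discrete)
    (identDistrib_comp_of_hasLaw hlaw φ) (mod_cast hφ.memLp_comp hy (hlaw 0) two_ne_zero) n hc

include hn

lemma measureReal_ge_abs_scoreSum_le {K : ℝ} (hK : 0 < K) :
    P.real {ω | K * √(n * skellamInfo y) ≤ |scoreSum n (D · ω) y|} ≤ 1 / K ^ 2 := by
  have hJ := skellamInfo_pos hy
  have hchebyshev := (polyGrowth_skellamScore hy).measureReal_ge_abs_sum_sub_le hy hlaw hindep n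
    (c := K * √(n * skellamInfo y)) (by positivity)
  rw [integral_skellamScore hy, mul_zero] at hchebyshev
  simp only [sub_zero] at hchebyshev
  refine hchebyshev.trans_eq ?_
  rw [← skellamInfo, mul_pow, Real.sq_sqrt (by positivity)]
  field_simp

lemma measureReal_ge_abs_scoreDerivSum_add_le {δ : ℝ} (hδ : 0 < δ) :
    P.real {ω | δ * (n * skellamInfo y) ≤ |scoreDerivSum n (D · ω) y + n * skellamInfo y|} ≤
      (∫ k, skellamScoreDeriv y k ^ 2 ∂skellamMeasure y) / (n * skellamInfo y ^ 2 * δ ^ 2) := by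
  have hJ := skellamInfo_pos hy
  have hchebyshev := (polyGrowth_skellamScoreDeriv hy).measureReal_ge_abs_sum_sub_le hy hlaw hindep
    n (c := δ * (n * skellamInfo y)) (by positivity)
  rw [integral_skellamScoreDeriv hy, ← skellamInfo] at hchebyshev
  simp only [mul_neg, sub_neg_eq_add] at hchebyshev
  refine hchebyshev.trans_eq ?_
  field_simp

omit [IsProbabilityMeasure P] hindep in
lemma measureReal_ge_sum_scoreModulus_le {M : ℝ} (hM : 0 < M) :
    P.real {ω | M * (n * skellamInfo y) ≤ ∑ i ∈ Finset.range n, scoreModulus y (D i ω)} ≤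
      (∫ k, scoreModulus y k ∂skellamMeasure y) / (M * skellamInfo y) := by
  have hJ := skellamInfo_pos hy
  refine ((polyGrowth_scoreModulus y).measureReal_ge_sum_le hy hlaw (scoreModulus_nonneg hy) n
    (by positivity)).trans_eq ?_
  field_simp

lemma measureReal_ge_abs_sub_of_quadraticVariation_le {x : Ω → ℝ} (hx : ∀ ω, |x ω - y| ≤
      (|∑ i ∈ Finset.range n, (D i ω : ℝ) ^ 2 - n * y| + y) / n) {K : ℝ} (hK : 0 < K) :
    P.real {ω | K ≤ √(n * skellamInfo y) * |x ω - y|} ≤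
      12 * (y * (1 + y) * skellamInfo y) / K ^ 2 := by
  have hJ := skellamInfo_pos hy
  have hn_one : (1 : ℝ) ≤ n := by exact_mod_cast hn
  set s := √(n * skellamInfo y)
  have hs_pos : 0 < s := by positivity
  have hs_sq : s ^ 2 = n * skellamInfo y := Real.sq_sqrt (by positivity)
  rcases lt_or_ge (n * K) (2 * (s * y)) with hlt | hge
  · refine measureReal_le_one.trans ?_
    rw [one_le_div₀ (by positivity)]
    have hsq : (n * K) ^ 2 ≤ n ^ 2 * (4 * (y ^ 2 * skellamInfo y)) := by
      calc (n * K) ^ 2 ≤ (2 * (s * y)) ^ 2 := by gcongr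
        _ = n * 1 * (4 * (y ^ 2 * skellamInfo y)) := by rw [mul_pow, mul_pow, hs_sq]; ring
        _ ≤ n * n * (4 * (y ^ 2 * skellamInfo y)) := by gcongr
        _ = n ^ 2 * (4 * (y ^ 2 * skellamInfo y)) := by ring
    rw [mul_pow] at hsq
    nlinarith [le_of_mul_le_mul_left hsq (by positivity), mul_pos hy hJ, mul_pos (mul_pos hy hy) hJ]
  · have hchebyshev := (PolyGrowth.cast.pow 2).measureReal_ge_abs_sum_sub_le hy hlaw hindep n
      (c := n * K / (2 * s)) (by positivity)
    simp only [integral_cast_sq hy, ← pow_mul, integral_cast_pow_four hy] at hchebyshev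
    calc P.real {ω | K ≤ s * |x ω - y|}
        ≤ P.real {ω | n * K / (2 * s) ≤ |∑ i ∈ Finset.range n, (D i ω : ℝ) ^ 2 - n * y|} := by
          refine measureReal_mono fun ω (hω : K ≤ s * |x ω - y|) => ?_
          have hbound := hω.trans (mul_le_mul_of_nonneg_left (hx ω) hs_pos.le)
          rw [mul_div_assoc', le_div_iff₀ (by positivity)] at hbound
          rw [Set.mem_ofPred_eq, div_le_iff₀ (by positivity)]
          linarith
      _ ≤ n * (3 * y ^ 2 + y) / (n * K / (2 * s)) ^ 2 := hchebyshev
      _ = 4 * (3 * y ^ 2 + y) * skellamInfo y / K ^ 2 := by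
          rw [div_pow, mul_pow 2 s, hs_sq]
          field_simp
          ring
      _ ≤ 12 * (y * (1 + y) * skellamInfo y) / K ^ 2 := by
          refine div_le_div_of_nonneg_right ?_ (sq_nonneg K)
          nlinarith [mul_pos hy hJ]

lemma measureReal_newton_error_gt_le {x Y : Ω → ℝ} {δ K M : ℝ} (hδ : 0 < δ) (hδ' : δ ≤ 1 / 4)
    (hK : 0 < K) (hM : 0 < M) (htwo : 2 * K ≤ √(n * skellamInfo y) * y)
    (hKM : K * M ≤ δ * (√(n * skellamInfo y) * y))
    (hx : ∀ ω, |x ω - y| ≤ (|∑ i ∈ Finset.range n, (D i ω : ℝ) ^ 2 - n * y| + y) / n)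
    (hY : ∀ ω, 0 < x ω → Y ω = x ω - scoreSum n (D · ω) (x ω) / scoreDerivSum n (D · ω) (x ω)) :
    P.real {ω | 8 * K * δ <
      |√(n * skellamInfo y) * (Y ω - y) - scoreSum n (D · ω) y / √(n * skellamInfo y)|} ≤
      12 * (y * (1 + y) * skellamInfo y) / K ^ 2 + 1 / K ^ 2 +
        (∫ k, skellamScoreDeriv y k ^ 2 ∂skellamMeasure y) / (n * skellamInfo y ^ 2 * δ ^ 2) +
        (∫ k, scoreModulus y k ∂skellamMeasure y) / (M * skellamInfo y) := by
  have hJ := skellamInfo_pos hy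
  set s := √(n * skellamInfo y)
  have hs : 0 < s := by positivity
  have hs_sq : s ^ 2 = n * skellamInfo y := Real.sq_sqrt (by positivity)
  have hsubset : {ω | 8 * K * δ < |s * (Y ω - y) - scoreSum n (D · ω) y / s|} ⊆
      {ω | K ≤ s * |x ω - y|} ∪ {ω | K * s ≤ |scoreSum n (D · ω) y|} ∪
        {ω | δ * (n * skellamInfo y) ≤ |scoreDerivSum n (D · ω) y + n * skellamInfo y|} ∪
        {ω | M * (n * skellamInfo y) ≤ ∑ i ∈ Finset.range n, scoreModulus y (D i ω)} := by
    intro ω hω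
    contrapose! hω
    simp only [Set.mem_union, Set.mem_ofPred_eq, not_or, not_le, ← hs_sq] at hω ⊢
    obtain ⟨⟨⟨hxω, hscore⟩, hderiv⟩, hmodulus⟩ := hω
    have hx_pos : 0 < x ω := by
      have hxy : |x ω - y| < y := lt_of_mul_lt_mul_left (by linarith) hs.le
      linarith [(abs_lt.1 hxy).1]
    rw [not_lt, hY ω hx_pos]
    exact abs_newton_sub_scoreSum_le hs hy hδ hδ' hxω.le hscore.le hderiv.le hmodulus.le htwo hKM
  refine (measureReal_mono hsubset).trans ((measureReal_union_le _ _).trans ?_)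
  refine add_le_add ((measureReal_union_le _ _).trans ?_)
    (measureReal_ge_sum_scoreModulus_le hy hlaw hn hM)
  refine add_le_add ((measureReal_union_le _ _).trans ?_)
    (measureReal_ge_abs_scoreDerivSum_add_le hy hlaw hn hindep hδ)
  exact add_le_add (measureReal_ge_abs_sub_of_quadraticVariation_le hy hlaw hn hindep hx hK)
    (measureReal_ge_abs_scoreSum_le hy hlaw hn hindep hK)

end Row

lemma exists_pow_le_sqrt_mul_skellamInfo : ∃ C, ∀ n y r : ℝ, 0 < y → C ≤ r →
    r ^ 10 = n / (1 + 1 / y) → r ^ 4 ≤ √(n * skellamInfo y) * y := by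
  obtain ⟨C, _, hbound⟩ := exists_inv_le_mul_skellamInfo
  refine ⟨max 1 C, fun n y r hy hr hn => ?_⟩
  have hr_one : 1 ≤ r := (le_max_left _ _).trans hr
  have hCr : C ≤ r ^ 2 := ((le_max_right _ _).trans hr).trans (le_self_pow₀ hr_one two_ne_zero)
  have hn_eq : n = r ^ 10 * (1 + 1 / y) := by rw [hn]; field_simp
  have hinfo : 1 ≤ r ^ 2 * (y * (1 + y) * skellamInfo y) := by
    have hy_inv := hbound y hy
    rw [div_le_iff₀ (by positivity)] at hy_inv
    calc 1 ≤ C * skellamInfo y * (y * (1 + y)) := hy_inv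
      _ = C * (y * (1 + y) * skellamInfo y) := by ring
      _ ≤ r ^ 2 * (y * (1 + y) * skellamInfo y) := by
        have := skellamInfo_pos hy
        gcongr
  rw [← div_le_iff₀ hy]
  refine Real.le_sqrt_of_sq_le ?_
  calc (r ^ 4 / y) ^ 2 = r ^ 8 / y ^ 2 * 1 := by field_simp
    _ ≤ r ^ 8 / y ^ 2 * (r ^ 2 * (y * (1 + y) * skellamInfo y)) := by gcongr
    _ = n * skellamInfo y := by rw [hn_eq]; field_simp; ring

lemma exists_newton_error_bound_le : ∃ C, ∀ n y r : ℝ, 0 < y → 1 ≤ r →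
    r ^ 10 = n / (1 + 1 / y) →
    12 * (y * (1 + y) * skellamInfo y) / r ^ 2 + 1 / r ^ 2 +
      (∫ k, skellamScoreDeriv y k ^ 2 ∂skellamMeasure y) /
        (n * skellamInfo y ^ 2 * (1 / r ^ 2) ^ 2) +
      (∫ k, scoreModulus y k ∂skellamMeasure y) / (r * skellamInfo y) ≤ C / r := by
  obtain ⟨A, hA⟩ := exists_mul_one_add_mul_skellamInfo_le
  obtain ⟨B, hB⟩ := exists_integral_skellamScoreDeriv_sq_le
  obtain ⟨M, hM⟩ := exists_integral_scoreModulus_le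
  refine ⟨12 * A + 1 + B + M, fun n y r hy hr hn => ?_⟩
  have hJ := skellamInfo_pos hy
  have hr_pos : 0 < r := one_pos.trans_le hr
  have hA_nonneg : 0 ≤ A := (hA y hy).trans' (by positivity)
  have hB_nonneg : 0 ≤ B := nonneg_of_mul_nonneg_left
    ((integral_nonneg fun k => sq_nonneg (skellamScoreDeriv y k)).trans (hB y hy)) (by positivity)
  have hn_eq : n = r ^ 10 * (1 + 1 / y) := by rw [hn]; field_simp
  have hsq : 12 * (y * (1 + y) * skellamInfo y) / r ^ 2 ≤ 12 * A / r :=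
    div_le_div₀ (by positivity) (by linarith [hA y hy]) hr_pos (le_self_pow₀ hr two_ne_zero)
  have hone : 1 / r ^ 2 ≤ 1 / r := one_div_le_one_div_of_le hr_pos (le_self_pow₀ hr two_ne_zero)
  have hderiv : (∫ k, skellamScoreDeriv y k ^ 2 ∂skellamMeasure y) /
      (n * skellamInfo y ^ 2 * (1 / r ^ 2) ^ 2) ≤ B / r := by
    calc (∫ k, skellamScoreDeriv y k ^ 2 ∂skellamMeasure y) /
          (n * skellamInfo y ^ 2 * (1 / r ^ 2) ^ 2)
        ≤ B * ((1 + 1 / y) * skellamInfo y ^ 2) / (n * skellamInfo y ^ 2 * (1 / r ^ 2) ^ 2) :=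
          div_le_div_of_nonneg_right (hB y hy) (by rw [hn_eq]; positivity)
      _ = B / r ^ 6 := by rw [hn_eq]; field_simp
      _ ≤ B / r := div_le_div_of_nonneg_left hB_nonneg hr_pos (le_self_pow₀ hr (by norm_num))
  have hmodulus : (∫ k, scoreModulus y k ∂skellamMeasure y) / (r * skellamInfo y) ≤ M / r := by
    rw [div_le_div_iff₀ (by positivity) hr_pos]
    calc (∫ k, scoreModulus y k ∂skellamMeasure y) * r ≤ M * skellamInfo y * r := by
          gcongr
          exact hM y hy
      _ = M * (r * skellamInfo y) := by ring
  simp only [add_div]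
  exact add_le_add (add_le_add (add_le_add hsq hone) hderiv) hmodulus

section Array

variable {Ω : Type*} [MeasurableSpace Ω] {P : Measure Ω} [IsProbabilityMeasure P] {ι : Type*}
  {l : Filter ι} {D : ι → ℕ → Ω → ℤ} {y : ι → ℝ} {n : ι → ℕ}
  (hindep : ∀ T, iIndepFun (D T) P) (hlaw : ∀ T i, HasLaw (D T i) (skellamMeasure (y T)) P)
  (hy : ∀ᶠ T in l, 0 < y T) (hn : Tendsto (fun T => n T / (1 + 1 / y T)) l atTop)
include hy hn

omit [IsProbabilityMeasure P] in
lemma tendsto_atTop_of_tendsto_div_one_add : Tendsto n l atTop := by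
  refine tendsto_natCast_atTop_iff.1 (tendsto_atTop_mono' l ?_ hn)
  filter_upwards [hy] with T hyT
  exact div_le_self (by positivity) (le_add_of_nonneg_right (by positivity))

lemma tendsto_mul_integral_standardized_score_pow_four :
    Tendsto (fun T => n T * ∫ k, (skellamScore (y T) k / √(n T * skellamInfo (y T))) ^ 4
      ∂skellamMeasure (y T)) l (𝓝 0) := by
  obtain ⟨C, hC⟩ := exists_integral_skellamScore_pow_four_le
  refine squeeze_zero' (Eventually.of_forall fun T => by positivity) ?_
    (tendsto_const_nhds (x := C).div_atTop hn)
  filter_upwards [hy, (tendsto_atTop_of_tendsto_div_one_add hy hn).eventually_gt_atTop 0]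
    with T hyT hnT
  have hJ := skellamInfo_pos hyT
  have hroot : √(n T * skellamInfo (y T)) ^ 4 = (n T * skellamInfo (y T)) ^ 2 := by
    rw [show 4 = 2 * 2 from rfl, pow_mul, Real.sq_sqrt (by positivity)]
  simp only [div_pow, integral_div, hroot]
  calc n T * ((∫ k, skellamScore (y T) k ^ 4 ∂skellamMeasure (y T)) /
        (n T * skellamInfo (y T)) ^ 2)
      ≤ n T * (C * ((1 + 1 / y T) * skellamInfo (y T) ^ 2) / (n T * skellamInfo (y T)) ^ 2) := by
        gcongr
        exact hC (y T) hyT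
    _ = C / (n T / (1 + 1 / y T)) := by field_simp

include hindep hlaw

lemma tendstoInDistribution_scoreSum [l.IsCountablyGenerated] :
    TendstoInDistribution
      (fun T ω => scoreSum (n T) (D T · ω) (y T) / √(n T * skellamInfo (y T))) l (id : ℝ → ℝ)
      (fun _ => P) (gaussianReal 0 1) := by
  have hn_atTop := tendsto_atTop_of_tendsto_div_one_add hy hn
  set φ : ι → ℤ → ℝ := fun T k => skellamScore (y T) k / √(n T * skellamInfo (y T))
  simp only [scoreSum, Finset.sum_div]
  refine tendstoInDistribution_sum_of_lyapunov (X := fun T i ω => φ T (D T i ω))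
    (fun T => (hindep T).comp (fun _ => φ T) fun _ => .of_discrete)
    (fun T => identDistrib_comp_of_hasLaw (hlaw T) (φ T)) ?_ ?_ ?_ hn_atTop ?_
  · filter_upwards [hy] with T hyT
    exact mod_cast ((polyGrowth_skellamScore hyT).div_const _).memLp_comp hyT (hlaw T 0)
      four_ne_zero
  · filter_upwards [hy] with T hyT
    rw [integral_comp_of_hasLaw (hlaw T 0), integral_div, integral_skellamScore hyT, zero_div]
  · filter_upwards [hy, hn_atTop.eventually_gt_atTop 0] with T hyT hnT
    have hJ := skellamInfo_pos hyT
    rw [integral_comp_of_hasLaw (hlaw T 0) fun k => φ T k ^ 2]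
    have hroot : √(n T * skellamInfo (y T)) ^ 2 = n T * skellamInfo (y T) :=
      Real.sq_sqrt (by positivity)
    simp only [φ, div_pow, integral_div, hroot]
    rw [← skellamInfo]
    field_simp
  · simp only [fun T => integral_comp_of_hasLaw (hlaw T 0) fun k => φ T k ^ 4]
    exact tendsto_mul_integral_standardized_score_pow_four hy hn

variable {x Y : ι → Ω → ℝ}
  (hx : ∀ᶠ T in l, ∀ ω, |x T ω - y T| ≤
    (|∑ i ∈ Finset.range (n T), (D T i ω : ℝ) ^ 2 - n T * y T| + y T) / n T)
  (hY : ∀ᶠ T in l, ∀ ω, 0 < x T ω → Y T ω = x T ω -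
    scoreSum (n T) (D T · ω) (x T ω) / scoreDerivSum (n T) (D T · ω) (x T ω))
include hx hY

lemma tendstoInMeasure_newton_sub_scoreSum :
    TendstoInMeasure P (fun T ω => √(n T * skellamInfo (y T)) * (Y T ω - y T) -
      scoreSum (n T) (D T · ω) (y T) / √(n T * skellamInfo (y T))) l (fun _ => 0) := by
  obtain ⟨A, hA⟩ := exists_pow_le_sqrt_mul_skellamInfo
  obtain ⟨C, hC⟩ := exists_newton_error_bound_le
  set r : ι → ℝ := fun T => (n T / (1 + 1 / y T)) ^ (1 / 10 : ℝ)
  have hr : Tendsto r l atTop := (tendsto_rpow_atTop (by norm_num)).comp hn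
  refine tendstoInMeasure_iff_measureReal_norm.2 fun ε hε =>
    squeeze_zero' (Eventually.of_forall fun T => measureReal_nonneg) ?_
      (tendsto_const_nhds (x := C).div_atTop hr)
  filter_upwards [hy, hx, hY, (tendsto_atTop_of_tendsto_div_one_add hy hn).eventually_gt_atTop 0,
    hr.eventually_ge_atTop 2, hr.eventually_ge_atTop A,
    (tendsto_const_nhds (x := (8 : ℝ)).div_atTop hr).eventually_lt_const hε]
    with T hyT hxT hYT hnT htwo hAT hεT
  have hr_pos : 0 < r T := two_pos.trans_le htwo
  have hr_pow : r T ^ 10 = n T / (1 + 1 / y T) := by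
    rw [← Real.rpow_natCast, ← Real.rpow_mul (by positivity)]
    norm_num
  have hscale := hA _ _ _ hyT hAT hr_pow
  refine (measureReal_mono fun ω hω => ?_).trans ((measureReal_newton_error_gt_le hyT (hlaw T) hnT
    (hindep T) (δ := 1 / r T ^ 2) (K := r T) (M := r T) (by positivity) ?_ hr_pos hr_pos ?_ ?_
    hxT hYT).trans (hC _ _ _ hyT (by linarith) hr_pow))
  · rw [Set.mem_ofPred_eq, sub_zero, Real.norm_eq_abs] at hω
    refine lt_of_lt_of_le (lt_of_eq_of_lt ?_ hεT) hω
    field_simp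
  · exact one_div_le_one_div_of_le (by norm_num) (by nlinarith)
  · refine hscale.trans' ?_
    nlinarith [pow_le_pow_left₀ zero_le_two htwo 3]
  · refine (mul_le_mul_of_nonneg_left hscale (by positivity)).trans' (le_of_eq ?_)
    field_simp

theorem tendstoInDistribution_newton [l.IsCountablyGenerated]
    (hY_meas : ∀ T, AEMeasurable (Y T) P) :
    TendstoInDistribution (fun T ω => √(n T * skellamInfo (y T)) * (Y T ω - y T)) l (id : ℝ → ℝ)
      (fun _ => P) (gaussianReal 0 1) :=
  tendstoInDistribution_of_tendstoInMeasure_sub _ _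
    (tendstoInDistribution_scoreSum hindep hlaw hy hn)
    (tendstoInMeasure_newton_sub_scoreSum hindep hlaw hy hn hx hY)
    fun T => ((hY_meas T).sub_const _).const_mul _

end Array

/-! ### The one-step estimator -/

/-- The `i`-th increment of `X` over the sampling grid of mesh `Δ`, indexed from `0`. -/
def increment {Ω : Type*} (X : ℝ≥0 → Ω → ℤ) (Δ : ℝ≥0) (i : ℕ) (ω : Ω) : ℤ :=
  X ((i + 1 : ℕ) * Δ) ω - X (i * Δ) ω

lemma osEstimator_congr {f : ℝ → ℤ → ℝ} {T Δ : ℝ≥0} {x x' : ℕ → ℤ}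
    (hx : ∀ i ≤ numObs T Δ, x i = x' i) : osEstimator f T Δ x = osEstimator f T Δ x' := by
  have hsum (g : ℤ → ℝ) : ∑ i ∈ Finset.range (numObs T Δ), g (x (i + 1) - x i) =
      ∑ i ∈ Finset.range (numObs T Δ), g (x' (i + 1) - x' i) := by
    refine Finset.sum_congr rfl fun i hi => ?_
    have hi' := Finset.mem_range.1 hi
    rw [hx i hi'.le, hx (i + 1) hi']
  have hqv : qvEstimator T Δ x = qvEstimator T Δ x' := by
    rw [qvEstimator, qvEstimator, hsum fun d => (d : ℝ) ^ 2]
  rw [osEstimator, osEstimator, hqv, hsum (score f _), hsum (scoreDeriv f _)]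

-- No regularity of `f` is needed: the estimator is a function of finitely many integers.
lemma measurable_osEstimator {Ω : Type*} [MeasurableSpace Ω] {Z : ℕ → Ω → ℤ}
    (hZ : ∀ i, Measurable (Z i)) (f : ℝ → ℤ → ℝ) (T Δ : ℝ≥0) :
    Measurable fun ω => osEstimator f T Δ fun i => Z i ω := by
  let estimator (v : Fin (numObs T Δ + 1) → ℤ) : ℝ :=
    osEstimator f T Δ fun i => v (Fin.ofNat _ i)
  have hfinite : (fun ω => osEstimator f T Δ fun i => Z i ω) =
      estimator ∘ fun ω (i : Fin (numObs T Δ + 1)) => Z i ω := by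
    ext ω
    refine osEstimator_congr fun i hi => ?_
    change Z i ω = Z (Fin.ofNat (numObs T Δ + 1) i : ℕ) ω
    rw [Fin.val_ofNat, Nat.mod_eq_of_lt (Nat.lt_succ_of_le hi)]
  rw [hfinite]
  exact Measurable.of_discrete.comp (measurable_pi_lambda _ fun i => hZ i)

lemma abs_qvEstimator_sub_le {T Δ : ℝ≥0} {ϑ : ℝ} (hΔ : 0 < Δ) (hn : 0 < numObs T Δ) (hϑ : 0 ≤ ϑ)
    (x : ℕ → ℤ) :
    |Δ * qvEstimator T Δ x - ϑ * Δ| ≤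
      (|∑ i ∈ Finset.range (numObs T Δ), ((x (i + 1) - x i : ℤ) : ℝ) ^ 2 -
        numObs T Δ * (ϑ * Δ)| + ϑ * Δ) / numObs T Δ := by
  set S := ∑ i ∈ Finset.range (numObs T Δ), ((x (i + 1) - x i : ℤ) : ℝ) ^ 2
  have hfloor_le : (numObs T Δ : ℝ) * Δ ≤ T := by
    exact_mod_cast (le_div_iff₀ hΔ).1 (Nat.floor_le zero_le)
  have hlt_floor : (T : ℝ) < (numObs T Δ + 1) * Δ := by
    exact_mod_cast (div_lt_iff₀ hΔ).1 (Nat.lt_floor_add_one (T / Δ))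
  have hT : (0 : ℝ) < T := hfloor_le.trans_lt' (by positivity)
  have hmesh : (Δ : ℝ) / T ≤ 1 / numObs T Δ := by
    rw [div_le_div_iff₀ hT (by positivity)]
    linarith
  have hremainder : |((T : ℝ) - numObs T Δ * Δ) / T| ≤ 1 / numObs T Δ := by
    rw [abs_of_nonneg (div_nonneg (by linarith) hT.le)]
    exact (div_le_div_of_nonneg_right (by linarith) hT.le).trans hmesh
  calc |Δ * qvEstimator T Δ x - ϑ * Δ|
      = |Δ / T * (S - numObs T Δ * (ϑ * Δ)) - ϑ * Δ * (((T : ℝ) - numObs T Δ * Δ) / T)| := by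
        rw [qvEstimator]
        congr 1
        field_simp
        ring
    _ ≤ |Δ / T * (S - numObs T Δ * (ϑ * Δ))| + |ϑ * Δ * (((T : ℝ) - numObs T Δ * Δ) / T)| :=
        abs_sub _ _
    _ = Δ / T * |S - numObs T Δ * (ϑ * Δ)| + ϑ * Δ * |((T : ℝ) - numObs T Δ * Δ) / T| := by
        rw [abs_mul, abs_mul, abs_of_nonneg (by positivity : 0 ≤ (Δ / T : ℝ)),
          abs_of_nonneg (by positivity : 0 ≤ ϑ * Δ)]
    _ ≤ 1 / numObs T Δ * |S - numObs T Δ * (ϑ * Δ)| + ϑ * Δ * (1 / numObs T Δ) := by gcongr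
    _ = (|S - numObs T Δ * (ϑ * Δ)| + ϑ * Δ) / numObs T Δ := by ring

lemma AsympStandardNormal.congr_normalisation {Ω : Type*} [MeasurableSpace Ω] {P : Measure Ω}
    [IsProbabilityMeasure P] {a b : ℝ≥0 → ℝ} {Y : ℝ≥0 → Ω → ℝ} {ϑ : ℝ}
    (h : AsympStandardNormal P a Y ϑ) (hY : ∀ T, AEMeasurable (Y T) P)
    (hab : Tendsto (fun T => b T / a T) atTop (𝓝 1)) : AsympStandardNormal P b Y ϑ := by
  have hroot : Tendsto (fun T => √(b T / a T)) atTop (𝓝 1) := by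
    simpa only [Real.sqrt_one] using hab.sqrt
  have hroot_measure : TendstoInMeasure P (fun (T : ℝ≥0) (_ : Ω) => √(b T / a T)) atTop
      (fun _ => 1) := by
    refine tendstoInMeasure_iff_dist.2 fun ε hε => tendsto_const_nhds.congr' ?_
    filter_upwards [Metric.tendsto_nhds.1 hroot ε hε] with T hT
    simp [hT.not_ge]
  have hslutsky := h.continuous_comp_prodMk_of_tendstoInMeasure_const
    (g := fun p : ℝ × ℝ => p.1 * p.2) (by fun_prop) hroot_measure fun _ => aemeasurable_const
  simp only [id, mul_one] at hslutsky
  refine tendstoInDistribution_of_tendstoInMeasure_sub _ (id : ℝ → ℝ) hslutsky ?_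
    fun T => ((hY T).sub_const ϑ).const_mul _
  refine tendstoInMeasure_iff_norm.2 fun ε hε => tendsto_const_nhds.congr' ?_
  filter_upwards [hab.eventually_const_lt one_pos] with T hT
  have hsplit : √(b T) = √(a T) * √(b T / a T) := by
    rw [← Real.sqrt_mul' _ hT.le, mul_div_cancel₀ _ fun ha => by simp [ha] at hT]
  have hzero (ω : Ω) : √(b T) * (Y T ω - ϑ) - √(a T) * (Y T ω - ϑ) * √(b T / a T) = 0 := by
    rw [hsplit]
    ring
  simp [hzero, hε.not_ge]

lemma tendsto_numObs_div {Δ : ℝ≥0 → ℝ≥0} (hu : Tendsto (fun T => T / Δ T) atTop atTop) :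
    Tendsto (fun T => (numObs T (Δ T) : ℝ) / (T / Δ T)) atTop (𝓝 1) := by
  refine (tendsto_nat_floor_div_atTop.comp (NNReal.tendsto_coe_atTop.2 hu)).congr fun T => ?_
  rw [Function.comp, numObs, ← NNReal.coe_div]
  congr 2

lemma tendsto_numObs_div_one_add {Δ : ℝ≥0 → ℝ≥0} {ϑ : ℝ} (hϑ : 0 < ϑ)
    (hΔ : ∀ᶠ T in atTop, 0 < Δ T) (hu : Tendsto (fun T => T / Δ T) atTop atTop) :
    Tendsto (fun T => numObs T (Δ T) / (1 + 1 / (ϑ * Δ T))) atTop atTop := by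
  have hu_inv : Tendsto (fun T : ℝ≥0 => ((T : ℝ) / Δ T)⁻¹) atTop (𝓝 0) :=
    tendsto_inv_atTop_zero.comp (mod_cast NNReal.tendsto_coe_atTop.2 hu)
  have hT_inv : Tendsto (fun T : ℝ≥0 => (ϑ * T)⁻¹) atTop (𝓝 0) :=
    tendsto_inv_atTop_zero.comp ((NNReal.tendsto_coe_atTop.2 tendsto_id).const_mul_atTop hϑ)
  have hsum : Tendsto (fun T : ℝ≥0 => ((T : ℝ) / Δ T)⁻¹ + (ϑ * T)⁻¹) atTop (𝓝[>] 0) := by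
    refine tendsto_nhdsWithin_iff.2 ⟨by simpa only [add_zero] using hu_inv.add hT_inv, ?_⟩
    filter_upwards [eventually_gt_atTop 0, hΔ] with T hT hΔT
    exact Set.mem_Ioi.2 (by positivity)
  refine ((tendsto_numObs_div hu).pos_mul_atTop one_pos hsum.inv_tendsto_nhdsGT_zero).congr' ?_
  filter_upwards [eventually_gt_atTop 0, hΔ] with T hT hΔT
  simp only [Pi.inv_apply]
  field_simp

section

variable {Ω : Type*} [MeasurableSpace Ω] {N : ℝ≥0 → Ω → ℕ} {ε : ℕ → Ω → ℤ} {ϑ : ℝ}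

section

variable {P : Measure Ω} [IsProbabilityMeasure P] (h : IsModel N ε ϑ P) (hϑ : 0 ≤ ϑ) (Δ : ℝ≥0)
include h hϑ

lemma IsModel.iIndepFun_increment : iIndepFun (increment (process N ε) Δ) P :=
  h.iIndepFun_increments hϑ (t := fun i => i * Δ) (Nat.mono_cast.mul_const zero_le)

lemma IsModel.hasLaw_increment_skellam (i : ℕ) :
    HasLaw (increment (process N ε) Δ i) (skellamMeasure (ϑ * Δ)) P := by
  have hle : (i * Δ : ℝ≥0) ≤ (i + 1 : ℕ) * Δ := by gcongr; exact i.le_succ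
  have hlaw := h.hasLaw_increment hϑ hle
  rwa [show ϑ * (((i + 1 : ℕ) * Δ : ℝ≥0) - (i * Δ : ℝ≥0) : ℝ) = ϑ * Δ by push_cast; ring] at hlaw

end

variable {P : ℝ → Measure Ω} [∀ ϑ, IsProbabilityMeasure (P ϑ)]
  (hmodel : ∀ ϑ : ℝ, 0 < ϑ → IsModel N ε ϑ (P ϑ))
include hmodel

lemma mul_oneStep_eq {T Δ : ℝ≥0} (hΔ : 0 < Δ) {ω : Ω} {x : ℝ}
    (hx_eq : x = Δ * qvEstimator T Δ fun i => process N ε (i * Δ) ω) (hx : 0 < x) :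
    Δ * oneStep P (process N ε) T Δ ω =
      x - scoreSum (numObs T Δ) (increment (process N ε) Δ · ω) x /
        scoreDerivSum (numObs T Δ) (increment (process N ε) Δ · ω) x := by
  have hΔ' : (Δ : ℝ) ≠ 0 := by positivity
  have hqv : 0 < qvEstimator T Δ fun i => process N ε (i * Δ) ω :=
    pos_of_mul_pos_right (hx_eq ▸ hx) Δ.2
  simp only [oneStep, osEstimator, score_eq hmodel hqv hΔ, scoreDeriv_eq hmodel hqv hΔ,
    ← Finset.mul_sum, mul_comm _ (Δ : ℝ), ← hx_eq]
  rw [mul_sub, ← hx_eq, sq, mul_assoc, mul_div_mul_left _ _ hΔ', ← mul_div_assoc,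
    mul_div_mul_left _ _ hΔ']
  rfl

omit [∀ ϑ, IsProbabilityMeasure (P ϑ)] in
lemma aemeasurable_oneStep (hϑ : 0 < ϑ) (T Δ : ℝ≥0) :
    AEMeasurable (oneStep P (process N ε) T Δ) (P ϑ) :=
  (measurable_osEstimator (fun i => (hmodel ϑ hϑ).measurable_process (i * Δ)) _ T Δ).aemeasurable

variable {Δ : ℝ≥0 → ℝ≥0} (hϑ : 0 < ϑ) (hΔ : ∀ᶠ T in atTop, 0 < Δ T)
  (hu : Tendsto (fun T => T / Δ T) atTop atTop)
include hϑ hΔ hu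

lemma asympStandardNormal_oneStep_skellamInfo :
    AsympStandardNormal (P ϑ)
      (fun T => numObs T (Δ T) * (Δ T : ℝ) ^ 2 * skellamInfo (ϑ * Δ T))
      (fun T => oneStep P (process N ε) T (Δ T)) ϑ := by
  have hn_div := tendsto_numObs_div_one_add hϑ hΔ hu
  have hy : ∀ᶠ T in atTop, 0 < ϑ * (Δ T : ℝ) := hΔ.mono fun T hΔT => by positivity
  have hn := (tendsto_atTop_of_tendsto_div_one_add hy hn_div).eventually_gt_atTop 0
  have hnewton := tendstoInDistribution_newton
    (fun T => (hmodel ϑ hϑ).iIndepFun_increment hϑ.le (Δ T))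
    (fun T => (hmodel ϑ hϑ).hasLaw_increment_skellam hϑ.le (Δ T)) hy hn_div
    (x := fun T ω => Δ T * qvEstimator T (Δ T) fun i => process N ε (i * Δ T) ω)
    (Y := fun T ω => Δ T * oneStep P (process N ε) T (Δ T) ω)
    (by filter_upwards [hΔ, hn] with T hΔT hnT ω using abs_qvEstimator_sub_le hΔT hnT hϑ.le _)
    (by filter_upwards [hΔ] with T hΔT ω using mul_oneStep_eq hmodel hΔT rfl)
    (fun T => (aemeasurable_oneStep hmodel hϑ T (Δ T)).const_mul _)
  unfold AsympStandardNormal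
  convert hnewton using 3 with T ω
  beta_reduce
  rw [mul_right_comm, Real.sqrt_mul' _ (by positivity), Real.sqrt_sq (by positivity)]
  ring

lemma asympStandardNormal_oneStep_of_tendsto_div {b : ℝ≥0 → ℝ}
    (hb : Tendsto (fun T => b T / information P (process N ε) T (Δ T) ϑ) atTop (𝓝 1)) :
    AsympStandardNormal (P ϑ) b (fun T => oneStep P (process N ε) T (Δ T)) ϑ := by
  refine (asympStandardNormal_oneStep_skellamInfo hmodel hϑ hΔ hu).congr_normalisation
    (fun T => aemeasurable_oneStep hmodel hϑ T (Δ T)) ?_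
  have hn := (tendsto_numObs_div hu).inv₀ one_ne_zero
  have hprod := hb.mul hn
  rw [inv_one, mul_one] at hprod
  refine hprod.congr' ?_
  filter_upwards [eventually_gt_atTop 0, hΔ] with T hT hΔT
  rw [information_eq hmodel hϑ]
  field_simp

lemma tendsto_fisherInformation_div_information :
    Tendsto (fun T => fisherInformation P (process N ε) T (Δ T) ϑ /
      information P (process N ε) T (Δ T) ϑ) atTop (𝓝 1) := by
  refine (tendsto_numObs_div hu).congr' ?_
  filter_upwards [eventually_gt_atTop 0, hΔ] with T hT hΔT
  have hJ := skellamInfo_pos (by positivity : 0 < ϑ * (Δ T : ℝ))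
  rw [information_eq hmodel hϑ, fisherInformation_eq hmodel hϑ hΔT,
    mul_div_mul_right _ _ hJ.ne']
  field_simp

end

section Regimes

variable {Δ : ℝ≥0 → ℝ≥0}

lemma tendsto_div_atTop_of_eventually_le (hΔ : ∀ᶠ T in atTop, 0 < Δ T) {B : ℝ≥0} (hB : 0 < B)
    (hΔB : ∀ᶠ T in atTop, Δ T ≤ B) : Tendsto (fun T => T / Δ T) atTop atTop := by
  refine tendsto_atTop_mono' _ ?_ (tendsto_id.atTop_div_const hB)
  filter_upwards [hΔ, hΔB] with T hT hTB
  exact div_le_div_of_nonneg_left zero_le hT hTB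

lemma IsMicroscopic.tendsto_div_atTop (h : IsMicroscopic Δ) (hΔ : ∀ᶠ T in atTop, 0 < Δ T) :
    Tendsto (fun T => T / Δ T) atTop atTop :=
  tendsto_div_atTop_of_eventually_le hΔ one_pos (h.eventually_le_const one_pos)

lemma IsIntermediate.tendsto_div_atTop {Δinf : ℝ≥0} (h : IsIntermediate Δ Δinf)
    (hΔ : ∀ᶠ T in atTop, 0 < Δ T) : Tendsto (fun T => T / Δ T) atTop atTop :=
  tendsto_div_atTop_of_eventually_le hΔ (add_pos_of_pos_of_nonneg h.1 zero_le)
    (h.2.eventually_le_const (lt_add_of_pos_right Δinf one_pos))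

variable {Ω : Type*} [MeasurableSpace Ω] {N : ℝ≥0 → Ω → ℕ} {ε : ℕ → Ω → ℤ} {ϑ : ℝ}
  {P : ℝ → Measure Ω} [∀ ϑ, IsProbabilityMeasure (P ϑ)]
  (hmodel : ∀ ϑ : ℝ, 0 < ϑ → IsModel N ε ϑ (P ϑ)) (hϑ : 0 < ϑ) (hΔ : ∀ᶠ T in atTop, 0 < Δ T)
include hmodel hϑ hΔ

lemma tendsto_div_self_information :
    Tendsto (fun T => information P (process N ε) T (Δ T) ϑ /
      information P (process N ε) T (Δ T) ϑ) atTop (𝓝 1) := by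
  refine tendsto_const_nhds.congr' ?_
  filter_upwards [eventually_gt_atTop 0, hΔ] with T hT hΔT
  have hJ := skellamInfo_pos (by positivity : 0 < ϑ * (Δ T : ℝ))
  rw [information_eq hmodel hϑ, div_self (by positivity)]

lemma IsMicroscopic.tendsto_div_information (h : IsMicroscopic Δ) :
    Tendsto (fun T : ℝ≥0 => T / ϑ / information P (process N ε) T (Δ T) ϑ) atTop (𝓝 1) := by
  have hy : Tendsto (fun T => ϑ * (Δ T : ℝ)) atTop (𝓝[>] 0) := by
    refine tendsto_nhdsWithin_iff.2 ⟨?_, hΔ.mono fun T hT => Set.mem_Ioi.2 (by positivity)⟩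
    simpa only [NNReal.coe_zero, mul_zero] using (NNReal.tendsto_coe.2 h).const_mul ϑ
  have hJ := (tendsto_mul_skellamInfo_zero.comp hy).inv₀ one_ne_zero
  rw [inv_one] at hJ
  refine hJ.congr' ?_
  filter_upwards [eventually_gt_atTop 0, hΔ] with T hT hΔT
  have hJT := skellamInfo_pos (by positivity : 0 < ϑ * (Δ T : ℝ))
  simp only [Function.comp, information_eq hmodel hϑ]
  field_simp

omit hΔ in
lemma IsIntermediate.tendsto_div_information {Δinf : ℝ≥0} (h : IsIntermediate Δ Δinf) :
    Tendsto (fun T => information P (process N ε) T Δinf ϑ /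
      information P (process N ε) T (Δ T) ϑ) atTop (𝓝 1) := by
  have hinf : (0 : ℝ) < Δinf := h.1
  have hlim : Tendsto (fun T => (Δ T : ℝ)) atTop (𝓝 Δinf) := NNReal.tendsto_coe.2 h.2
  have hy : 0 < ϑ * (Δinf : ℝ) := mul_pos hϑ hinf
  have hJ := (continuousAt_skellamInfo hy).tendsto.comp (hlim.const_mul ϑ)
  have hne := (mul_pos hinf (skellamInfo_pos hy)).ne'
  have hratio := (tendsto_const_nhds (x := Δinf * skellamInfo (ϑ * Δinf))).div (hlim.mul hJ) hne
  rw [div_self hne] at hratio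
  refine hratio.congr' ?_
  filter_upwards [eventually_gt_atTop 0] with T hT
  simp only [Function.comp, Pi.div_apply, information_eq hmodel hϑ, mul_assoc]
  rw [mul_div_mul_left _ _ (by positivity)]

lemma tendsto_div_information_of_tendsto_atTop (h : Tendsto Δ atTop atTop) :
    Tendsto (fun T : ℝ≥0 => T / Δ T / (2 * ϑ ^ 2) / information P (process N ε) T (Δ T) ϑ)
      atTop (𝓝 1) := by
  have hy := (NNReal.tendsto_coe_atTop.2 h).const_mul_atTop hϑ
  have hJ := (tendsto_mul_skellamInfo_atTop.comp hy).inv₀ one_ne_zero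
  rw [inv_one] at hJ
  refine hJ.congr' ?_
  filter_upwards [eventually_gt_atTop 0, hΔ] with T hT hΔT
  have hJT := skellamInfo_pos (by positivity : 0 < ϑ * (Δ T : ℝ))
  simp only [Function.comp, information_eq hmodel hϑ]
  field_simp

end Regimes

end TimeScales

end

theorem theorem6_general {Ω : Type*} [MeasurableSpace Ω]
    (P : ℝ → Measure Ω) [∀ ϑ, IsProbabilityMeasure (P ϑ)]
    (N : ℝ≥0 → Ω → ℕ) (ε : ℕ → Ω → ℤ)
    (hmodel : ∀ ϑ : ℝ, 0 < ϑ → TimeScales.IsModel N ε ϑ (P ϑ))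
    (Δ : ℝ≥0 → ℝ≥0) (hΔ : ∀ᶠ T in atTop, 0 < Δ T)
    (hu : Tendsto (fun T => T / Δ T) atTop atTop) (ϑ : ℝ) (hϑ : 0 < ϑ) :
    let X := TimeScales.process N ε
    let Y : ℝ≥0 → Ω → ℝ := fun T => TimeScales.oneStep P X T (Δ T)
    TimeScales.AsympStandardNormal (P ϑ) (fun T => TimeScales.information P X T (Δ T) ϑ) Y ϑ ∧
    TimeScales.AsympStandardNormal (P ϑ) (fun T => TimeScales.fisherInformation P X T (Δ T) ϑ) Y ϑ ∧
    (TimeScales.IsMicroscopic Δ →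
      TimeScales.AsympStandardNormal (P ϑ) (fun T => (T : ℝ) / ϑ) Y ϑ) ∧
    (∀ Δinf : ℝ≥0, TimeScales.IsIntermediate Δ Δinf →
      TimeScales.AsympStandardNormal (P ϑ) (fun T => TimeScales.information P X T Δinf ϑ) Y ϑ) ∧
    (Tendsto Δ atTop atTop →
      TimeScales.AsympStandardNormal (P ϑ) (fun T => (T : ℝ) / (Δ T : ℝ) / (2 * ϑ ^ 2)) Y ϑ) := by
  intro X Y
  have hnormal {b : ℝ≥0 → ℝ} :=
    TimeScales.asympStandardNormal_oneStep_of_tendsto_div hmodel hϑ hΔ hu (b := b)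
  exact ⟨hnormal (TimeScales.tendsto_div_self_information hmodel hϑ hΔ),
    hnormal (TimeScales.tendsto_fisherInformation_div_information hmodel hϑ hΔ hu),
    fun h => hnormal (h.tendsto_div_information hmodel hϑ hΔ),
    fun Δinf h => hnormal (h.tendsto_div_information hmodel hϑ),
    fun h => hnormal (TimeScales.tendsto_div_information_of_tendsto_atTop hmodel hϑ hΔ h)⟩

theorem theorem6 {Ω : Type*} [MeasurableSpace Ω]
    (P : ℝ → Measure Ω) [∀ ϑ, IsProbabilityMeasure (P ϑ)]
    (N : ℝ≥0 → Ω → ℕ) (ε : ℕ → Ω → ℤ)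
    (hmodel : ∀ ϑ : ℝ, 0 < ϑ → TimeScales.IsModel N ε ϑ (P ϑ))
    (Δ : ℝ≥0 → ℝ≥0) (hΔ : ∀ T : ℝ≥0, 0 < T → 0 < Δ T ∧ Δ T ≤ T)
    (ϑ : ℝ) (hϑ : 0 < ϑ) :
    let X := TimeScales.process N ε
    let Y : ℝ≥0 → Ω → ℝ := fun T => TimeScales.oneStep P X T (Δ T)
    -- microscopic regime
    (TimeScales.IsMicroscopic Δ →
      TimeScales.AsympStandardNormal (P ϑ) (fun T => TimeScales.information P X T (Δ T) ϑ) Y ϑ ∧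
      TimeScales.AsympStandardNormal (P ϑ)
        (fun T => TimeScales.fisherInformation P X T (Δ T) ϑ) Y ϑ ∧
      TimeScales.AsympStandardNormal (P ϑ) (fun T => (T : ℝ) / ϑ) Y ϑ) ∧
    -- intermediate regime
    (∀ Δinf : ℝ≥0, TimeScales.IsIntermediate Δ Δinf →
      TimeScales.AsympStandardNormal (P ϑ) (fun T => TimeScales.information P X T (Δ T) ϑ) Y ϑ ∧
      TimeScales.AsympStandardNormal (P ϑ)
        (fun T => TimeScales.fisherInformation P X T (Δ T) ϑ) Y ϑ ∧
      TimeScales.AsympStandardNormal (P ϑ) (fun T => TimeScales.information P X T Δinf ϑ) Y ϑ) ∧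
    -- macroscopic regime
    (TimeScales.IsMacroscopic Δ →
      TimeScales.AsympStandardNormal (P ϑ) (fun T => TimeScales.information P X T (Δ T) ϑ) Y ϑ ∧
      TimeScales.AsympStandardNormal (P ϑ)
        (fun T => TimeScales.fisherInformation P X T (Δ T) ϑ) Y ϑ ∧
      TimeScales.AsympStandardNormal (P ϑ)
        (fun T => (T : ℝ) / (Δ T : ℝ) / (2 * ϑ ^ 2)) Y ϑ) := by
  have hpos : ∀ᶠ T in atTop, 0 < Δ T := (eventually_gt_atTop 0).mono fun T hT => (hΔ T hT).1
  have hgeneral (hu : Tendsto (fun T => T / Δ T) atTop atTop) :=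
    theorem6_general P N ε hmodel Δ hpos hu ϑ hϑ
  exact ⟨fun h => (hgeneral (h.tendsto_div_atTop hpos)).imp_right (.imp_right (·.1 h)),
    fun Δinf h => (hgeneral (h.tendsto_div_atTop hpos)).imp_right (.imp_right (·.2.1 Δinf h)),
    fun h => (hgeneral h.2).imp_right (.imp_right (·.2.2 h.1))⟩
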